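/- **Setting.** Let $V$ be a finite set of $n$ vertices. Every pair of distinct vertices is either a positive or a negative edge; $N_u^+$ denotes the set consisting of $u$ and all vertices joined to $u$ by a positive edge, and $N_u^-=V\setminus N_u^+$. For a partition (clustering) $\mathcal C$ of $V$ let $y_{\mathcal C}(u)$ be the number of edges at $u$ that disagree with $\mathcal C$ (positive edges between different clusters, negative edges inside a cluster). For $1\le p\le\infty$ the cost of $\mathcal C$ is $\|y_{\mathcal C}\|_p$, and $\mathsf{OPT}_p=\min_{\mathcal C}\|y_{\mathcal C}\|_p$. **Online-with-a-sample (AOS) model.** An adversary fixes the signs and an arrival order. Each vertex is put into the sample $S$ independently with probability $\varepsilon\in(0,1)$; $\varepsilon$, $S$ and the signs inside $S$ are known in advance. The vertices of $V\setminus S$ then arrive one by one; an arriving vertex reveals the signs of its edges to $S$ and to all previously arrived vertices, and must at once be irrevocably assigned to a cluster. **Splitting the sample.** Let $x=\varepsilon/2$. Independently for each $v\in S$, put $v$ into exactly the subsamples belonging to a random subset of $\{S_p,S_d,S_b,S_r\}$: each given singleton is chosen with probability $x-3\varepsilon x^2+3\varepsilon^2x^3-\varepsilon^3x^4$, each given pair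 with probability $\varepsilon x^2-2\varepsilon^2x^3+\varepsilon^3x^4$, each given triple with probability $\varepsilon^2x^3-\varepsilon^3x^4$, all four with probability $\varepsilon^3x^4$, and none with the remaining probability. **Algorithm 1.** Put $\delta=\frac{10}{7}$, $c=2\delta^2+\delta$, $r=\frac1{2c\delta^2}$. For $u\ne v$ let $\bar d_{uv}=1-\frac{|N_u^+\cap N_v^+\cap S_d|}{|(N_u^+\cup N_v^+)\cap S_d|}$ (and $\bar d_{uv}=1$ if the denominator is $0$), and let $\bar d_{uu}=0$. A vertex $u$ is *isolated* if $|\{v\in N_u^-\cap S_r:\bar d_{uv}\le\frac7{10}\}|\ge\frac{10}{3}|N_u^+\cap S_d|$. Put $\tilde d_{uu}=0$ and, for $u\neq v$, $\tilde d_{uv}=1$ if $u$ or $v$ is isolated, or if $uv$ is negative with $\bar d_{uv}>\frac7{10}$; otherwise $\tilde d_{uv}=\bar d_{uv}$. Order the elements of $S_p$ (the *centers*) by decreasing value of $|\{v\in S_b:\tilde d_{uv}\le r\}|$, ties broken arbitrarily. Process first the vertices of $S$ in an arbitrary order, then those of $V\setminus S$ as they arrive. When $v$ is processed: 1. if $N_v^+\cap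 S_d\ne\emptyset$ and some center $u$ has $\tilde d_{uv}\le cr$, then $v$ joins the cluster of the earliest such center; 2. if $N_v^+\cap S_d=\emptyset$, then $v$ is clustered by Pivot on the vertices with this property, with the positive edges as clusterable edges; 3. in the remaining case $v$ is clustered by Pivot on the vertices falling under this case, with the positive edges $uw$ with $\tilde d_{uw}<cr$ as clusterable edges. Here Pivot means: if $v$ has a clusterable edge to an earlier pivot, $v$ joins the cluster of the earliest such pivot; otherwise $v$ opens a new cluster and becomes a pivot. **Theorem 1.** Algorithm 1 is an online algorithm in the AOS model: the cluster given to a vertex is determined by $S$, the splitting of $S$, the signs between vertices seen so far, and the order of the arrivals so far. Moreover, there is an absolute constant $K>0$ such that for every $0<\varepsilon<1$, every $n$-vertex instance, every arrival order, every order of the sample vertices and every rule for breaking ties, the single clustering $\mathcal C$ that it produces satisfies (probability and expectation being over $S$ and its splitting): 1. with probability at least $1-\frac1n$, $\ \|y_{\mathcal C}\|_p\le\frac{K}{\varepsilon^8}\log^4 n\cdot\mathsf{OPT}_p$ for all $1\le p<\infty$ simultaneously; 2. with probability at least $1-\frac1n$, $\ \|y_{\mathcal C}\|_\infty\le\frac{K}{\varepsilon^6}\log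 n\cdot\mathsf{OPT}_\infty$; 3. $\mathbb E\,\|y_{\mathcal C}\|_1\le\frac{K}{\varepsilon^6}\cdot\mathsf{OPT}_1$. -/

import Mathlib

open scoped Classical ENNReal

noncomputable section

namespace OnlineCC

/-! ## Correlation clustering

A complete signed graph on the vertex set `V` is given by the graph `G : SimpleGraph V` of its
positive edges; all other pairs of distinct vertices are negative edges. A clustering is a
partition of `V`, that is, a `Setoid V`. -/

section Clustering

variable {V : Type*} [Fintype V]

/-- The edge `uv` disagrees with the clustering `C`: it is positive and cut, or it is negative and
its ends are clustered together. -/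
def Disagrees (G : SimpleGraph V) (C : Setoid V) (u v : V) : Prop :=
  u ≠ v ∧ ((G.Adj u v ∧ ¬ C u v) ∨ (¬ G.Adj u v ∧ C u v))

/-- The number of edges at `u` that disagree with `C`. -/
def disagreements (G : SimpleGraph V) (C : Setoid V) (u : V) : ℕ :=
  (Finset.univ.filter fun v => Disagrees G C u v).card

/-- The `ℓ_p`-norm of the disagreement vector of the clustering `C`. -/
def cost (G : SimpleGraph V) (p : ℝ≥0∞) (C : Setoid V) : ℝ :=
  ‖(WithLp.toLp p fun u => (disagreements G C u : ℝ) : PiLp p fun _ : V => ℝ)‖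

/-- The optimal value of the `ℓ_p`-norm objective. -/
def OPT (G : SimpleGraph V) (p : ℝ≥0∞) : ℝ := ⨅ C : Setoid V, cost G p C

end Clustering

/-! ## Correlation metrics -/

section Metrics

variable {V : Type*} [Fintype V]

/-- The positive neighbourhood of `u`, with the positive self-loop at `u`. -/
def posNbhd (G : SimpleGraph V) (u : V) : Finset V :=
  Finset.univ.filter fun v => v = u ∨ G.Adj u v

/-- The correlation metric on `U`. -/
def corrDist (G : SimpleGraph V) (U : Finset V) (u v : V) : ℝ :=
  if u = v then 0
  else if (posNbhd G u ∪ posNbhd G v) ∩ U = ∅ then 1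
  else 1 - ((posNbhd G u ∩ posNbhd G v ∩ U).card : ℝ) /
    (((posNbhd G u ∪ posNbhd G v) ∩ U).card : ℝ)

/-- The vertex `u` is isolated by the adjusted correlation metric on `U` and `W`. -/
def IsIsolated (G : SimpleGraph V) (U W : Finset V) (u : V) : Prop :=
  (10 / 3 : ℝ) * ((posNbhd G u ∩ U).card : ℝ) ≤
    ((W.filter fun v => v ∉ posNbhd G u ∧ corrDist G U u v ≤ 7 / 10).card : ℝ)

/-- The adjusted correlation metric on `U` and `W`. -/
def adjDist (G : SimpleGraph V) (U W : Finset V) (u v : V) : ℝ :=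
  if u = v then 0
  else if IsIsolated G U W u ∨ IsIsolated G U W v then 1
  else if ¬ G.Adj u v ∧ 7 / 10 < corrDist G U u v then 1
  else corrDist G U u v

end Metrics

/-- The constant `δ = 10/7`. -/
def deltaConst : ℝ := 10 / 7

/-- The constant `c = 2δ² + δ`. -/
def cConst : ℝ := 2 * deltaConst ^ 2 + deltaConst

/-- The radius `r = 1/(2cδ²)`. -/
def rConst : ℝ := 1 / (2 * cConst * deltaConst ^ 2)

/-! ## The Pivot algorithm -/

section Pivot

variable {V : Type*}

/-- Processing the vertices in increasing order of `rank`, the vertex `v` becomes a pivot (that is,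
opens a new cluster) iff no earlier pivot is joined to it by a clusterable edge. -/
def IsPivot (rank : V → ℕ ×ₗ ℕ) (E : V → V → Prop) : V → Prop :=
  (InvImage.wf rank wellFounded_lt).fix fun v pivot =>
    ∀ (w : V) (h : rank w < rank v), E w v → ¬ pivot w h

theorem isPivot_iff (rank : V → ℕ ×ₗ ℕ) (E : V → V → Prop) (v : V) :
    IsPivot rank E v ↔ ∀ w, rank w < rank v → E w v → ¬ IsPivot rank E w := by
  unfold IsPivot
  rw [WellFounded.fix_eq]

/-- The pivots before `v` that are joined to `v` by a clusterable edge. -/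
def earlierPivots (rank : V → ℕ ×ₗ ℕ) (E : V → V → Prop) (v : V) : Set V :=
  {w | rank w < rank v ∧ E w v ∧ IsPivot rank E w}

/-- The pivot whose cluster `v` joins: the earliest one that is joined to `v` by a clusterable
edge, and `v` itself if there is none. -/
def pivotOf (rank : V → ℕ ×ₗ ℕ) (E : V → V → Prop) (v : V) : V :=
  if h : (earlierPivots rank E v).Nonempty then
    Function.argminOn rank (earlierPivots rank E v) h
  else v

end Pivot

/-! ## The main algorithm -/

/-- Names of the four subsamples: centers `p`, distance sample `d`, counting sample `b`, rounding
sample `r`. -/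
inductive Subsample
  | p | d | b | r
  deriving DecidableEq

instance : Fintype Subsample where
  elems := {.p, .d, .b, .r}
  complete := by intro x; cases x <;> simp

section Algorithm

variable {V : Type*} [Fintype V]

/-- The subsample of `S` with name `i`, where `seed v` says in which subsamples `v` is put. -/
def sub (S : Finset V) (seed : V → Subsample → Bool) (i : Subsample) : Finset V :=
  S.filter fun v => seed v i = true

/-- The estimated adjusted correlation metric. -/
def estDist (G : SimpleGraph V) (S : Finset V) (seed : V → Subsample → Bool) : V → V → ℝ :=
  adjDist G (sub S seed .d) (sub S seed .r)

/-- The estimated density of `u`, the number of vertices of the counting sample in the ball of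
radius `r` around `u`. -/
def density (G : SimpleGraph V) (S : Finset V) (seed : V → Subsample → Bool) (u : V) : ℕ :=
  ((sub S seed .b).filter fun v => estDist G S seed u v ≤ rConst).card

/-- The position of a center: centers are in decreasing order of density (equivalently, in
increasing order of the number of counting vertices outside the ball), ties being broken by
`tie`. -/
def centerKey (G : SimpleGraph V) (tie : V → ℕ) (S : Finset V) (seed : V → Subsample → Bool)
    (u : V) : ℕ ×ₗ ℕ :=
  toLex ((sub S seed .b).card - density G S seed u, tie u)

/-- `v` has a positive neighbour in the distance sample. -/
def Eligible (G : SimpleGraph V) (S : Finset V) (seed : V → Subsample → Bool) (v : V) : Prop :=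
  (posNbhd G v ∩ sub S seed .d).Nonempty

/-- The centers that could collect `v` in the pre-clustering phase. -/
def nearCenters (G : SimpleGraph V) (S : Finset V) (seed : V → Subsample → Bool) (v : V) :
    Set V :=
  {u | Eligible G S seed v ∧ u ∈ sub S seed .p ∧ estDist G S seed u v ≤ cConst * rConst}

/-- The clusterable edges of the first run of Pivot: the positive edges between vertices without
positive neighbours in the distance sample. -/
def PivotEdge₁ (G : SimpleGraph V) (S : Finset V) (seed : V → Subsample → Bool) (u v : V) : Prop :=
  ¬ Eligible G S seed u ∧ ¬ Eligible G S seed v ∧ G.Adj u v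

/-- The vertices clustered by the second run of Pivot: those with a positive neighbour in the
distance sample that were not collected by a center. -/
def Leftover (G : SimpleGraph V) (S : Finset V) (seed : V → Subsample → Bool) (v : V) : Prop :=
  Eligible G S seed v ∧ ¬ (nearCenters G S seed v).Nonempty

/-- The clusterable edges of the second run of Pivot: the short positive edges between leftover
vertices. -/
def PivotEdge₂ (G : SimpleGraph V) (S : Finset V) (seed : V → Subsample → Bool) (u v : V) : Prop :=
  Leftover G S seed u ∧ Leftover G S seed v ∧ G.Adj u v ∧
    estDist G S seed u v < cConst * rConst

/-- The processing order: first the vertices of the sample, in the order `sampleOrder`, then the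
other vertices, as they arrive. -/
def processingRank (arrival sampleOrder : V → ℕ) (S : Finset V) (v : V) : ℕ ×ₗ ℕ :=
  if v ∈ S then toLex (0, sampleOrder v) else toLex (1, arrival v)

/-- The main algorithm: the cluster to which the vertex `v` is assigned. The label `Sum.inl u` is
the cluster of the center `u`, and `Sum.inr w` is the cluster opened by the pivot `w`. The first
three arguments after `tie` are the input: the signs, the arrival order, and the sample; `seed` is
the internal randomness, which splits the sample. -/
def mainAlgorithm (sampleOrder tie : V ↪ ℕ) (G : SimpleGraph V) (arrival : V ↪ ℕ)
    (S : Finset V) (seed : V → Subsample → Bool) (v : V) : V ⊕ V :=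
  if h : (nearCenters G S seed v).Nonempty then
    Sum.inl (Function.argminOn (centerKey G tie S seed) (nearCenters G S seed v) h)
  else if ¬ Eligible G S seed v then
    Sum.inr (pivotOf (processingRank arrival sampleOrder S) (PivotEdge₁ G S seed) v)
  else
    Sum.inr (pivotOf (processingRank arrival sampleOrder S) (PivotEdge₂ G S seed) v)

end Algorithm

/-! ## The online-with-a-sample model -/

section Model

/-- The vertices that the algorithm has seen when it assigns a cluster to `v`: the sample, and,
if `v` is not in the sample, the vertices that have arrived up to and including `v`. -/
def seen {V : Type*} (arrival : V ↪ ℕ) (S : Finset V) (v : V) : Set V :=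
  {w | w ∈ S ∨ (v ∉ S ∧ arrival w ≤ arrival v)}

/-- The algorithm `A` is an online algorithm with a sample: the cluster it gives to `v` is
determined by the sample, the splitting of the sample, the vertices seen so far with the order in
which those outside the sample arrived, and the signs of the edges between vertices seen so far. -/
def IsOnline {V L : Type*}
    (A : SimpleGraph V → (V ↪ ℕ) → Finset V → (V → Subsample → Bool) → V → L) : Prop :=
  ∀ (G G' : SimpleGraph V) (arrival arrival' : V ↪ ℕ) (S : Finset V)
    (seed seed' : V → Subsample → Bool) (v : V),
    (∀ w ∈ S, seed w = seed' w) →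
    seen arrival S v = seen arrival' S v →
    (∀ w ∈ seen arrival S v, ∀ w' ∈ seen arrival S v, w ∉ S → w' ∉ S →
      (arrival w ≤ arrival w' ↔ arrival' w ≤ arrival' w')) →
    (∀ w ∈ seen arrival S v, ∀ w' ∈ seen arrival S v, (G.Adj w w' ↔ G'.Adj w w')) →
    A G arrival S seed v = A G' arrival' S seed' v

/-- With `x = ε/2`, the probability that a vertex of the sample is put in exactly a given set of
`k` subsamples. -/
def allocWeight (ε : ℝ) (k : ℕ) : ℝ :=
  if k = 0 then
    1 - 4 * (ε / 2) + 6 * ε * (ε / 2) ^ 2 - 4 * ε ^ 2 * (ε / 2) ^ 3 + ε ^ 3 * (ε / 2) ^ 4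
  else if k = 1 then
    ε / 2 - 3 * ε * (ε / 2) ^ 2 + 3 * ε ^ 2 * (ε / 2) ^ 3 - ε ^ 3 * (ε / 2) ^ 4
  else if k = 2 then ε * (ε / 2) ^ 2 - 2 * ε ^ 2 * (ε / 2) ^ 3 + ε ^ 3 * (ε / 2) ^ 4
  else if k = 3 then ε ^ 2 * (ε / 2) ^ 3 - ε ^ 3 * (ε / 2) ^ 4
  else ε ^ 3 * (ε / 2) ^ 4

/-- The law of the set of subsamples in which a vertex of the sample is put. -/
def allocLaw (ε : ℝ) : MeasureTheory.Measure (Subsample → Bool) :=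
  ∑ a : Subsample → Bool,
    ENNReal.ofReal (allocWeight ε (Finset.univ.filter fun i => a i = true).card) •
      MeasureTheory.Measure.dirac a

/-- The law of the indicator of the event that a vertex is in the sample. -/
def coinLaw (ε : ℝ) : MeasureTheory.Measure Bool :=
  ENNReal.ofReal ε • MeasureTheory.Measure.dirac true +
    ENNReal.ofReal (1 - ε) • MeasureTheory.Measure.dirac false

/-- The joint law of the sample and of the splitting: every vertex is in the sample independently
with probability `ε`, and the vertices are allocated to subsamples independently. -/
def aosLaw (ε : ℝ) (V : Type*) [Fintype V] :
    MeasureTheory.Measure ((V → Bool) × (V → Subsample → Bool)) :=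
  (MeasureTheory.Measure.pi fun _ : V => coinLaw ε).prod
    (MeasureTheory.Measure.pi fun _ : V => allocLaw ε)

variable {V : Type*} [Fintype V]

/-- The clustering that the main algorithm outputs when the sample and its splitting are given
by `ω`. -/
def output (sampleOrder tie : V ↪ ℕ) (G : SimpleGraph V) (arrival : V ↪ ℕ)
    (ω : (V → Bool) × (V → Subsample → Bool)) : Setoid V :=
  Setoid.ker (mainAlgorithm sampleOrder tie G arrival
    (Finset.univ.filter fun v => ω.1 v = true) ω.2)

end Model

end OnlineCC

end

/-! Fix a clustering `C` and an outcome of the sampling. The disagreements of the output at each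
vertex are bounded by those of `C`, multiplied by weights or transported by nonnegative kernels. The
sizes of these weights and of the row and column sums of the kernels depend only on how well the
subsamples represent certain vertex sets: positive neighbourhoods, short negative neighbourhoods and
small balls. This comparison (`disVec_output_le`) is deterministic; the optimal clustering for the
norm at hand is substituted for `C` at the end.

By `disagreeSet_subset` an edge on which the output errs is of one of five kinds. Edges that already
disagree with `C` cost nothing new. Ambiguous edges (positive but not short, or negative but not
long) force `C` to disagree with a constant fraction of the sampled neighbours of the ends
(`card_ambiguous_le`). A short positive edge is cut either by a center, whose whole ball is then
ambiguous for the end in question and, centers being ordered by density, at least as populous as the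
ball of any center near that end, or by a pivot of the second run, which is then itself ambiguous
for one end (`card_closeCut_le`). An isolated vertex has many short negative edges, and double
counting makes `C` pay for its sampled degree (`sampledDegree_le_of_isIsolated`). Around vertices
without sampled neighbours Pivot reproduces a perfect cluster of `C`, and elsewhere a single
disagreement of `C` is multiplied by a degree, which for such a vertex is also its degree ratio
(`card_unseenNegative_le`, `card_isolatedEdges_le`).

Row sums alone give the maximum norm, row and column sums together give all finite `p` at once by
Schur's test (`lpNorm_kernel_le`), and column sums give the total.

The weights of the splitting are made so that the four subsamples are independent random sets of
density `q = ε² / 2` (`integral_subsamples`). Each set to be estimated is determined by subsamples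
drawn before the one that estimates it, so a Chernoff bound applies: its size in the event of bad
representation has an exponential tail. Hence all defects are `O(log n / ε²)` with high probability,
while the expected `ℓ_1` cost needs only first and second moments and loses no logarithm. -/

noncomputable section

namespace OnlineCC

/-! ### Pivot: what a cut clusterable edge implies -/

section PivotLemmas

variable {V : Type*} {rank : V → ℕ ×ₗ ℕ} {E : V → V → Prop}

theorem argminOn_eq_iff {β : Type*} [LinearOrder β] [WellFoundedLT β] {f : V → β} {s : Set V}
    (hf : Set.InjOn f s) (hs : s.Nonempty) {x : V} :
    Function.argminOn f s hs = x ↔ x ∈ s ∧ ∀ y ∈ s, f x ≤ f y := by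
  constructor
  · rintro rfl
    exact ⟨Function.argminOn_mem f s hs, fun y hy => Function.argminOn_le f s hy⟩
  · rintro ⟨hx, hmin⟩
    have h1 := Function.argminOn_mem f s hs
    exact hf h1 hx (le_antisymm (Function.argminOn_le f s hx) (hmin _ h1))

theorem pivotOf_of_isPivot {v : V} (hv : IsPivot rank E v) : pivotOf rank E v = v := by
  rw [isPivot_iff] at hv
  unfold pivotOf
  rw [dif_neg]
  rintro ⟨w, h1, h2, h3⟩
  exact hv w h1 h2 h3

theorem earlierPivots_nonempty {v : V} (hv : ¬ IsPivot rank E v) :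
    (earlierPivots rank E v).Nonempty := by
  rw [isPivot_iff] at hv
  push Not at hv
  obtain ⟨w, h1, h2, h3⟩ := hv
  exact ⟨w, h1, h2, h3⟩

theorem pivotOf_mem {v : V} (h : (earlierPivots rank E v).Nonempty) :
    pivotOf rank E v ∈ earlierPivots rank E v := by
  unfold pivotOf
  rw [dif_pos h]
  exact Function.argminOn_mem _ _ _

theorem rank_pivotOf_le {v w : V} (h : w ∈ earlierPivots rank E v) :
    rank (pivotOf rank E v) ≤ rank w := by
  unfold pivotOf
  rw [dif_pos ⟨w, h⟩]
  exact Function.argminOn_le _ _ h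

/-- A vertex is its own pivot or is joined to its pivot by a clusterable edge. -/
theorem pivotOf_eq_or_edge (rank : V → ℕ ×ₗ ℕ) (E : V → V → Prop) (v : V) :
    pivotOf rank E v = v ∨ E (pivotOf rank E v) v := by
  by_cases hv : IsPivot rank E v
  · exact Or.inl (pivotOf_of_isPivot hv)
  · exact Or.inr (pivotOf_mem (earlierPivots_nonempty hv)).2.1

/-- The separating vertex is the pivot of `t` or that of `v`. If `t` is a pivot, `v` chose an
earlier pivot, which cannot be joined to `t`. Otherwise the pivot of `t` separates them, unless it
is also joined to `v`; then `v` chose a still earlier pivot, which `t` would have preferred if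
joined to it. -/
theorem exists_separating_pivot_of_lt (hrank : Function.Injective rank)
    {t v : V} (htv : E t v) (hlt : rank t < rank v) (hne : pivotOf rank E t ≠ pivotOf rank E v) :
    ∃ w, w ≠ t ∧ w ≠ v ∧ ((E w t ∧ ¬ E w v) ∨ (E w v ∧ ¬ E w t)) := by
  by_cases ht : IsPivot rank E t
  · have htm : t ∈ earlierPivots rank E v := ⟨hlt, htv, ht⟩
    have hw := pivotOf_mem ⟨t, htm⟩
    have hle := rank_pivotOf_le htm
    rw [pivotOf_of_isPivot ht] at hne
    have hlt' : rank (pivotOf rank E v) < rank t :=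
      lt_of_le_of_ne hle fun h => hne (hrank h).symm
    refine ⟨pivotOf rank E v, hne.symm, fun h => ?_, Or.inr ⟨hw.2.1, fun h => ?_⟩⟩
    · exact (h ▸ hw.1).ne rfl
    · exact (isPivot_iff rank E t).1 ht _ hlt' h hw.2.2
  · have hw := pivotOf_mem (earlierPivots_nonempty ht)
    by_cases hwv : E (pivotOf rank E t) v
    · have hwm : pivotOf rank E t ∈ earlierPivots rank E v := ⟨hw.1.trans hlt, hwv, hw.2.2⟩
      have hw' := pivotOf_mem ⟨_, hwm⟩
      have hlt' : rank (pivotOf rank E v) < rank (pivotOf rank E t) :=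
        lt_of_le_of_ne (rank_pivotOf_le hwm) fun h => hne (hrank h).symm
      refine ⟨pivotOf rank E v, fun h => ?_, fun h => ?_, Or.inr ⟨hw'.2.1, fun h => ?_⟩⟩
      · exact ((h ▸ hlt').trans hw.1).ne rfl
      · exact (h ▸ hw'.1).ne rfl
      · exact hlt'.not_ge (rank_pivotOf_le ⟨hlt'.trans hw.1, h, hw'.2.2⟩)
    · refine ⟨pivotOf rank E t, fun h => ?_, fun h => ?_, Or.inl ⟨hw.2.1, hwv⟩⟩
      · exact (h ▸ hw.1).ne rfl
      · exact ((h ▸ hw.1).trans hlt).ne rfl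

/-- If a clusterable edge is cut by Pivot, then some third vertex has a clusterable edge to exactly
one of its ends. -/
theorem exists_separating_pivot (hrank : Function.Injective rank) (hE : ∀ {u v : V}, E u v → E v u)
    {t v : V} (hne' : t ≠ v) (htv : E t v) (hne : pivotOf rank E t ≠ pivotOf rank E v) :
    ∃ w, w ≠ t ∧ w ≠ v ∧ ((E w t ∧ ¬ E w v) ∨ (E w v ∧ ¬ E w t)) := by
  rcases lt_trichotomy (rank t) (rank v) with h | h | h
  · exact exists_separating_pivot_of_lt hrank htv h hne
  · exact absurd (hrank h) hne'
  · obtain ⟨w, h1, h2, h3⟩ := exists_separating_pivot_of_lt hrank (hE htv) h hne.symm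
    exact ⟨w, h2, h1, h3.symm⟩

theorem processingRank_injective (arrival sampleOrder : V ↪ ℕ) (S : Finset V) :
    Function.Injective (processingRank arrival sampleOrder S) := by
  intro u v h
  unfold processingRank at h
  split_ifs at h <;> simp at h <;> exact h

theorem centerKey_injective [Fintype V] (G : SimpleGraph V) (tie : V ↪ ℕ) (S : Finset V)
    (seed : V → Subsample → Bool) : Function.Injective (centerKey G tie S seed) := by
  intro u v h
  unfold centerKey at h
  have := congrArg (fun z => (ofLex z).2) h
  simpa using this

end PivotLemmas

/-! ### The algorithm is online -/

section Online

variable {V : Type*}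

/-- Being a pivot depends only on earlier vertices, so an induction along `rank` never leaves a set
that is closed downwards for both orders. -/
theorem isPivot_congr {rank rank' : V → ℕ ×ₗ ℕ} {E E' : V → V → Prop} {T : Set V}
    (hdown : ∀ v ∈ T, ∀ w, rank w < rank v → w ∈ T)
    (hdown' : ∀ v ∈ T, ∀ w, rank' w < rank' v → w ∈ T)
    (hrank : ∀ v ∈ T, ∀ w ∈ T, (rank v < rank w ↔ rank' v < rank' w))
    (hE : ∀ v ∈ T, ∀ w ∈ T, (E v w ↔ E' v w)) :
    ∀ v ∈ T, (IsPivot rank E v ↔ IsPivot rank' E' v) := by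
  intro v
  induction v using (InvImage.wf rank wellFounded_lt).induction with
  | _ v ih =>
    intro hv
    rw [isPivot_iff rank, isPivot_iff rank']
    constructor
    · intro h w hw hEw
      have hwT := hdown' v hv w hw
      have hw' := (hrank w hwT v hv).2 hw
      rw [← ih w hw' hwT]
      exact h w hw' ((hE w hwT v hv).2 hEw)
    · intro h w hw hEw
      have hwT := hdown v hv w hw
      rw [ih w hw hwT]
      exact h w ((hrank w hwT v hv).1 hw) ((hE w hwT v hv).1 hEw)

theorem pivotOf_congr {rank rank' : V → ℕ ×ₗ ℕ} {E E' : V → V → Prop} {T : Set V}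
    (hinj : Function.Injective rank)
    (hdown : ∀ v ∈ T, ∀ w, rank w < rank v → w ∈ T)
    (hdown' : ∀ v ∈ T, ∀ w, rank' w < rank' v → w ∈ T)
    (hrank : ∀ v ∈ T, ∀ w ∈ T, (rank v < rank w ↔ rank' v < rank' w))
    (hE : ∀ v ∈ T, ∀ w ∈ T, (E v w ↔ E' v w)) {v : V} (hv : v ∈ T) :
    pivotOf rank E v = pivotOf rank' E' v := by
  have hset : earlierPivots rank E v = earlierPivots rank' E' v := by
    have hp := isPivot_congr hdown hdown' hrank hE
    ext w
    constructor
    · rintro ⟨h1, h2, h3⟩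
      have hw := hdown v hv w h1
      exact ⟨(hrank w hw v hv).1 h1, (hE w hw v hv).1 h2, (hp w hw).1 h3⟩
    · rintro ⟨h1, h2, h3⟩
      have hw := hdown' v hv w h1
      exact ⟨(hrank w hw v hv).2 h1, (hE w hw v hv).2 h2, (hp w hw).2 h3⟩
  by_cases h : (earlierPivots rank E v).Nonempty
  · have h' : (earlierPivots rank' E' v).Nonempty := hset ▸ h
    have hm := pivotOf_mem h'
    have heq : pivotOf rank E v = Function.argminOn rank (earlierPivots rank E v) h := by
      unfold pivotOf
      rw [dif_pos h]
    rw [heq, argminOn_eq_iff hinj.injOn]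
    refine ⟨hset ▸ hm, fun w hw => ?_⟩
    have h2 := rank_pivotOf_le (hset ▸ hw : w ∈ earlierPivots rank' E' v)
    rw [← not_lt] at h2 ⊢
    rwa [hrank w (hdown v hv w hw.1) _ (hdown' v hv _ hm.1)]
  · have h' : ¬ (earlierPivots rank' E' v).Nonempty := hset ▸ h
    unfold pivotOf
    rw [dif_neg h, dif_neg h']

theorem sub_congr [Fintype V] {S : Finset V} {seed seed' : V → Subsample → Bool}
    (h : ∀ w ∈ S, seed w = seed' w) : sub S seed = sub S seed' := by
  funext i
  unfold sub
  exact Finset.filter_congr fun w hw => by rw [h w hw]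

theorem sub_subset [Fintype V] (S : Finset V) (seed : V → Subsample → Bool) (i : Subsample) :
    sub S seed i ⊆ S := Finset.filter_subset _ _

theorem mem_seen_of_processingRank_lt {arrival sampleOrder : V ↪ ℕ} {S : Finset V} {u v w : V}
    (hv : v ∈ seen arrival S u)
    (h : processingRank arrival sampleOrder S w < processingRank arrival sampleOrder S v) :
    w ∈ seen arrival S u := by
  unfold processingRank at h
  by_cases hw : w ∈ S
  · exact Or.inl hw
  · by_cases hvS : v ∈ S
    · rw [if_neg hw, if_pos hvS, Prod.Lex.toLex_lt_toLex] at h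
      simp at h
    · rw [if_neg hw, if_neg hvS, Prod.Lex.toLex_lt_toLex] at h
      simp only [lt_irrefl, true_and, false_or] at h
      rcases hv with hv | ⟨h1, h2⟩
      · exact absurd hv hvS
      · exact Or.inr ⟨h1, h.le.trans h2⟩

variable [Fintype V]

theorem mem_posNbhd {G : SimpleGraph V} {u v : V} : v ∈ posNbhd G u ↔ v = u ∨ G.Adj u v := by
  simp [posNbhd]

theorem posNbhd_inter_congr {G G' : SimpleGraph V} {T : Set V}
    (h : ∀ w ∈ T, ∀ w' ∈ T, (G.Adj w w' ↔ G'.Adj w w')) {U : Finset V} (hU : ↑U ⊆ T) {u : V}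
    (hu : u ∈ T) : posNbhd G u ∩ U = posNbhd G' u ∩ U := by
  ext w
  simp only [Finset.mem_inter, mem_posNbhd]
  constructor
  · rintro ⟨h1, h2⟩
    exact ⟨h1.imp id (h u hu w (hU h2)).1, h2⟩
  · rintro ⟨h1, h2⟩
    exact ⟨h1.imp id (h u hu w (hU h2)).2, h2⟩

theorem corrDist_congr {G G' : SimpleGraph V} {T : Set V}
    (h : ∀ w ∈ T, ∀ w' ∈ T, (G.Adj w w' ↔ G'.Adj w w')) {U : Finset V} (hU : ↑U ⊆ T) {u v : V}
    (hu : u ∈ T) (hv : v ∈ T) : corrDist G U u v = corrDist G' U u v := by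
  have h1 := posNbhd_inter_congr h hU hu
  have h2 := posNbhd_inter_congr h hU hv
  have h3 : (posNbhd G u ∪ posNbhd G v) ∩ U = (posNbhd G' u ∪ posNbhd G' v) ∩ U := by
    rw [Finset.union_inter_distrib_right, Finset.union_inter_distrib_right, h1, h2]
  have h4 : posNbhd G u ∩ posNbhd G v ∩ U = posNbhd G' u ∩ posNbhd G' v ∩ U := by
    rw [Finset.inter_inter_distrib_right, h1, h2, ← Finset.inter_inter_distrib_right]
  unfold corrDist
  rw [h3, h4]

theorem isIsolated_congr {G G' : SimpleGraph V} {T : Set V}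
    (h : ∀ w ∈ T, ∀ w' ∈ T, (G.Adj w w' ↔ G'.Adj w w')) {U W : Finset V} (hU : ↑U ⊆ T)
    (hW : ↑W ⊆ T) {u : V} (hu : u ∈ T) : IsIsolated G U W u ↔ IsIsolated G' U W u := by
  have h1 := posNbhd_inter_congr h hU hu
  have h2 : (W.filter fun v => v ∉ posNbhd G u ∧ corrDist G U u v ≤ 7 / 10) =
      W.filter fun v => v ∉ posNbhd G' u ∧ corrDist G' U u v ≤ 7 / 10 := by
    refine Finset.filter_congr fun v hv => ?_
    rw [corrDist_congr h hU hu (hW hv), mem_posNbhd, mem_posNbhd, h u hu v (hW hv)]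
  unfold IsIsolated
  rw [h1, h2]

theorem adjDist_congr {G G' : SimpleGraph V} {T : Set V}
    (h : ∀ w ∈ T, ∀ w' ∈ T, (G.Adj w w' ↔ G'.Adj w w')) {U W : Finset V} (hU : ↑U ⊆ T)
    (hW : ↑W ⊆ T) {u v : V} (hu : u ∈ T) (hv : v ∈ T) :
    adjDist G U W u v = adjDist G' U W u v := by
  unfold adjDist
  rw [corrDist_congr h hU hu hv, isIsolated_congr h hU hW hu, isIsolated_congr h hU hW hv,
    h u hu v hv]

omit [Fintype V] in
theorem processingRank_lt_iff {arrival arrival' sampleOrder : V ↪ ℕ} {S : Finset V} {v w : V}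
    (h : v ∉ S → w ∉ S → (arrival w ≤ arrival v ↔ arrival' w ≤ arrival' v)) :
    processingRank arrival sampleOrder S v < processingRank arrival sampleOrder S w ↔
      processingRank arrival' sampleOrder S v < processingRank arrival' sampleOrder S w := by
  unfold processingRank
  by_cases h1 : v ∈ S <;> by_cases h2 : w ∈ S <;>
    simp only [h1, h2, if_true, if_false, Prod.Lex.toLex_lt_toLex]
  · simp
  · simp
  · have : arrival v < arrival w ↔ arrival' v < arrival' w := by
      rw [← not_le, ← not_le, h h1 h2]
    simp [this]

theorem mainAlgorithm_isOnline (sampleOrder tie : V ↪ ℕ) :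
    IsOnline (mainAlgorithm sampleOrder tie) := by
  intro G G' arrival arrival' S seed seed' v hseed hseen horder hadj
  set T := seen arrival S v with hT
  have hsub : sub S seed = sub S seed' := sub_congr hseed
  -- The subsamples lie in the sample, which is always seen; hence distances, eligibility and near
  -- centers of seen vertices involve only signs between seen vertices.
  have hST : ∀ i, (↑(sub S seed i) : Set V) ⊆ T := fun i w hw =>
    Or.inl (sub_subset S seed i (Finset.mem_coe.1 hw))
  have hvT : v ∈ T := by
    by_cases h : v ∈ S
    · exact Or.inl h
    · exact Or.inr ⟨h, le_rfl⟩
  have hdist : ∀ u ∈ T, ∀ w ∈ T, estDist G S seed u w = estDist G' S seed' u w := by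
    intro u hu w hw
    unfold estDist
    rw [← hsub]
    exact adjDist_congr hadj (hST _) (hST _) hu hw
  have helig : ∀ u ∈ T, (Eligible G S seed u ↔ Eligible G' S seed' u) := by
    intro u hu
    unfold Eligible
    rw [← hsub, posNbhd_inter_congr hadj (hST _) hu]
  have hnear : ∀ u ∈ T, nearCenters G S seed u = nearCenters G' S seed' u := by
    intro u hu
    ext w
    simp only [nearCenters, Set.mem_ofPred_eq, ← hsub, helig u hu]
    refine and_congr_right fun _ => and_congr_right fun hw => ?_
    rw [hdist w (hST _ hw) u hu]
  -- Keys are compared only between centers, so agreement on the sample is enough.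
  have hkey : ∀ u ∈ S, centerKey G tie S seed u = centerKey G' tie S seed' u := by
    intro u hu
    unfold centerKey density
    rw [← hsub]
    congr 3
    congr 1
    refine Finset.filter_congr fun w hw => ?_
    rw [hdist u (Or.inl hu) w (hST _ hw)]
  have hleft : ∀ u ∈ T, (Leftover G S seed u ↔ Leftover G' S seed' u) := by
    intro u hu
    unfold Leftover
    rw [helig u hu, hnear u hu]
  have hdown : ∀ u ∈ T, ∀ w, processingRank arrival sampleOrder S w <
      processingRank arrival sampleOrder S u → w ∈ T := fun u hu w h =>
    mem_seen_of_processingRank_lt hu h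
  have hdown' : ∀ u ∈ T, ∀ w, processingRank arrival' sampleOrder S w <
      processingRank arrival' sampleOrder S u → w ∈ T := by
    intro u hu w h
    rw [hseen] at hu ⊢
    exact mem_seen_of_processingRank_lt hu h
  have hrank : ∀ u ∈ T, ∀ w ∈ T, (processingRank arrival sampleOrder S u <
      processingRank arrival sampleOrder S w ↔ processingRank arrival' sampleOrder S u <
      processingRank arrival' sampleOrder S w) := fun u hu w hw =>
    processingRank_lt_iff fun h1 h2 => horder w hw u hu h2 h1
  have hinj := processingRank_injective arrival sampleOrder S
  unfold mainAlgorithm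
  by_cases h1 : (nearCenters G S seed v).Nonempty
  · have h1' : (nearCenters G' S seed' v).Nonempty := hnear v hvT ▸ h1
    rw [dif_pos h1, dif_pos h1']
    congr 1
    rw [argminOn_eq_iff (centerKey_injective G tie S seed).injOn]
    have hm := Function.argminOn_mem (centerKey G' tie S seed') _ h1'
    refine ⟨(hnear v hvT).symm ▸ hm, fun w hw => ?_⟩
    rw [hkey w (sub_subset S seed _ hw.2.1), hkey _ (sub_subset S seed' _ hm.2.1)]
    exact Function.argminOn_le _ _ (hnear v hvT ▸ hw)
  · have h1' : ¬ (nearCenters G' S seed' v).Nonempty := hnear v hvT ▸ h1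
    rw [dif_neg h1, dif_neg h1', ← helig v hvT]
    have e1 : ∀ u ∈ T, ∀ w ∈ T, (PivotEdge₁ G S seed u w ↔ PivotEdge₁ G' S seed' u w) := by
      intro u hu w hw
      unfold PivotEdge₁
      rw [helig u hu, helig w hw, hadj u hu w hw]
    have e2 : ∀ u ∈ T, ∀ w ∈ T, (PivotEdge₂ G S seed u w ↔ PivotEdge₂ G' S seed' u w) := by
      intro u hu w hw
      unfold PivotEdge₂
      rw [hleft u hu, hleft w hw, hadj u hu w hw, hdist u hu w hw]
    rw [pivotOf_congr hinj hdown hdown' hrank e1 hvT,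
      pivotOf_congr hinj hdown hdown' hrank e2 hvT]

end Online

/-! ### Jaccard distance and its adjusted form -/

section MetricLemmas

variable {V : Type*} [Fintype V] (G : SimpleGraph V) (D R : Finset V)

theorem corrDist_self (u : V) : corrDist G D u u = 0 := by simp [corrDist]

theorem corrDist_comm (u v : V) : corrDist G D u v = corrDist G D v u := by
  unfold corrDist
  rw [Finset.union_comm, Finset.inter_comm (posNbhd G u)]
  simp only [eq_comm]

theorem corrDist_of_empty {u v : V} (h : u ≠ v)
    (hU : posNbhd G u ∩ D ∪ posNbhd G v ∩ D = ∅) : corrDist G D u v = 1 := by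
  unfold corrDist
  rw [if_neg h, if_pos]
  rwa [Finset.union_inter_distrib_right]

theorem card_inter_add_card_symmDiff {α : Type*} [DecidableEq α] (X Y : Finset α) :
    (X ∩ Y).card + (symmDiff X Y).card = (X ∪ Y).card := by
  rw [← Finset.card_union_of_disjoint]
  · congr 1
    ext x
    simp only [Finset.mem_union, Finset.mem_inter, Finset.mem_symmDiff]
    tauto
  · rw [Finset.disjoint_left]
    intro x
    simp only [Finset.mem_inter, Finset.mem_symmDiff]
    tauto

/-- Clearing the denominator of the Jaccard distance also covers an empty union, where the default
value 1 is multiplied by 0. -/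
theorem corrDist_mul_card {u v : V} (h : u ≠ v) :
    corrDist G D u v * ((posNbhd G u ∩ D ∪ posNbhd G v ∩ D).card : ℝ) =
      ((symmDiff (posNbhd G u ∩ D) (posNbhd G v ∩ D)).card : ℝ) := by
  have hc := card_inter_add_card_symmDiff (posNbhd G u ∩ D) (posNbhd G v ∩ D)
  by_cases hU : posNbhd G u ∩ D ∪ posNbhd G v ∩ D = ∅
  · rw [hU] at hc ⊢
    simp only [Finset.card_empty, Nat.add_eq_zero_iff] at hc
    simp [hc.2]
  · have hpos : (0 : ℝ) < ((posNbhd G u ∩ D ∪ posNbhd G v ∩ D).card : ℝ) := by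
      exact_mod_cast Finset.card_pos.2 (Finset.nonempty_iff_ne_empty.2 hU)
    unfold corrDist
    rw [if_neg h, Finset.union_inter_distrib_right, if_neg hU, Finset.inter_inter_distrib_right,
      sub_mul, div_mul_cancel₀ _ hpos.ne', ← hc]
    push_cast
    ring

theorem corrDist_nonneg (u v : V) : 0 ≤ corrDist G D u v := by
  by_cases h : u = v
  · rw [h, corrDist_self]
  by_cases hU : posNbhd G u ∩ D ∪ posNbhd G v ∩ D = ∅
  · rw [corrDist_of_empty G D h hU]
    exact zero_le_one
  · have hpos : (0 : ℝ) < ((posNbhd G u ∩ D ∪ posNbhd G v ∩ D).card : ℝ) := by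
      exact_mod_cast Finset.card_pos.2 (Finset.nonempty_iff_ne_empty.2 hU)
    refine nonneg_of_mul_nonneg_left ?_ hpos
    rw [corrDist_mul_card G D h]
    positivity

theorem corrDist_le_one (u v : V) : corrDist G D u v ≤ 1 := by
  unfold corrDist
  split_ifs
  · exact zero_le_one
  · exact le_rfl
  · have : (0 : ℝ) ≤ ((posNbhd G u ∩ posNbhd G v ∩ D).card : ℝ) /
      (((posNbhd G u ∪ posNbhd G v) ∩ D).card : ℝ) := by positivity
    linarith

/-- The Jaccard distance satisfies the triangle inequality. -/
theorem corrDist_triangle (u v w : V) :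
    corrDist G D u w ≤ corrDist G D u v + corrDist G D v w := by
  by_cases huw : u = w
  · rw [huw, corrDist_self]
    exact add_nonneg (corrDist_nonneg G D _ _) (corrDist_nonneg G D _ _)
  by_cases huv : u = v
  · rw [huv, corrDist_self, zero_add]
  by_cases hvw : v = w
  · rw [hvw, corrDist_self, add_zero]
  set X := posNbhd G u ∩ D with hX
  set Y := posNbhd G v ∩ D with hY
  set Z := posNbhd G w ∩ D with hZ
  by_cases hU : X ∪ Y ∪ Z = ∅
  · have hXY : X ∪ Y = ∅ := Finset.subset_empty.1 (hU ▸ Finset.subset_union_left)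
    rw [corrDist_of_empty G D huv hXY]
    linarith [corrDist_le_one G D u w, corrDist_nonneg G D v w]
  have hpos : (0 : ℝ) < ((X ∪ Y ∪ Z).card : ℝ) := by
    exact_mod_cast Finset.card_pos.2 (Finset.nonempty_iff_ne_empty.2 hU)
  have key : ∀ {a b : V}, a ≠ b → posNbhd G a ∩ D ∪ posNbhd G b ∩ D ⊆ X ∪ Y ∪ Z →
      ((symmDiff (posNbhd G a ∩ D) (posNbhd G b ∩ D)).card : ℝ) ≤
        corrDist G D a b * ((X ∪ Y ∪ Z).card : ℝ) := by
    intro a b hab hsub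
    rw [← corrDist_mul_card G D hab]
    exact mul_le_mul_of_nonneg_left (by exact_mod_cast Finset.card_le_card hsub)
      (corrDist_nonneg G D a b)
  have h1 := key huv (show X ∪ Y ⊆ X ∪ Y ∪ Z from Finset.subset_union_left)
  have h2 := key hvw (show Y ∪ Z ⊆ X ∪ Y ∪ Z by
    rw [Finset.union_assoc]; exact Finset.subset_union_right)
  -- Points of `Y` outside `X ∪ Z` lie in both symmetric differences on the right. Keeping them on
  -- the left pays for replacing every denominator by the size of `X ∪ Y ∪ Z`, since the distance of
  -- `u` and `w` is at most 1.
  have h3 : (symmDiff X Z).card + (Y \ (X ∪ Z)).card ≤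
      (symmDiff X Y).card + (symmDiff Y Z).card := by
    rw [← Finset.card_union_of_disjoint]
    · refine (Finset.card_le_card ?_).trans (Finset.card_union_le _ _)
      intro x
      simp only [Finset.mem_union, Finset.mem_sdiff, Finset.mem_symmDiff]
      tauto
    · rw [Finset.disjoint_left]
      intro x
      simp only [Finset.mem_union, Finset.mem_sdiff, Finset.mem_symmDiff]
      tauto
  have h4 : (X ∪ Z).card + (Y \ (X ∪ Z)).card = (X ∪ Y ∪ Z).card := by
    rw [← Finset.card_union_of_disjoint Finset.disjoint_sdiff]
    congr 1
    ext x
    simp only [Finset.mem_union, Finset.mem_sdiff]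
    tauto
  have h5 := corrDist_mul_card G D huw
  have h6 := corrDist_le_one G D u w
  have h3' : ((symmDiff X Z).card : ℝ) + ((Y \ (X ∪ Z)).card : ℝ) ≤
      ((symmDiff X Y).card : ℝ) + ((symmDiff Y Z).card : ℝ) := by exact_mod_cast h3
  have h4' : ((X ∪ Z).card : ℝ) + ((Y \ (X ∪ Z)).card : ℝ) = ((X ∪ Y ∪ Z).card : ℝ) := by
    exact_mod_cast h4
  have h7 : corrDist G D u w * ((Y \ (X ∪ Z)).card : ℝ) ≤ ((Y \ (X ∪ Z)).card : ℝ) :=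
    mul_le_of_le_one_left (Nat.cast_nonneg _) h6
  refine le_of_mul_le_mul_right ?_ hpos
  calc corrDist G D u w * ((X ∪ Y ∪ Z).card : ℝ)
      = corrDist G D u w * ((X ∪ Z).card : ℝ) +
          corrDist G D u w * ((Y \ (X ∪ Z)).card : ℝ) := by rw [← h4']; ring
    _ ≤ (corrDist G D u v + corrDist G D v w) * ((X ∪ Y ∪ Z).card : ℝ) := by
        rw [add_mul]
        linarith

theorem isIsolated_of_empty {u : V} (h : posNbhd G u ∩ D = ∅) : IsIsolated G D R u := by
  unfold IsIsolated
  rw [h]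
  simp

theorem adjDist_self (u : V) : adjDist G D R u u = 0 := by simp [adjDist]

theorem adjDist_comm (u v : V) : adjDist G D R u v = adjDist G D R v u := by
  unfold adjDist
  rw [corrDist_comm, G.adj_comm]
  simp only [eq_comm, or_comm]

theorem adjDist_of_isIsolated {u v : V} (h : u ≠ v)
    (hi : IsIsolated G D R u ∨ IsIsolated G D R v) : adjDist G D R u v = 1 := by
  unfold adjDist
  rw [if_neg h, if_pos hi]

theorem corrDist_le_adjDist (u v : V) : corrDist G D u v ≤ adjDist G D R u v := by
  unfold adjDist
  split_ifs with h
  · rw [h, corrDist_self]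
  · exact corrDist_le_one G D u v
  · exact corrDist_le_one G D u v
  · exact le_rfl

theorem adjDist_nonneg (u v : V) : 0 ≤ adjDist G D R u v :=
  (corrDist_nonneg G D u v).trans (corrDist_le_adjDist G D R u v)

theorem adjDist_le_one (u v : V) : adjDist G D R u v ≤ 1 := by
  unfold adjDist
  split_ifs
  exacts [zero_le_one, le_rfl, le_rfl, corrDist_le_one G D u v]

theorem adjDist_eq_corrDist {u v : V} (hu : ¬ IsIsolated G D R u) (hv : ¬ IsIsolated G D R v)
    (h : G.Adj u v ∨ corrDist G D u v ≤ 7 / 10) : adjDist G D R u v = corrDist G D u v := by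
  unfold adjDist
  split_ifs with h1 h2 h3
  · rw [h1, corrDist_self]
  · tauto
  · rcases h with h | h
    · exact absurd h h3.1
    · exact absurd h3.2 h.not_gt
  · rfl

theorem not_isIsolated_of_adjDist_lt_one {u v : V} (h : u ≠ v) (hlt : adjDist G D R u v < 1) :
    ¬ IsIsolated G D R u ∧ ¬ IsIsolated G D R v ∧ adjDist G D R u v = corrDist G D u v := by
  unfold adjDist at hlt ⊢
  split_ifs at hlt ⊢ with h2 h3
  · exact absurd h2 h
  · exact absurd hlt (lt_irrefl _)
  · exact absurd hlt (lt_irrefl _)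
  · tauto

/-- The adjusted correlation metric satisfies the triangle inequality up to the factor `δ`. -/
theorem adjDist_triangle (u v w : V) :
    adjDist G D R u w ≤ deltaConst * (adjDist G D R u v + adjDist G D R v w) := by
  have h1 := adjDist_nonneg G D R u v
  have h2 := adjDist_nonneg G D R v w
  have hδ : deltaConst = 10 / 7 := rfl
  by_cases huw : u = w
  · rw [huw, adjDist_self, hδ]
    linarith [adjDist_nonneg G D R w v, adjDist_nonneg G D R v w]
  by_cases huv : u = v
  · subst huv
    rw [adjDist_self, hδ]
    linarith
  by_cases hvw : v = w
  · subst hvw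
    rw [adjDist_self, hδ]
    linarith
  by_cases hu : IsIsolated G D R u
  · rw [adjDist_of_isIsolated G D R huv (Or.inl hu), hδ]
    linarith [adjDist_le_one G D R u w]
  by_cases hw : IsIsolated G D R w
  · rw [adjDist_of_isIsolated G D R hvw (Or.inr hw), hδ]
    linarith [adjDist_le_one G D R u w]
  have h3 := corrDist_le_adjDist G D R u v
  have h4 := corrDist_le_adjDist G D R v w
  have h5 := corrDist_triangle G D u v w
  by_cases h : G.Adj u w ∨ corrDist G D u w ≤ 7 / 10
  · rw [adjDist_eq_corrDist G D R hu hw h, hδ]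
    linarith
  -- Here a distance above 7/10 may have been raised to 1; since `1 = (10/7) · (7/10)`, the factor
  -- `δ` absorbs this.
  · push Not at h
    rw [hδ]
    linarith [adjDist_le_one G D R u w]

end MetricLemmas

/-! ### Ambiguous edges and close balls -/

section Ambiguous

variable {V : Type*} [Fintype V] (G : SimpleGraph V) (D R : Finset V)

/-- Vertices at most this far apart are regarded as close. -/
def closeRadius : ℝ := rConst / 3

theorem rConst_eq : rConst = 2401 / 54000 := by
  norm_num [rConst, cConst, deltaConst]

/-- This is `1 / (2δ²)`: two vertices within `cr` of a third are at distance at most `δ · 2cr = 1/δ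
= 7/10`, the threshold for negative edges. -/
theorem cConst_mul_rConst : cConst * rConst = 49 / 200 := by
  norm_num [rConst, cConst, deltaConst]

theorem closeRadius_eq : closeRadius = 2401 / 162000 := by
  rw [closeRadius, rConst_eq]
  norm_num

/-- The vertices whose edge to `t` has a large fractional cost in the adjusted correlation metric,
neither end being isolated. -/
def ambiguous (t : V) : Finset V :=
  Finset.univ.filter fun v => v ≠ t ∧ ¬ IsIsolated G D R t ∧ ¬ IsIsolated G D R v ∧
    ((G.Adj t v ∧ closeRadius ≤ corrDist G D t v) ∨ (¬ G.Adj t v ∧ corrDist G D t v ≤ 7 / 10))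

/-- The vertices close to `t`. -/
def closeBall (t : V) : Finset V :=
  Finset.univ.filter fun v => adjDist G D R t v ≤ closeRadius

variable {G D R}

theorem mem_closeBall {t v : V} : v ∈ closeBall G D R t ↔ adjDist G D R t v ≤ closeRadius := by
  simp [closeBall]

theorem mem_ambiguous {t v : V} : v ∈ ambiguous G D R t ↔
    v ≠ t ∧ ¬ IsIsolated G D R t ∧ ¬ IsIsolated G D R v ∧
    ((G.Adj t v ∧ closeRadius ≤ corrDist G D t v) ∨
      (¬ G.Adj t v ∧ corrDist G D t v ≤ 7 / 10)) := by
  simp [ambiguous]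

theorem mem_ambiguous_comm {t v : V} : v ∈ ambiguous G D R t ↔ t ∈ ambiguous G D R v := by
  rw [mem_ambiguous, mem_ambiguous, corrDist_comm, G.adj_comm]
  tauto

/-- An intermediate distance makes the edge ambiguous whatever its sign; being below 1, it also
shows that neither end is isolated. -/
theorem mem_ambiguous_of_adjDist {t v : V} (h1 : closeRadius ≤ adjDist G D R t v)
    (h2 : adjDist G D R t v ≤ 7 / 10) : v ∈ ambiguous G D R t := by
  have hne : t ≠ v := by
    rintro rfl
    rw [adjDist_self, closeRadius_eq] at h1
    norm_num at h1
  obtain ⟨h3, h4, h5⟩ := not_isIsolated_of_adjDist_lt_one G D R hne (by linarith)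
  rw [mem_ambiguous]
  rw [h5] at h1 h2
  exact ⟨hne.symm, h3, h4, by tauto⟩

end Ambiguous

/-! ### Disagreements of an arbitrary clustering -/

section Disagreements

variable {V : Type*} [Fintype V] (G : SimpleGraph V) (C : Setoid V)

/-- The set of vertices whose edge to `u` disagrees with `C`. -/
def disagreeSet (u : V) : Finset V := Finset.univ.filter fun v => Disagrees G C u v

/-- The cluster of `u`. -/
def clusterOf (u : V) : Finset V := Finset.univ.filter fun v => C u v

/-- The disagreement vector with real entries. -/
def disVec (u : V) : ℝ := (disagreements G C u : ℝ)

variable {G C}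

theorem card_disagreeSet (u : V) : ((disagreeSet G C u).card : ℝ) = disVec G C u := rfl

theorem mem_disagreeSet {u v : V} : v ∈ disagreeSet G C u ↔ Disagrees G C u v := by
  simp [disagreeSet]

theorem mem_clusterOf {u v : V} : v ∈ clusterOf C u ↔ C u v := by
  simp [clusterOf]

theorem disVec_nonneg (u : V) : 0 ≤ disVec G C u := Nat.cast_nonneg _

/-- Integrality yields the dichotomy used throughout: either `C` is perfect at `u`, and the
neighbourhood of `u` is a cluster, or `u` can pay 1. -/
theorem disVec_eq_zero_or (u : V) : disVec G C u = 0 ∨ 1 ≤ disVec G C u := by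
  unfold disVec
  rcases Nat.eq_zero_or_pos (disagreements G C u) with h | h
  · exact Or.inl (by simp [h])
  · exact Or.inr (by exact_mod_cast h)

theorem mem_disagreeSet_of_mem_not {u w : V} (h1 : w ∈ posNbhd G u) (h2 : ¬ C u w) :
    w ∈ disagreeSet G C u := by
  have hne : u ≠ w := by
    rintro rfl
    exact h2 (C.refl u)
  rw [mem_disagreeSet]
  exact ⟨hne, Or.inl ⟨(mem_posNbhd.1 h1).resolve_left hne.symm, h2⟩⟩

theorem mem_disagreeSet_of_not_mem {u w : V} (h1 : w ∉ posNbhd G u) (h2 : C u w) :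
    w ∈ disagreeSet G C u := by
  rw [mem_posNbhd] at h1
  push Not at h1
  rw [mem_disagreeSet]
  exact ⟨h1.1.symm, Or.inr ⟨h1.2, h2⟩⟩

theorem card_union_disagreeSet_le (X : Finset V) (u v : V)
    (h : X ⊆ disagreeSet G C u ∪ disagreeSet G C v) :
    (X.card : ℝ) ≤ disVec G C u + disVec G C v := by
  rw [← card_disagreeSet, ← card_disagreeSet]
  exact_mod_cast (Finset.card_le_card h).trans (Finset.card_union_le _ _)

/-- A vertex joined positively to just one of two clustermates is either in their cluster, hence
wrong for the other one, or outside it, hence wrong for its neighbour. -/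
theorem card_symmDiff_posNbhd_le {u v : V} (h : C u v) (X : Finset V) :
    ((symmDiff (posNbhd G u ∩ X) (posNbhd G v ∩ X)).card : ℝ) ≤ disVec G C u + disVec G C v := by
  refine card_union_disagreeSet_le _ u v fun w hw => ?_
  have key : ∀ {a b : V}, C a b → w ∈ posNbhd G a → w ∉ posNbhd G b →
      w ∈ disagreeSet G C a ∪ disagreeSet G C b := by
    intro a b hab ha hb
    rw [Finset.mem_union]
    by_cases haw : C a w
    · exact Or.inr (mem_disagreeSet_of_not_mem hb (C.trans (C.symm hab) haw))
    · exact Or.inl (mem_disagreeSet_of_mem_not ha haw)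
  simp only [Finset.mem_symmDiff, Finset.mem_inter] at hw
  rcases hw with hw | hw
  · exact key h hw.1.1 fun h' => hw.2 ⟨h', hw.1.2⟩
  · rw [Finset.union_comm]
    exact key (C.symm h) hw.1.1 fun h' => hw.2 ⟨h', hw.1.2⟩

/-- A common positive neighbour of two vertices in different clusters is cut off from at least one
of them. -/
theorem card_inter_posNbhd_le {u v : V} (h : ¬ C u v) (X : Finset V) :
    ((posNbhd G u ∩ X ∩ (posNbhd G v ∩ X)).card : ℝ) ≤ disVec G C u + disVec G C v := by
  refine card_union_disagreeSet_le _ u v fun w hw => ?_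
  simp only [Finset.mem_inter] at hw
  rw [Finset.mem_union]
  by_cases hu : C u w
  · exact Or.inr (mem_disagreeSet_of_mem_not hw.2.1 fun hv => h (C.trans hu (C.symm hv)))
  · exact Or.inl (mem_disagreeSet_of_mem_not hw.1.1 hu)

theorem card_clusterOf_inter_le (u : V) (X : Finset V) :
    ((clusterOf C u ∩ X).card : ℝ) ≤ ((posNbhd G u ∩ X).card : ℝ) + disVec G C u := by
  rw [← card_disagreeSet]
  have : clusterOf C u ∩ X ⊆ (posNbhd G u ∩ X) ∪ disagreeSet G C u := by
    intro w hw
    simp only [Finset.mem_inter, Finset.mem_union, mem_clusterOf] at hw ⊢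
    by_cases h : w ∈ posNbhd G u
    · exact Or.inl ⟨h, hw.2⟩
    · exact Or.inr (mem_disagreeSet_of_not_mem h hw.1)
  exact_mod_cast (Finset.card_le_card this).trans (Finset.card_union_le _ _)

theorem card_clusterOf_le (u : V) :
    ((clusterOf C u).card : ℝ) ≤ ((posNbhd G u).card : ℝ) + disVec G C u := by
  simpa using card_clusterOf_inter_le (G := G) (C := C) u Finset.univ

theorem card_posNbhd_inter_le (u : V) (X : Finset V) :
    ((posNbhd G u ∩ X).card : ℝ) ≤ ((clusterOf C u ∩ X).card : ℝ) + disVec G C u := by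
  rw [← card_disagreeSet]
  have : posNbhd G u ∩ X ⊆ (clusterOf C u ∩ X) ∪ disagreeSet G C u := by
    intro w hw
    simp only [Finset.mem_inter, Finset.mem_union, mem_clusterOf] at hw ⊢
    by_cases h : C u w
    · exact Or.inl ⟨h, hw.2⟩
    · exact Or.inr (mem_disagreeSet_of_mem_not hw.1 h)
  exact_mod_cast (Finset.card_le_card this).trans (Finset.card_union_le _ _)

theorem clusterOf_eq {u v : V} (h : C u v) : clusterOf C u = clusterOf C v := by
  ext w
  rw [mem_clusterOf, mem_clusterOf]
  exact ⟨fun h' => C.trans (C.symm h) h', fun h' => C.trans h h'⟩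

theorem posNbhd_eq_clusterOf {u : V} (h : disVec G C u = 0) : posNbhd G u = clusterOf C u := by
  have h0 : disagreeSet G C u = ∅ := by
    rw [← card_disagreeSet] at h
    exact Finset.card_eq_zero.1 (by exact_mod_cast h)
  ext w
  rw [mem_clusterOf]
  constructor
  · intro hw
    by_contra hC
    have := mem_disagreeSet_of_mem_not hw hC
    simp [h0] at this
  · intro hw
    by_contra hC
    have := mem_disagreeSet_of_not_mem hC hw
    simp [h0] at this

theorem self_mem_posNbhd (u : V) : u ∈ posNbhd G u := mem_posNbhd.2 (Or.inl rfl)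

theorem mem_posNbhd_comm {u v : V} : u ∈ posNbhd G v ↔ v ∈ posNbhd G u := by
  rw [mem_posNbhd, mem_posNbhd, G.adj_comm, eq_comm]

end Disagreements

/-! ### Degrees against sampled degrees -/

section Ratio

variable {V : Type*} [Fintype V] (G : SimpleGraph V) (D : Finset V)

/-- The number of positive neighbours in the sample, or `1` if there are none. -/
def sampledDegree (u : V) : ℝ := max 1 ((posNbhd G u ∩ D).card : ℝ)

/-- The ratio of the degree of a vertex to its degree into the sample. -/
def degreeRatio (u : V) : ℝ := ((posNbhd G u).card : ℝ) / sampledDegree G D u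

theorem one_le_sampledDegree (u : V) : 1 ≤ sampledDegree G D u := le_max_left _ _

theorem sampledDegree_pos (u : V) : 0 < sampledDegree G D u :=
  zero_lt_one.trans_le (one_le_sampledDegree G D u)

theorem card_le_sampledDegree (u : V) : ((posNbhd G u ∩ D).card : ℝ) ≤ sampledDegree G D u :=
  le_max_right _ _

theorem sampledDegree_of_nonempty {u : V} (h : posNbhd G u ∩ D ≠ ∅) :
    sampledDegree G D u = ((posNbhd G u ∩ D).card : ℝ) := by
  refine max_eq_right ?_
  exact_mod_cast Finset.card_pos.2 (Finset.nonempty_iff_ne_empty.2 h)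

/-- Owing to the cut-off at 1, a bound on ratios also bounds the full degrees of unseen vertices. -/
theorem degreeRatio_of_empty {u : V} (h : posNbhd G u ∩ D = ∅) :
    degreeRatio G D u = ((posNbhd G u).card : ℝ) := by
  simp [degreeRatio, sampledDegree, h]

theorem card_posNbhd_pos (u : V) : 0 < (posNbhd G u).card :=
  Finset.card_pos.2 ⟨u, self_mem_posNbhd u⟩

theorem degreeRatio_mul (u : V) :
    degreeRatio G D u * sampledDegree G D u = ((posNbhd G u).card : ℝ) :=
  div_mul_cancel₀ _ (sampledDegree_pos G D u).ne'

theorem one_le_degreeRatio (u : V) : 1 ≤ degreeRatio G D u := by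
  unfold degreeRatio
  rw [one_le_div (sampledDegree_pos G D u), sampledDegree, max_le_iff]
  refine ⟨by exact_mod_cast card_posNbhd_pos G u, ?_⟩
  exact_mod_cast Finset.card_le_card Finset.inter_subset_left

theorem degreeRatio_nonneg (u : V) : 0 ≤ degreeRatio G D u :=
  zero_le_one.trans (one_le_degreeRatio G D u)

end Ratio

/-! ### The charging kernels and their row and column sums -/

section Kernels

variable {V : Type*} [Fintype V] (G : SimpleGraph V) (D R : Finset V) (C : Setoid V)

/-- The kernel that spreads the cost of ambiguous edges over their ends. -/
def ambiguousKernel (t v : V) : ℝ :=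
  if v ∈ ambiguous G D R t then 1 / max (sampledDegree G D t) (sampledDegree G D v) else 0

/-- The kernel that spreads the cost of isolated vertices over their sampled neighbours. -/
def sampleKernel (t w : V) : ℝ :=
  if w ∈ posNbhd G t ∩ D then 1 / max (sampledDegree G D t) (sampledDegree G D w) else 0

/-- The isolated neighbours of `t` in its own cluster, apart from those that are clustered perfectly
and not seen by the distance sample. -/
def isolatedNbrs (t : V) : Finset V :=
  Finset.univ.filter fun v => v ∈ posNbhd G t ∧ C t v ∧ IsIsolated G D R v ∧
    (posNbhd G v ∩ D ≠ ∅ ∨ disVec G C v ≠ 0)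

/-- The kernel that spreads the number of isolated neighbours over them. -/
def isolatedKernel (t v : V) : ℝ :=
  if v ∈ isolatedNbrs G D R C t then
    1 / max ((isolatedNbrs G D R C t).card : ℝ) ((posNbhd G v).card : ℝ) else 0

/-- The vertex is clustered perfectly by `C` and not seen by the distance sample. -/
def PerfectUnseen (t : V) : Prop := posNbhd G t ∩ D = ∅ ∧ disVec G C t = 0

/-- The kernel that spreads the cost of perfect unseen vertices over their cluster. -/
def perfectKernel (t v : V) : ℝ := if C t v ∧ PerfectUnseen G D C t then 1 else 0

/-- A perfectly clustered vertex in the cluster of `v`, if there is one. -/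
def perfectRep (v : V) : V := if h : ∃ u, C v u ∧ disVec G C u = 0 then h.choose else v

/-- An upper bound for the degree of an isolated vertex. -/
def isolatedCharge (t : V) : ℝ :=
  40 * degreeRatio G D t * (disVec G C t + ∑ w, sampleKernel G D t w * disVec G C w)

theorem ambiguousKernel_nonneg (t v : V) : 0 ≤ ambiguousKernel G D R t v := by
  unfold ambiguousKernel
  have := sampledDegree_pos G D t
  split_ifs <;> positivity

theorem sampleKernel_nonneg (t v : V) : 0 ≤ sampleKernel G D t v := by
  unfold sampleKernel
  have := sampledDegree_pos G D t
  split_ifs <;> positivity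

theorem isolatedKernel_nonneg (t v : V) : 0 ≤ isolatedKernel G D R C t v := by
  unfold isolatedKernel
  split_ifs <;> positivity

theorem perfectKernel_nonneg (t v : V) : 0 ≤ perfectKernel G D C t v := by
  unfold perfectKernel
  split_ifs <;> norm_num

theorem isolatedCharge_nonneg (t : V) : 0 ≤ isolatedCharge G D C t :=
  mul_nonneg (mul_nonneg (by norm_num) (degreeRatio_nonneg G D t))
    (add_nonneg (disVec_nonneg t) (Finset.sum_nonneg fun w _ =>
      mul_nonneg (sampleKernel_nonneg G D t w) (disVec_nonneg w)))

/-- Symmetry, the reason for the maximum in the denominator, turns each bound on row sums into one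
on column sums. -/
theorem ambiguousKernel_comm (t v : V) :
    ambiguousKernel G D R t v = ambiguousKernel G D R v t := by
  unfold ambiguousKernel
  simp only [mem_ambiguous_comm (t := t) (v := v), max_comm]

theorem sum_ambiguousKernel_le (t : V) :
    ∑ v, ambiguousKernel G D R t v ≤ ((ambiguous G D R t).card : ℝ) / sampledDegree G D t := by
  unfold ambiguousKernel
  rw [← Finset.sum_filter, Finset.filter_mem_eq_inter, Finset.univ_inter, div_eq_mul_one_div,
    ← nsmul_eq_mul]
  refine Finset.sum_le_card_nsmul _ _ _ fun v _ => ?_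
  exact one_div_le_one_div_of_le (sampledDegree_pos G D t) (le_max_left _ _)

theorem sum_sampleKernel_le (t : V) : ∑ w, sampleKernel G D t w ≤ 1 := by
  unfold sampleKernel
  rw [← Finset.sum_filter, Finset.filter_mem_eq_inter, Finset.univ_inter]
  calc _ ≤ (posNbhd G t ∩ D).card • (1 / sampledDegree G D t) :=
        Finset.sum_le_card_nsmul _ _ _ fun v _ =>
          one_div_le_one_div_of_le (sampledDegree_pos G D t) (le_max_left _ _)
    _ ≤ 1 := by
        rw [nsmul_eq_mul, mul_one_div, div_le_one (sampledDegree_pos G D t)]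
        exact card_le_sampledDegree G D t

/-- Keeping only the sampled degree of `w` gives a bound that is constant on the neighbourhood of
`w`, so that a column sums to at most the degree ratio of `w`. -/
theorem sampleKernel_le (t w : V) :
    sampleKernel G D t w ≤ if t ∈ posNbhd G w then 1 / sampledDegree G D w else 0 := by
  unfold sampleKernel
  have := sampledDegree_pos G D w
  split_ifs with h1 h2 h2
  · exact one_div_le_one_div_of_le (sampledDegree_pos G D w) (le_max_right _ _)
  · exact absurd (mem_posNbhd_comm.1 (Finset.mem_inter.1 h1).1) h2
  · positivity
  · exact le_rfl

theorem sum_sampleKernel_col_le (w : V) : ∑ t, sampleKernel G D t w ≤ degreeRatio G D w := by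
  refine (Finset.sum_le_sum fun t _ => sampleKernel_le G D t w).trans ?_
  rw [← Finset.sum_filter, Finset.filter_mem_eq_inter, Finset.univ_inter, Finset.sum_const,
    nsmul_eq_mul, mul_one_div]
  exact le_rfl

/-- Of the two entries of the maximum in the kernel, the number of isolated neighbours normalizes
the rows and the degree of `v` normalizes the columns. -/
theorem sum_isolatedKernel_le (t : V) : ∑ v, isolatedKernel G D R C t v ≤ 1 := by
  unfold isolatedKernel
  rw [← Finset.sum_filter, Finset.filter_mem_eq_inter, Finset.univ_inter]
  rcases Finset.eq_empty_or_nonempty (isolatedNbrs G D R C t) with h | h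
  · simp [h]
  · have hpos : (0 : ℝ) < ((isolatedNbrs G D R C t).card : ℝ) := by
      exact_mod_cast Finset.card_pos.2 h
    calc _ ≤ (isolatedNbrs G D R C t).card • (1 / ((isolatedNbrs G D R C t).card : ℝ)) :=
          Finset.sum_le_card_nsmul _ _ _ fun v _ =>
            one_div_le_one_div_of_le hpos (le_max_left _ _)
      _ = 1 := by
          rw [nsmul_eq_mul, mul_one_div, div_self hpos.ne']

theorem sum_isolatedKernel_col_le (v : V) : ∑ t, isolatedKernel G D R C t v ≤ 1 := by
  have hpos : (0 : ℝ) < ((posNbhd G v).card : ℝ) := by exact_mod_cast card_posNbhd_pos G v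
  calc ∑ t, isolatedKernel G D R C t v
      ≤ ∑ t, if t ∈ posNbhd G v then 1 / ((posNbhd G v).card : ℝ) else 0 := by
        refine Finset.sum_le_sum fun t _ => ?_
        unfold isolatedKernel
        split_ifs with h1 h2 h2
        · exact one_div_le_one_div_of_le hpos (le_max_right _ _)
        · exact absurd (mem_posNbhd_comm.1 (by simp [isolatedNbrs] at h1; exact h1.1)) h2
        · positivity
        · exact le_rfl
    _ = 1 := by
        rw [← Finset.sum_filter, Finset.filter_mem_eq_inter, Finset.univ_inter, Finset.sum_const,
          nsmul_eq_mul, mul_one_div, div_self hpos.ne']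

theorem sum_perfectKernel_le (t : V) : ∑ v, perfectKernel G D C t v ≤ degreeRatio G D t := by
  by_cases h : PerfectUnseen G D C t
  · rw [degreeRatio_of_empty G D h.1, posNbhd_eq_clusterOf h.2]
    unfold perfectKernel clusterOf
    simp [h]
  · refine le_trans (le_of_eq ?_) (degreeRatio_nonneg G D t)
    simp [perfectKernel, h]

theorem perfectRep_spec {v u : V} (h : C v u) (hu : disVec G C u = 0) :
    C v (perfectRep G C v) ∧ disVec G C (perfectRep G C v) = 0 := by
  have hex : ∃ u, C v u ∧ disVec G C u = 0 := ⟨u, h, hu⟩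
  unfold perfectRep
  rw [dif_pos hex]
  exact hex.choose_spec

/-- All perfect vertices of a cluster have that cluster as neighbourhood. If one of them is unseen,
so is the representative, and its degree ratio is the size of the cluster. The representative is
chosen without reference to `D`, so moment bounds for a fixed vertex apply to its ratio. -/
theorem card_perfectUnseen_le (v : V) :
    ((Finset.univ.filter fun u => C v u ∧ PerfectUnseen G D C u).card : ℝ) ≤
      degreeRatio G D (perfectRep G C v) := by
  rcases Finset.eq_empty_or_nonempty
    (Finset.univ.filter fun u => C v u ∧ PerfectUnseen G D C u) with h | ⟨u, hu⟩
  · rw [h]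
    simpa using degreeRatio_nonneg G D _
  · obtain ⟨-, h1, h2, h3⟩ := Finset.mem_filter.1 hu
    obtain ⟨h4, h5⟩ := perfectRep_spec G C h1 h3
    have h6 := posNbhd_eq_clusterOf h5
    have h7 := posNbhd_eq_clusterOf h3
    rw [← clusterOf_eq h4] at h6
    rw [← clusterOf_eq h1] at h7
    rw [degreeRatio_of_empty G D (by rw [h6, ← h7, h2]), h6]
    refine Nat.cast_le.2 (Finset.card_le_card fun x hx => ?_)
    exact mem_clusterOf.2 (Finset.mem_filter.1 hx).2.1

theorem sum_perfectKernel_col_le (v : V) :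
    ∑ t, perfectKernel G D C t v ≤ degreeRatio G D (perfectRep G C v) := by
  refine le_trans (le_of_eq ?_) (card_perfectUnseen_le G D C v)
  unfold perfectKernel
  rw [Finset.sum_boole]
  congr 2
  refine Finset.filter_congr fun t _ => ?_
  rw [show C t v ↔ C v t from ⟨C.symm, C.symm⟩]

end Kernels

/-! ### Charging ambiguous edges -/

section Charging

variable {V : Type*} [Fintype V] {G : SimpleGraph V} {D R : Finset V} {C : Setoid V}

theorem nonempty_of_not_isIsolated {u : V} (h : ¬ IsIsolated G D R u) : posNbhd G u ∩ D ≠ ∅ :=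
  fun h' => h (isIsolated_of_empty G D R h')

/-- The union of the two sampled neighbourhoods is at least as large as either of them. If the edge
is positive, `C` keeps the ends together and a fraction `closeRadius` of the union is in the
symmetric difference; if negative, `C` separates them and 3/10 of the union is common to both.
Either part consists of disagreements at the ends. -/
theorem max_le_of_mem_ambiguous {t v : V} (h : v ∈ ambiguous G D R t) (hd : ¬ Disagrees G C t v) :
    closeRadius * max (sampledDegree G D t) (sampledDegree G D v) ≤
      disVec G C t + disVec G C v := by
  obtain ⟨hne, ht, hv, hcase⟩ := mem_ambiguous.1 h
  have hmul := corrDist_mul_card G D hne.symm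
  have hic := card_inter_add_card_symmDiff (posNbhd G t ∩ D) (posNbhd G v ∩ D)
  set U : ℝ := ((posNbhd G t ∩ D ∪ posNbhd G v ∩ D).card : ℝ) with hU
  have hic' : ((posNbhd G t ∩ D ∩ (posNbhd G v ∩ D)).card : ℝ) +
      ((symmDiff (posNbhd G t ∩ D) (posNbhd G v ∩ D)).card : ℝ) = U := by
    rw [hU]
    exact_mod_cast hic
  have hU0 : 0 ≤ U := Nat.cast_nonneg _
  have hmax : max (sampledDegree G D t) (sampledDegree G D v) ≤ U := by
    rw [sampledDegree_of_nonempty G D (nonempty_of_not_isIsolated ht),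
      sampledDegree_of_nonempty G D (nonempty_of_not_isIsolated hv), max_le_iff, hU]
    exact ⟨by exact_mod_cast Finset.card_le_card Finset.subset_union_left,
      by exact_mod_cast Finset.card_le_card Finset.subset_union_right⟩
  have hκ := closeRadius_eq
  have hκ0 : 0 ≤ closeRadius := by rw [hκ]; norm_num
  refine (mul_le_mul_of_nonneg_left hmax hκ0).trans ?_
  unfold Disagrees at hd
  rcases hcase with ⟨hadj, hc⟩ | ⟨hadj, hc⟩
  · have hC : C t v := by tauto
    have := card_symmDiff_posNbhd_le (G := G) hC D
    nlinarith
  · have hC : ¬ C t v := by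
      have := hne.symm
      tauto
    have := card_inter_posNbhd_le (G := G) hC D
    rw [hκ]
    nlinarith

/-- The number of ambiguous edges at a vertex is controlled by the disagreements of `C`. -/
theorem card_ambiguous_le (t : V) :
    ((ambiguous G D R t).card : ℝ) ≤ disVec G C t + 1 / closeRadius *
      ∑ v, ambiguousKernel G D R t v * (disVec G C t + disVec G C v) := by
  have hκ0 : 0 < closeRadius := by rw [closeRadius_eq]; norm_num
  have h1 : ((ambiguous G D R t).card : ℝ) ≤ ((disagreeSet G C t).card : ℝ) +
      ((ambiguous G D R t \ disagreeSet G C t).card : ℝ) := by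
    have := Finset.card_le_card_sdiff_add_card (t := disagreeSet G C t) (s := ambiguous G D R t)
    have h : ((ambiguous G D R t).card : ℝ) ≤ ((ambiguous G D R t \ disagreeSet G C t).card : ℝ)
      + ((disagreeSet G C t).card : ℝ) := by exact_mod_cast this
    linarith
  rw [card_disagreeSet] at h1
  refine h1.trans (add_le_add_right ?_ _)
  rw [Finset.mul_sum]
  calc ((ambiguous G D R t \ disagreeSet G C t).card : ℝ)
      = ∑ v ∈ ambiguous G D R t \ disagreeSet G C t, (1 : ℝ) := by simp
    _ ≤ ∑ v ∈ ambiguous G D R t \ disagreeSet G C t, 1 / closeRadius *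
        (ambiguousKernel G D R t v * (disVec G C t + disVec G C v)) := by
        -- Each ambiguous edge on which `C` is right receives at least 1 from the disagreements at
        -- its two ends.
        refine Finset.sum_le_sum fun v hv => ?_
        obtain ⟨h2, h3⟩ := Finset.mem_sdiff.1 hv
        have h4 := max_le_of_mem_ambiguous h2 fun h => h3 (mem_disagreeSet.2 h)
        have hpos : 0 < max (sampledDegree G D t) (sampledDegree G D v) :=
          (sampledDegree_pos G D t).trans_le (le_max_left _ _)
        unfold ambiguousKernel
        rw [if_pos h2, ← mul_assoc, one_div_mul_one_div, one_div_mul_eq_div,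
          one_le_div (mul_pos hκ0 hpos)]
        exact h4
    _ ≤ _ := by
        refine Finset.sum_le_sum_of_subset_of_nonneg (Finset.subset_univ _) fun v _ _ => ?_
        have := ambiguousKernel_nonneg G D R t v
        have := disVec_nonneg (G := G) (C := C) t
        have := disVec_nonneg (G := G) (C := C) v
        positivity

end Charging

/-! ### Charging isolated vertices -/

section IsolatedCharging

variable {V : Type*} [Fintype V] {G : SimpleGraph V} {D R : Finset V} {C : Setoid V}

theorem sum_sampleKernel_mul_ge {t : V} {W : Finset V} (hW : W ⊆ posNbhd G t ∩ D) {f : V → ℝ}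
    (h : ∀ w ∈ W, f w * max (sampledDegree G D t) (sampledDegree G D w) ≤ disVec G C w) :
    ∑ w ∈ W, f w ≤ ∑ w, sampleKernel G D t w * disVec G C w := by
  refine (Finset.sum_le_sum fun w hw => ?_).trans
    (Finset.sum_le_sum_of_subset_of_nonneg (Finset.subset_univ W) fun w _ _ =>
      mul_nonneg (sampleKernel_nonneg G D t w) (disVec_nonneg w))
  have hpos : 0 < max (sampledDegree G D t) (sampledDegree G D w) :=
    (sampledDegree_pos G D t).trans_le (le_max_left _ _)
  unfold sampleKernel
  rw [if_pos (hW hw), one_div_mul_eq_div, le_div_iff₀ hpos]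
  exact h w hw

/-- The common cluster contains at most `1 + 1/10` times the sampled degree of `t` in sampled
vertices, less than 11/100 of the sampled degree of `w`; the other sampled neighbours of `w` are cut
off from it. -/
theorem disVec_ge_of_large {t w : V} (ht : disVec G C t ≤ sampledDegree G D t / 10)
    (hw : w ∈ posNbhd G t ∩ D) (hC : C t w)
    (hlarge : 10 * sampledDegree G D t < sampledDegree G D w) :
    (89 / 100) * max (sampledDegree G D t) (sampledDegree G D w) ≤ disVec G C w := by
  have h1 := card_clusterOf_inter_le (G := G) (C := C) t D
  have h2 := card_posNbhd_inter_le (G := G) (C := C) w D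
  have h3 := card_le_sampledDegree G D t
  have h4 := sampledDegree_pos G D t
  rw [clusterOf_eq hC] at h1
  have hne : posNbhd G w ∩ D ≠ ∅ := Finset.ne_empty_of_mem
    (Finset.mem_inter.2 ⟨self_mem_posNbhd w, (Finset.mem_inter.1 hw).2⟩)
  rw [sampledDegree_of_nonempty G D hne] at hlarge ⊢
  rw [max_eq_right (by linarith)]
  linarith

/-- An isolated vertex that is seen by the distance sample pays for its sampled degree by
disagreements at itself and at its sampled neighbours. -/
theorem sampledDegree_le_of_isIsolated {t : V} (hiso : IsIsolated G D R t)
    (hne : posNbhd G t ∩ D ≠ ∅) :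
    sampledDegree G D t ≤ 40 * (disVec G C t + ∑ w, sampleKernel G D t w * disVec G C w) := by
  have hS : 0 ≤ ∑ w, sampleKernel G D t w * disVec G C w := Finset.sum_nonneg fun w _ =>
      mul_nonneg (sampleKernel_nonneg G D t w) (disVec_nonneg w)
  set a := sampledDegree G D t with ha
  have ha1 : 1 ≤ a := one_le_sampledDegree G D t
  have hacard : a = ((posNbhd G t ∩ D).card : ℝ) := sampledDegree_of_nonempty G D hne
  have hy0 := disVec_nonneg (G := G) (C := C) t
  by_cases hy : a / 10 ≤ disVec G C t
  · linarith
  push Not at hy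
  set Lg := (posNbhd G t ∩ D).filter fun w => C t w ∧ 10 * a < sampledDegree G D w with hLg
  set W := (posNbhd G t ∩ D).filter fun w => C t w ∧ ¬ 10 * a < sampledDegree G D w with hWdef
  -- If many sampled neighbours in the cluster of `t` have a much larger sampled degree, they pay on
  -- their own, each contributing at least 89/100.
  by_cases hL : a / 10 ≤ (Lg.card : ℝ)
  · have h1 := sum_sampleKernel_mul_ge (G := G) (C := C) (t := t) (W := Lg)
      (f := fun _ => 89 / 100) (Finset.filter_subset _ _) (fun w hw => by
        obtain ⟨h1, h2, h3⟩ := Finset.mem_filter.1 hw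
        exact disVec_ge_of_large hy.le h1 h2 h3)
    rw [Finset.sum_const, nsmul_eq_mul] at h1
    linarith
  push Not at hL
  set T := R.filter fun v => v ∉ posNbhd G t ∧ corrDist G D t v ≤ 7 / 10 with hT
  set T' := T.filter fun v => ¬ C t v with hT'
  have hTcard : 10 / 3 * a ≤ (T.card : ℝ) := by
    rw [hacard]
    exact hiso
  -- Of at least `10a/3` short negative neighbours of `t`, fewer than `a/10` share its cluster.
  have hT'card : 3 * a ≤ (T'.card : ℝ) := by
    have h1 : T ⊆ T' ∪ disagreeSet G C t := by
      intro v hv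
      rw [Finset.mem_union]
      by_cases h : C t v
      · exact Or.inr (mem_disagreeSet_of_not_mem (Finset.mem_filter.1 hv).2.1 h)
      · exact Or.inl (Finset.mem_filter.2 ⟨hv, h⟩)
    have h2 : (T.card : ℝ) ≤ T'.card + (disagreeSet G C t).card := by
      exact_mod_cast (Finset.card_le_card h1).trans (Finset.card_union_le _ _)
    rw [card_disagreeSet] at h2
    linarith
  -- A distance of at most 7/10 means at least `3a/10` common sampled neighbours; fewer than `a/10`
  -- are cut off from `t` and fewer than `a/10` lie in `Lg`.
  have hmany : ∀ v ∈ T', a / 10 ≤ ((W.filter fun w => w ∈ posNbhd G v).card : ℝ) := by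
    intro v hv
    obtain ⟨hvT, hvC⟩ := Finset.mem_filter.1 hv
    obtain ⟨-, hvN, hvd⟩ := Finset.mem_filter.1 hvT
    have hne' : t ≠ v := by
      rintro rfl
      exact hvN (self_mem_posNbhd t)
    have h1 := corrDist_mul_card G D hne'
    have h2 := card_inter_add_card_symmDiff (posNbhd G t ∩ D) (posNbhd G v ∩ D)
    have h2' : ((posNbhd G t ∩ D ∩ (posNbhd G v ∩ D)).card : ℝ) +
      ((symmDiff (posNbhd G t ∩ D) (posNbhd G v ∩ D)).card : ℝ) =
        ((posNbhd G t ∩ D ∪ posNbhd G v ∩ D).card : ℝ) := by exact_mod_cast h2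
    have h3 : a ≤ ((posNbhd G t ∩ D ∪ posNbhd G v ∩ D).card : ℝ) := by
      rw [hacard]
      exact_mod_cast Finset.card_le_card Finset.subset_union_left
    have h4 : posNbhd G t ∩ D ∩ (posNbhd G v ∩ D) ⊆
        ((W.filter fun w => w ∈ posNbhd G v) ∪ Lg) ∪ disagreeSet G C t := by
      intro w hw
      obtain ⟨hw1, hw2⟩ := Finset.mem_inter.1 hw
      simp only [Finset.mem_union]
      by_cases hwC : C t w
      · left
        by_cases hwl : 10 * a < sampledDegree G D w
        · exact Or.inr (Finset.mem_filter.2 ⟨hw1, hwC, hwl⟩)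
        · exact Or.inl (Finset.mem_filter.2
            ⟨Finset.mem_filter.2 ⟨hw1, hwC, hwl⟩, (Finset.mem_inter.1 hw2).1⟩)
      · exact Or.inr (mem_disagreeSet_of_mem_not (Finset.mem_inter.1 hw1).1 hwC)
    have h5 : ((posNbhd G t ∩ D ∩ (posNbhd G v ∩ D)).card : ℝ) ≤
        ((W.filter fun w => w ∈ posNbhd G v).card : ℝ) + Lg.card + (disagreeSet G C t).card := by
      exact_mod_cast (Finset.card_le_card h4).trans ((Finset.card_union_le _ _).trans
        (Nat.add_le_add_right (Finset.card_union_le _ _) _))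
    rw [card_disagreeSet] at h5
    nlinarith
  have hfew : ∀ w ∈ W, ((T'.filter fun v => w ∈ posNbhd G v).card : ℝ) ≤ disVec G C w := by
    intro w hw
    rw [← card_disagreeSet]
    refine Nat.cast_le.2 (Finset.card_le_card fun v hv => ?_)
    obtain ⟨hv1, hv2⟩ := Finset.mem_filter.1 hv
    refine mem_disagreeSet_of_mem_not (mem_posNbhd_comm.1 hv2) fun h => ?_
    exact (Finset.mem_filter.1 hv1).2 (C.trans (Finset.mem_filter.1 hw).2.1 h)
  -- Double counting of the positive edges between `T'` and `W`, all of which `C` cuts, because `W`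
  -- is in the cluster of `t` and `T'` is not.
  have hdouble : 3 * a * (a / 10) ≤ ∑ w ∈ W, disVec G C w := by
    calc 3 * a * (a / 10) ≤ T'.card * (a / 10) := by gcongr
      _ = ∑ v ∈ T', a / 10 := by rw [Finset.sum_const, nsmul_eq_mul]
      _ ≤ ∑ v ∈ T', ((W.filter fun w => w ∈ posNbhd G v).card : ℝ) := Finset.sum_le_sum hmany
      _ = ∑ w ∈ W, ((T'.filter fun v => w ∈ posNbhd G v).card : ℝ) := by
          exact_mod_cast Finset.sum_card_bipartiteAbove_eq_sum_card_bipartiteBelow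
            (s := T') (t := W) (fun v w => w ∈ posNbhd G v)
      _ ≤ _ := Finset.sum_le_sum hfew
  have h1 := sum_sampleKernel_mul_ge (G := G) (D := D) (C := C) (t := t) (W := W)
    (f := fun w => disVec G C w / (10 * a)) (Finset.filter_subset _ _) (fun w hw => by
      have h2 := not_lt.1 (Finset.mem_filter.1 hw).2.2
      have h3 := disVec_nonneg (G := G) (C := C) w
      have h4 : max (sampledDegree G D t) (sampledDegree G D w) ≤ 10 * a :=
        max_le (by rw [← ha]; linarith) h2
      calc disVec G C w / (10 * a) * max (sampledDegree G D t) (sampledDegree G D w)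
          ≤ disVec G C w / (10 * a) * (10 * a) := by gcongr
        _ = disVec G C w := by field_simp)
  rw [← Finset.sum_div] at h1
  -- The factor 40 in the statement is enough because `40 · 3/100 ≥ 1`.
  have h5 : 3 * a / 100 ≤ (∑ w ∈ W, disVec G C w) / (10 * a) := by
    rw [le_div_iff₀ (by linarith)]
    nlinarith
  linarith

theorem card_posNbhd_le_isolatedCharge {t : V} (hiso : IsIsolated G D R t)
    (h : posNbhd G t ∩ D ≠ ∅ ∨ disVec G C t ≠ 0) :
    ((posNbhd G t).card : ℝ) ≤ isolatedCharge G D C t := by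
  have hρ := degreeRatio_nonneg G D t
  unfold isolatedCharge
  by_cases hne : posNbhd G t ∩ D = ∅
  · have hy : 1 ≤ disVec G C t := (disVec_eq_zero_or t).resolve_left (by tauto)
    have hS : 0 ≤ ∑ w, sampleKernel G D t w * disVec G C w := Finset.sum_nonneg fun w _ =>
      mul_nonneg (sampleKernel_nonneg G D t w) (disVec_nonneg w)
    rw [← degreeRatio_of_empty G D hne]
    nlinarith
  · have h1 := sampledDegree_le_of_isIsolated (C := C) hiso hne
    rw [← degreeRatio_mul G D t]
    calc degreeRatio G D t * sampledDegree G D t ≤ degreeRatio G D t * (40 *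
          (disVec G C t + ∑ w, sampleKernel G D t w * disVec G C w)) := by gcongr
      _ = _ := by ring

theorem mem_isolatedNbrs {t v : V} : v ∈ isolatedNbrs G D R C t ↔
    v ∈ posNbhd G t ∧ C t v ∧ IsIsolated G D R v ∧
      (posNbhd G v ∩ D ≠ ∅ ∨ disVec G C v ≠ 0) := by
  simp [isolatedNbrs]

/-- Every isolated neighbour `v` contributes at least 1: its degree is at most its charge, and the
number of isolated neighbours of `t` is at most the size of the common cluster, hence at most the
degree of `v` plus its disagreements. -/
theorem card_isolatedNbrs_le (t : V) :
    ((isolatedNbrs G D R C t).card : ℝ) ≤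
      ∑ v, isolatedKernel G D R C t v * (disVec G C v + isolatedCharge G D C v) := by
  calc ((isolatedNbrs G D R C t).card : ℝ) = ∑ v ∈ isolatedNbrs G D R C t, (1 : ℝ) := by simp
    _ ≤ ∑ v ∈ isolatedNbrs G D R C t,
        isolatedKernel G D R C t v * (disVec G C v + isolatedCharge G D C v) := by
        refine Finset.sum_le_sum fun v hv => ?_
        obtain ⟨h1, h2, h3, h4⟩ := mem_isolatedNbrs.1 hv
        have h5 := card_posNbhd_le_isolatedCharge h3 h4
        have h6 := card_clusterOf_le (G := G) (C := C) v
        rw [← clusterOf_eq h2] at h6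
        have h7 : ((isolatedNbrs G D R C t).card : ℝ) ≤ ((clusterOf C t).card : ℝ) :=
          Nat.cast_le.2 (Finset.card_le_card fun w hw =>
            mem_clusterOf.2 (mem_isolatedNbrs.1 hw).2.1)
        have hpos : (0 : ℝ) < ((posNbhd G v).card : ℝ) := by
          exact_mod_cast card_posNbhd_pos G v
        have hy := disVec_nonneg (G := G) (C := C) v
        unfold isolatedKernel
        rw [if_pos hv, one_div_mul_eq_div, one_le_div (hpos.trans_le (le_max_right _ _)),
          max_le_iff]
        exact ⟨by linarith, by linarith⟩
    _ ≤ _ := Finset.sum_le_sum_of_subset_of_nonneg (Finset.subset_univ _) fun v _ _ =>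
        mul_nonneg (isolatedKernel_nonneg G D R C t v)
          (add_nonneg (disVec_nonneg v) (isolatedCharge_nonneg G D C v))

/-- A perfectly clustered vertex that is not seen by the distance sample has no perfectly clustered
neighbours that are seen by it. -/
theorem one_le_disVec_of_perfectUnseen {t v : V} (ht : PerfectUnseen G D C t) (hC : C t v)
    (hv : ¬ PerfectUnseen G D C v) : 1 ≤ disVec G C v := by
  refine (disVec_eq_zero_or v).resolve_left fun h0 => hv ⟨?_, h0⟩
  rw [posNbhd_eq_clusterOf h0, ← clusterOf_eq hC, ← posNbhd_eq_clusterOf ht.2]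
  exact ht.1

variable (G D R C) in
/-- The positive edges at `t` inside its cluster that have an isolated end, those between
perfectly clustered unseen vertices being left out. -/
def isolatedEdges (t : V) : Finset V :=
  Finset.univ.filter fun v => v ∈ posNbhd G t ∧ C t v ∧
    (IsIsolated G D R t ∨ IsIsolated G D R v) ∧
    ¬ (PerfectUnseen G D C t ∧ PerfectUnseen G D C v)

theorem mem_isolatedEdges {t v : V} : v ∈ isolatedEdges G D R C t ↔ v ∈ posNbhd G t ∧ C t v ∧
    (IsIsolated G D R t ∨ IsIsolated G D R v) ∧
    ¬ (PerfectUnseen G D C t ∧ PerfectUnseen G D C v) := by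
  simp [isolatedEdges]

/-- If `t` is perfect and unseen, every other end of these edges is imperfect and pays 1. If `t` is
isolated otherwise, its charge covers its whole degree. In the remaining case the other ends are
isolated neighbours or perfect unseen vertices of the cluster; if there is one of the latter, `t`
has a disagreement, which pays for the cluster. -/
theorem card_isolatedEdges_le (t : V) :
    ((isolatedEdges G D R C t).card : ℝ) ≤ isolatedCharge G D C t +
      ∑ v, isolatedKernel G D R C t v * (disVec G C v + isolatedCharge G D C v) +
      degreeRatio G D (perfectRep G C t) * disVec G C t +
      ∑ v, perfectKernel G D C t v * disVec G C v := by
  have n1 := isolatedCharge_nonneg G D C t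
  have n2 : 0 ≤ ∑ v, isolatedKernel G D R C t v * (disVec G C v + isolatedCharge G D C v) :=
    Finset.sum_nonneg fun v _ => mul_nonneg (isolatedKernel_nonneg G D R C t v)
          (add_nonneg (disVec_nonneg v) (isolatedCharge_nonneg G D C v))
  have n3 : 0 ≤ degreeRatio G D (perfectRep G C t) * disVec G C t :=
    mul_nonneg (degreeRatio_nonneg G D _) (disVec_nonneg t)
  have n4 : 0 ≤ ∑ v, perfectKernel G D C t v * disVec G C v :=
    Finset.sum_nonneg fun v _ => mul_nonneg (perfectKernel_nonneg G D C t v) (disVec_nonneg v)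
  by_cases hp : PerfectUnseen G D C t
  · have h1 : ((isolatedEdges G D R C t).card : ℝ) ≤
        ∑ v, perfectKernel G D C t v * disVec G C v := by
      calc ((isolatedEdges G D R C t).card : ℝ) = ∑ v ∈ isolatedEdges G D R C t, (1 : ℝ) := by
            simp
        _ ≤ ∑ v ∈ isolatedEdges G D R C t, perfectKernel G D C t v * disVec G C v := by
            refine Finset.sum_le_sum fun v hv => ?_
            obtain ⟨-, h2, -, h3⟩ := mem_isolatedEdges.1 hv
            have := one_le_disVec_of_perfectUnseen hp h2 fun h => h3 ⟨hp, h⟩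
            simpa [perfectKernel, h2, hp] using this
        _ ≤ _ := Finset.sum_le_sum_of_subset_of_nonneg (Finset.subset_univ _) fun v _ _ =>
            mul_nonneg (perfectKernel_nonneg G D C t v) (disVec_nonneg v)
    linarith
  by_cases hi : IsIsolated G D R t
  · have h1 := card_posNbhd_le_isolatedCharge (C := C) hi (by
      unfold PerfectUnseen at hp
      tauto)
    have h2 : ((isolatedEdges G D R C t).card : ℝ) ≤ ((posNbhd G t).card : ℝ) :=
      Nat.cast_le.2 (Finset.card_le_card fun v hv => (mem_isolatedEdges.1 hv).1)
    linarith
  · set U := (Finset.univ.filter fun u => C t u ∧ PerfectUnseen G D C u) with hU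
    have h1 : isolatedEdges G D R C t ⊆ isolatedNbrs G D R C t ∪ U := by
      intro v hv
      obtain ⟨h2, h3, h4, -⟩ := mem_isolatedEdges.1 hv
      rw [Finset.mem_union]
      by_cases hv' : PerfectUnseen G D C v
      · exact Or.inr (Finset.mem_filter.2 ⟨Finset.mem_univ _, h3, hv'⟩)
      · refine Or.inl (mem_isolatedNbrs.2 ⟨h2, h3, h4.resolve_left hi, ?_⟩)
        unfold PerfectUnseen at hv'
        tauto
    have h2 : ((isolatedEdges G D R C t).card : ℝ) ≤
        ((isolatedNbrs G D R C t).card : ℝ) + (U.card : ℝ) := by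
      exact_mod_cast (Finset.card_le_card h1).trans (Finset.card_union_le _ _)
    have h3 := card_isolatedNbrs_le (G := G) (D := D) (R := R) (C := C) t
    have h4 : (U.card : ℝ) ≤ degreeRatio G D (perfectRep G C t) * disVec G C t := by
      have h5 := card_perfectUnseen_le G D C t
      rcases Finset.eq_empty_or_nonempty U with h | ⟨u, hu⟩
      · rw [h]
        simpa using n3
      · obtain ⟨-, h6, h7⟩ := Finset.mem_filter.1 hu
        have h8 := one_le_disVec_of_perfectUnseen h7 (C.symm h6) hp
        exact h5.trans (le_mul_of_one_le_right (degreeRatio_nonneg G D _) h8)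
    linarith

end IsolatedCharging

/-! ### How well a sample represents a set -/

section SamplingDefect

variable {V : Type*} [Fintype V]

/-- The size of `X` if the sample `A` meets `X` in less than half the expected number of points,
and `0` otherwise. -/
def samplingDefect (q : ℝ) (X A : Finset V) : ℝ :=
  if ((X ∩ A).card : ℝ) < q / 2 * X.card then (X.card : ℝ) else 0

omit [Fintype V] in
theorem samplingDefect_nonneg (q : ℝ) (X A : Finset V) : 0 ≤ samplingDefect q X A := by
  unfold samplingDefect
  split_ifs <;> positivity

omit [Fintype V] in
-- Sizes are estimated deterministically, and all failure of the sampling is put into one additive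
-- random term.
theorem card_le_of_samplingDefect {q : ℝ} (hq : 0 < q) (X A : Finset V) :
    (X.card : ℝ) ≤ 2 / q * ((X ∩ A).card : ℝ) + samplingDefect q X A := by
  have h0 : 0 ≤ 2 / q * ((X ∩ A).card : ℝ) := by positivity
  unfold samplingDefect
  split_ifs with h
  · linarith
  · push Not at h
    rw [add_zero, div_mul_eq_mul_div, le_div_iff₀ hq]
    linarith

omit [Fintype V] in
theorem samplingDefect_of_disjoint {q : ℝ} (hq : 0 < q) {X A : Finset V} (h : X ∩ A = ∅) :
    samplingDefect q X A = X.card := by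
  have := card_le_of_samplingDefect hq X A
  rw [h] at this
  refine le_antisymm ?_ (by simpa using this)
  unfold samplingDefect
  split_ifs <;> simp

variable (G : SimpleGraph V) (D R P B : Finset V)

/-- No center is close to `t`. -/
def CenterFree (t : V) : Prop := closeBall G D R t ∩ P = ∅

/-- The error in estimating the size of the ball around `t` by sampling. -/
def ballDefect (q : ℝ) (t : V) : ℝ :=
  samplingDefect q (closeBall G D R t) P + samplingDefect q (closeBall G D R t) B

/-- The kernel that spreads the cost of cut edges between vertices far from all centers. -/
def closeKernel (t v : V) : ℝ :=
  if adjDist G D R t v ≤ closeRadius ∧ CenterFree G D R P t ∧ CenterFree G D R P v then 1 else 0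

theorem ballDefect_nonneg (q : ℝ) (t : V) : 0 ≤ ballDefect G D R P B q t :=
  add_nonneg (samplingDefect_nonneg _ _ _) (samplingDefect_nonneg _ _ _)

theorem closeKernel_nonneg (t v : V) : 0 ≤ closeKernel G D R P t v := by
  unfold closeKernel
  split_ifs <;> norm_num

theorem closeKernel_comm (t v : V) : closeKernel G D R P t v = closeKernel G D R P v t := by
  unfold closeKernel
  rw [adjDist_comm]
  congr 1
  rw [and_comm (a := CenterFree G D R P t)]

/-- A row is nonzero only if `P` misses the ball around `t`, and then the defect is the size of the
whole ball. -/
theorem sum_closeKernel_le {q : ℝ} (hq : 0 < q) (t : V) :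
    ∑ v, closeKernel G D R P t v ≤ ballDefect G D R P B q t := by
  by_cases h : CenterFree G D R P t
  · unfold ballDefect
    rw [samplingDefect_of_disjoint hq h]
    refine le_trans ?_ (le_add_of_nonneg_right (samplingDefect_nonneg _ _ _))
    unfold closeKernel
    rw [Finset.sum_boole]
    refine Nat.cast_le.2 (Finset.card_le_card fun v hv => ?_)
    exact mem_closeBall.2 (Finset.mem_filter.1 hv).2.1
  · refine le_trans (le_of_eq ?_) (ballDefect_nonneg G D R P B q t)
    simp [closeKernel, h]

theorem degreeRatio_le {q : ℝ} (hq : 0 < q) (u : V) :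
    degreeRatio G D u ≤ 2 / q + samplingDefect q (posNbhd G u) D := by
  have h1 := card_le_of_samplingDefect hq (posNbhd G u) D
  have h2 := card_le_sampledDegree G D u
  have h3 := one_le_sampledDegree G D u
  have h4 := samplingDefect_nonneg q (posNbhd G u) D
  unfold degreeRatio
  rw [div_le_iff₀ (sampledDegree_pos G D u)]
  have h5 : 0 ≤ 2 / q := by positivity
  nlinarith [mul_le_mul_of_nonneg_left h2 h5]

/-- The vertices joined to `u` by a negative edge that is short in the sampled metric. -/
def shortNegative (u : V) : Finset V :=
  Finset.univ.filter fun v => v ∉ posNbhd G u ∧ corrDist G D u v ≤ 7 / 10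

/-- Ambiguous edges occur only at vertices that are not isolated, for which the test of isolation
limits the number of short negative edges seen by `R`. -/
theorem card_ambiguous_div_le {q : ℝ} (hq : 0 < q) (u : V) :
    ((ambiguous G D R u).card : ℝ) / sampledDegree G D u ≤ 9 / q +
      samplingDefect q (posNbhd G u) D + samplingDefect q (shortNegative G D u) R := by
  have h1 := degreeRatio_le G D hq u
  have h3 := samplingDefect_nonneg q (posNbhd G u) D
  have h4 := samplingDefect_nonneg q (shortNegative G D u) R
  have hpos := sampledDegree_pos G D u
  by_cases hi : IsIsolated G D R u
  · have : ambiguous G D R u = ∅ := by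
      refine Finset.eq_empty_of_forall_notMem fun v hv => ?_
      exact (mem_ambiguous.1 hv).2.1 hi
    rw [this, Finset.card_empty, Nat.cast_zero, zero_div]
    positivity
  · have hsub : ambiguous G D R u ⊆ posNbhd G u ∪ shortNegative G D u := by
      intro v hv
      obtain ⟨h5, -, -, h6⟩ := mem_ambiguous.1 hv
      rw [Finset.mem_union]
      rcases h6 with h6 | h6
      · exact Or.inl (mem_posNbhd.2 (Or.inr h6.1))
      · refine Or.inr (Finset.mem_filter.2 ⟨Finset.mem_univ _, fun h => ?_, h6.2⟩)
        exact (mem_posNbhd.1 h).elim h5 h6.1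
    have hcard : ((ambiguous G D R u).card : ℝ) ≤
        ((posNbhd G u).card : ℝ) + ((shortNegative G D u).card : ℝ) := by
      exact_mod_cast (Finset.card_le_card hsub).trans (Finset.card_union_le _ _)
    have hR : ((shortNegative G D u ∩ R).card : ℝ) ≤ 10 / 3 * sampledDegree G D u := by
      unfold IsIsolated at hi
      push Not at hi
      have h7 := card_le_sampledDegree G D u
      have h8 : shortNegative G D u ∩ R =
          R.filter fun v => v ∉ posNbhd G u ∧ corrDist G D u v ≤ 7 / 10 := by
        ext v
        simp [shortNegative, and_comm]
      rw [h8]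
      linarith
    have h9 := card_le_of_samplingDefect hq (shortNegative G D u) R
    -- Here `2 · 10/3 ≤ 7`; with `2/q` for the positive neighbours this gives the `9/q` of the
    -- statement.
    have h10 : 2 / q * ((shortNegative G D u ∩ R).card : ℝ) ≤
        7 / q * sampledDegree G D u := by
      rw [div_mul_eq_mul_div, div_mul_eq_mul_div]
      gcongr ?_ / q
      linarith
    have h11 : samplingDefect q (shortNegative G D u) R ≤
        samplingDefect q (shortNegative G D u) R * sampledDegree G D u :=
      le_mul_of_one_le_right h4 (one_le_sampledDegree G D u)
    rw [div_le_iff₀ hpos]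
    have h12 := degreeRatio_mul G D u
    have h13 : degreeRatio G D u * sampledDegree G D u ≤
        (2 / q + samplingDefect q (posNbhd G u) D) * sampledDegree G D u := by gcongr
    have h14 : (9 : ℝ) / q = 2 / q + 7 / q := by ring
    rw [h14]
    nlinarith

end SamplingDefect

/-! ### Clusters of the first run of Pivot -/

section UnseenPivots

variable {V : Type*} [Fintype V] (G : SimpleGraph V) (D : Finset V) (π : V → V)

/-- The kernel that spreads the cost of negative edges inside the clusters of unseen pivots. -/
def pivotKernel (t w : V) : ℝ :=
  if w = π t ∧ posNbhd G w ∩ D = ∅ ∧ t ∈ posNbhd G w then degreeRatio G D w else 0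

theorem pivotKernel_nonneg (t w : V) : 0 ≤ pivotKernel G D π t w := by
  unfold pivotKernel
  split_ifs
  exacts [degreeRatio_nonneg G D w, le_rfl]

theorem sum_pivotKernel_le (t : V) :
    ∑ w, pivotKernel G D π t w ≤ degreeRatio G D (π t) := by
  rw [Finset.sum_eq_single (π t)]
  · unfold pivotKernel
    split_ifs
    exacts [le_rfl, degreeRatio_nonneg G D _]
  · intro w _ hw
    unfold pivotKernel
    rw [if_neg fun h => hw h.1]
  · intro h
    exact absurd (Finset.mem_univ _) h

/-- An unseen pivot receives charge only from its neighbours, and each time its degree, which is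
also its ratio; hence the square. -/
theorem sum_pivotKernel_col_le (w : V) :
    ∑ t, pivotKernel G D π t w ≤ degreeRatio G D w ^ 2 := by
  by_cases h : posNbhd G w ∩ D = ∅
  · calc ∑ t, pivotKernel G D π t w
        ≤ ∑ t, if t ∈ posNbhd G w then degreeRatio G D w else 0 := by
          refine Finset.sum_le_sum fun t _ => ?_
          have := degreeRatio_nonneg G D w
          unfold pivotKernel
          split_ifs with h1 h2 h2
          · exact le_rfl
          · exact absurd h1.2.2 h2
          · exact this
          · exact le_rfl
      _ = degreeRatio G D w ^ 2 := by
          rw [← Finset.sum_filter, Finset.filter_mem_eq_inter, Finset.univ_inter,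
            Finset.sum_const, nsmul_eq_mul, ← degreeRatio_of_empty G D h, sq]
  · refine le_trans (le_of_eq ?_) (sq_nonneg _)
    simp [pivotKernel, h]

end UnseenPivots

/-! ### Classification of the edges on which the output errs -/

section Rounding

variable {V : Type*} [Fintype V] {G : SimpleGraph V} {S : Finset V}
  {seed : V → Subsample → Bool} {sampleOrder tie arrival : V ↪ ℕ}

theorem eligible_iff {v : V} : Eligible G S seed v ↔ posNbhd G v ∩ sub S seed .d ≠ ∅ :=
  Finset.nonempty_iff_ne_empty

theorem eligible_of_not_isIsolated {v : V}
    (h : ¬ IsIsolated G (sub S seed .d) (sub S seed .r) v) : Eligible G S seed v :=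
  eligible_iff.2 (nonempty_of_not_isIsolated h)

theorem estDist_comm (u v : V) : estDist G S seed u v = estDist G S seed v u :=
  adjDist_comm G _ _ u v

theorem estDist_triangle (u v w : V) :
    estDist G S seed u w ≤ 10 / 7 * (estDist G S seed u v + estDist G S seed v w) :=
  adjDist_triangle G _ _ u v w

theorem nearCenters_nonempty_eligible {v : V} (h : (nearCenters G S seed v).Nonempty) :
    Eligible G S seed v := by
  obtain ⟨u, hu⟩ := h
  exact hu.1

theorem mainAlgorithm_of_nonempty {v : V} (h : (nearCenters G S seed v).Nonempty) :
    mainAlgorithm sampleOrder tie G arrival S seed v =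
      Sum.inl (Function.argminOn (centerKey G tie S seed) (nearCenters G S seed v) h) := by
  unfold mainAlgorithm
  rw [dif_pos h]

theorem mainAlgorithm_of_not_eligible {v : V} (h : ¬ Eligible G S seed v) :
    mainAlgorithm sampleOrder tie G arrival S seed v =
      Sum.inr (pivotOf (processingRank arrival sampleOrder S) (PivotEdge₁ G S seed) v) := by
  unfold mainAlgorithm
  rw [dif_neg fun h' => h (nearCenters_nonempty_eligible h'), if_pos h]

theorem mainAlgorithm_of_leftover {v : V} (h : Leftover G S seed v) :
    mainAlgorithm sampleOrder tie G arrival S seed v =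
      Sum.inr (pivotOf (processingRank arrival sampleOrder S) (PivotEdge₂ G S seed) v) := by
  unfold mainAlgorithm
  rw [dif_neg h.2, if_neg (not_not.2 h.1)]

theorem not_eligible_pivot (rank : V → ℕ ×ₗ ℕ) {v : V} (h : ¬ Eligible G S seed v) :
    ¬ Eligible G S seed (pivotOf rank (PivotEdge₁ G S seed) v) := by
  rcases pivotOf_eq_or_edge rank (PivotEdge₁ G S seed) v with h' | h'
  · rwa [h']
  · exact h'.1

theorem leftover_pivot (rank : V → ℕ ×ₗ ℕ) {v : V} (h : Leftover G S seed v) :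
    Leftover G S seed (pivotOf rank (PivotEdge₂ G S seed) v) ∧
      estDist G S seed (pivotOf rank (PivotEdge₂ G S seed) v) v ≤ cConst * rConst := by
  rcases pivotOf_eq_or_edge rank (PivotEdge₂ G S seed) v with h' | h'
  · rw [h']
    refine ⟨h, ?_⟩
    unfold estDist
    rw [adjDist_self, cConst_mul_rConst]
    norm_num
  · exact ⟨h'.1, h'.2.2.2.le⟩

/-- Vertices in a common cluster are either clustered by the first run of Pivot, or close in the
estimated metric. -/
theorem eq_cluster_cases {t v : V} (h : mainAlgorithm sampleOrder tie G arrival S seed t =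
      mainAlgorithm sampleOrder tie G arrival S seed v) :
    (¬ Eligible G S seed t ∧ ¬ Eligible G S seed v ∧
      pivotOf (processingRank arrival sampleOrder S) (PivotEdge₁ G S seed) t =
        pivotOf (processingRank arrival sampleOrder S) (PivotEdge₁ G S seed) v) ∨
    estDist G S seed t v ≤ 7 / 10 := by
  have hcr := cConst_mul_rConst
  have key : ∀ w, estDist G S seed w t ≤ cConst * rConst → estDist G S seed w v ≤ cConst * rConst →
      estDist G S seed t v ≤ 7 / 10 := by
    intro w h1 h2
    have := estDist_triangle (G := G) (S := S) (seed := seed) t w v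
    rw [estDist_comm t w] at this
    linarith
  have hcases : ∀ x, (nearCenters G S seed x).Nonempty ∨ ¬ Eligible G S seed x ∨
      Leftover G S seed x := by
    intro x
    unfold Leftover
    tauto
  rcases hcases t with ht | ht | ht <;> rcases hcases v with hv | hv | hv
  · rw [mainAlgorithm_of_nonempty ht, mainAlgorithm_of_nonempty hv, Sum.inl.injEq] at h
    have h1 := Function.argminOn_mem (centerKey G tie S seed) _ ht
    have h2 := Function.argminOn_mem (centerKey G tie S seed) _ hv
    rw [← h] at h2
    exact Or.inr (key _ h1.2.2 h2.2.2)
  · rw [mainAlgorithm_of_nonempty ht, mainAlgorithm_of_not_eligible hv] at h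
    exact absurd h (by simp)
  · rw [mainAlgorithm_of_nonempty ht, mainAlgorithm_of_leftover hv] at h
    exact absurd h (by simp)
  · rw [mainAlgorithm_of_not_eligible ht, mainAlgorithm_of_nonempty hv] at h
    exact absurd h (by simp)
  · rw [mainAlgorithm_of_not_eligible ht, mainAlgorithm_of_not_eligible hv, Sum.inr.injEq] at h
    exact Or.inl ⟨ht, hv, h⟩
  -- The two runs of Pivot use labels of the same form, but they cannot collide: pivots of the
  -- second run are eligible and those of the first are not.
  · rw [mainAlgorithm_of_not_eligible ht, mainAlgorithm_of_leftover hv, Sum.inr.injEq] at h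
    have h1 := not_eligible_pivot (processingRank arrival sampleOrder S) ht
    rw [h] at h1
    exact absurd (leftover_pivot _ hv).1.1 h1
  · rw [mainAlgorithm_of_leftover ht, mainAlgorithm_of_nonempty hv] at h
    exact absurd h (by simp)
  · rw [mainAlgorithm_of_leftover ht, mainAlgorithm_of_not_eligible hv, Sum.inr.injEq] at h
    have h1 := not_eligible_pivot (processingRank arrival sampleOrder S) hv
    rw [← h] at h1
    exact absurd (leftover_pivot _ ht).1.1 h1
  · rw [mainAlgorithm_of_leftover ht, mainAlgorithm_of_leftover hv, Sum.inr.injEq] at h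
    have h1 := (leftover_pivot (processingRank arrival sampleOrder S) ht).2
    have h2 := (leftover_pivot (processingRank arrival sampleOrder S) hv).2
    rw [← h] at h2
    exact Or.inr (key _ h1 h2)

/-- If a center separates two close vertices, then the ball around it is ambiguous for both. -/
theorem mem_ambiguous_of_separated {w t v : V} (hwt : estDist G S seed w t ≤ cConst * rConst)
    (hwv : cConst * rConst < estDist G S seed w v) (htv : estDist G S seed t v ≤ closeRadius)
    {x : V} (hx : estDist G S seed w x ≤ rConst) :
    x ∈ ambiguous G (sub S seed .d) (sub S seed .r) t ∧
      x ∈ ambiguous G (sub S seed .d) (sub S seed .r) v := by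
  rw [cConst_mul_rConst] at hwt hwv
  rw [rConst_eq] at hx
  rw [closeRadius_eq] at htv
  have h1 := estDist_triangle (G := G) (S := S) (seed := seed) w t v
  have h2 := estDist_triangle (G := G) (S := S) (seed := seed) w x t
  have h3 := estDist_triangle (G := G) (S := S) (seed := seed) w x v
  have h4 := estDist_triangle (G := G) (S := S) (seed := seed) x w t
  have h5 := estDist_triangle (G := G) (S := S) (seed := seed) x w v
  rw [estDist_comm x t] at h2 h4
  rw [estDist_comm x v] at h3 h5
  rw [estDist_comm x w] at h4 h5
  constructor
  -- The distances of `w` to `t` and `v` are both near `cr`, up to factors `δ` and an error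
  -- `closeRadius`. Passing from `w` to a point within `r` leaves them between `closeRadius` and
  -- 7/10; the four estimates are numerical.
  · refine mem_ambiguous_of_adjDist ?_ ?_
    · rw [closeRadius_eq]
      change _ ≤ estDist G S seed t x
      linarith
    · change estDist G S seed t x ≤ _
      linarith
  · refine mem_ambiguous_of_adjDist ?_ ?_
    · rw [closeRadius_eq]
      change _ ≤ estDist G S seed v x
      linarith
    · change estDist G S seed v x ≤ _
      linarith

/-- Two vertices of different clusters, not both left over, are separated by a center which comes
before all centers near one of them. -/
theorem exists_separating_center {t v : V}
    (h : mainAlgorithm sampleOrder tie G arrival S seed t ≠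
      mainAlgorithm sampleOrder tie G arrival S seed v)
    (ht : Eligible G S seed t) (hv : Eligible G S seed v)
    (hne : (nearCenters G S seed t ∪ nearCenters G S seed v).Nonempty) :
    ∃ w, ((estDist G S seed w t ≤ cConst * rConst ∧ cConst * rConst < estDist G S seed w v) ∨
      (estDist G S seed w v ≤ cConst * rConst ∧ cConst * rConst < estDist G S seed w t)) ∧
      ∀ z ∈ nearCenters G S seed t ∪ nearCenters G S seed v,
        centerKey G tie S seed w ≤ centerKey G tie S seed z := by
  set w := Function.argminOn (centerKey G tie S seed) _ hne with hw
  have hmem : w ∈ nearCenters G S seed t ∪ nearCenters G S seed v :=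
    Function.argminOn_mem _ _ hne
  have hmin : ∀ z ∈ nearCenters G S seed t ∪ nearCenters G S seed v,
      centerKey G tie S seed w ≤ centerKey G tie S seed z :=
    fun z hz => Function.argminOn_le _ _ hz
  refine ⟨w, ?_, hmin⟩
  have hlabel : ∀ x, (∀ z ∈ nearCenters G S seed x, z ∈ nearCenters G S seed t ∪
      nearCenters G S seed v) → w ∈ nearCenters G S seed x →
      mainAlgorithm sampleOrder tie G arrival S seed x = Sum.inl w := by
    intro x hx hwx
    rw [mainAlgorithm_of_nonempty (Set.nonempty_of_mem hwx), Sum.inl.injEq,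
      argminOn_eq_iff (centerKey_injective G tie S seed).injOn]
    exact ⟨hwx, fun z hz => hmin z (hx z hz)⟩
  have hl1 := hlabel t fun z hz => Or.inl hz
  have hl2 := hlabel v fun z hz => Or.inr hz
  -- A center near both ends that precedes all their near centers would have collected both.
  rcases hmem with hm | hm
  · refine Or.inl ⟨hm.2.2, lt_of_not_ge fun h' => ?_⟩
    exact h ((hl1 hm).trans (hl2 ⟨hv, hm.2.1, h'⟩).symm)
  · refine Or.inr ⟨hm.2.2, lt_of_not_ge fun h' => ?_⟩
    exact h ((hl1 ⟨ht, hm.2.1, h'⟩).trans (hl2 hm).symm)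

/-- The natural subtraction in the key is never truncated, since a density is at most the size of
the counting sample. -/
theorem density_le_of_centerKey_le {w z : V}
    (h : centerKey G tie S seed w ≤ centerKey G tie S seed z) :
    density G S seed z ≤ density G S seed w := by
  have hw : density G S seed w ≤ (sub S seed .b).card :=
    Finset.card_le_card (Finset.filter_subset _ _)
  have hz : density G S seed z ≤ (sub S seed .b).card :=
    Finset.card_le_card (Finset.filter_subset _ _)
  unfold centerKey at h
  rw [Prod.Lex.toLex_le_toLex] at h
  simp only at h
  omega

/-- If a close edge at `t` that is not between leftover vertices is cut, then `t` has an ambiguous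
edge, and if moreover a center is close to `t`, the ambiguous edges at `t` outnumber the counting
sample near `t`. -/
theorem ambiguous_of_cut {t v : V}
    (h : mainAlgorithm sampleOrder tie G arrival S seed t ≠
      mainAlgorithm sampleOrder tie G arrival S seed v)
    (ht : Eligible G S seed t) (hv : Eligible G S seed v)
    (hne : (nearCenters G S seed t ∪ nearCenters G S seed v).Nonempty)
    (htv : estDist G S seed t v ≤ closeRadius) :
    (ambiguous G (sub S seed .d) (sub S seed .r) t).Nonempty ∧
      (¬ CenterFree G (sub S seed .d) (sub S seed .r) (sub S seed .p) t →
        (closeBall G (sub S seed .d) (sub S seed .r) t ∩ sub S seed .b).card ≤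
          (ambiguous G (sub S seed .d) (sub S seed .r) t).card) := by
  obtain ⟨w, hw, hmin⟩ := exists_separating_center h ht hv hne
  have hsub : ∀ x, estDist G S seed w x ≤ rConst →
      x ∈ ambiguous G (sub S seed .d) (sub S seed .r) t := by
    intro x hx
    rcases hw with hw | hw
    · exact (mem_ambiguous_of_separated hw.1 hw.2 htv hx).1
    · exact (mem_ambiguous_of_separated hw.1 hw.2 (by rwa [estDist_comm]) hx).2
  constructor
  · refine ⟨w, hsub w ?_⟩
    unfold estDist
    rw [adjDist_self, rConst_eq]
    norm_num
  · intro hcf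
    obtain ⟨z, hz⟩ := Finset.nonempty_iff_ne_empty.2 hcf
    obtain ⟨hzt, hzp⟩ := Finset.mem_inter.1 hz
    have hzt' : estDist G S seed t z ≤ closeRadius := mem_closeBall.1 hzt
    have hzn : z ∈ nearCenters G S seed t := by
      refine ⟨ht, hzp, ?_⟩
      rw [estDist_comm, cConst_mul_rConst]
      rw [closeRadius_eq] at hzt'
      linarith
    have hd := density_le_of_centerKey_le (hmin z (Or.inl hzn))
    refine le_trans (Finset.card_le_card fun x hx => ?_) (hd.trans
      (Finset.card_le_card fun x hx => hsub x (Finset.mem_filter.1 hx).2))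
    obtain ⟨hx1, hx2⟩ := Finset.mem_inter.1 hx
    have hx1' : estDist G S seed t x ≤ closeRadius := mem_closeBall.1 hx1
    refine Finset.mem_filter.2 ⟨hx2, ?_⟩
    -- With radius `r/3`, the close ball of `t` lies in the ball of radius `r` around any close
    -- center, as `(10/7) · (2/3) ≤ 1`. So the density of `z`, and that of the earlier `w`,
    -- dominates the counting sample near `t`.
    have h1 := estDist_triangle (G := G) (S := S) (seed := seed) z t x
    rw [closeRadius_eq] at hx1' hzt'
    rw [estDist_comm z t] at h1
    rw [rConst_eq]
    linarith

theorem pivotEdge₂_symm {u v : V} (h : PivotEdge₂ G S seed u v) : PivotEdge₂ G S seed v u :=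
  ⟨h.2.1, h.1, h.2.2.1.symm, by rw [estDist_comm]; exact h.2.2.2⟩

theorem pivotEdge₁_symm {u v : V} (h : PivotEdge₁ G S seed u v) : PivotEdge₁ G S seed v u :=
  ⟨h.2.1, h.1, h.2.2.symm⟩

/-- If a close positive edge between leftover vertices is cut, then one of its ends has an
ambiguous edge. -/
theorem ambiguous_of_cut_leftover {t v : V}
    (h : mainAlgorithm sampleOrder tie G arrival S seed t ≠
      mainAlgorithm sampleOrder tie G arrival S seed v)
    (ht : Leftover G S seed t) (hv : Leftover G S seed v) (hadj : G.Adj t v)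
    (htv : estDist G S seed t v ≤ closeRadius) :
    (ambiguous G (sub S seed .d) (sub S seed .r) t).Nonempty ∨
      (ambiguous G (sub S seed .d) (sub S seed .r) v).Nonempty := by
  have hcr := cConst_mul_rConst
  have hκ := closeRadius_eq
  have hedge : PivotEdge₂ G S seed t v := ⟨ht, hv, hadj, by rw [hcr]; linarith⟩
  rw [mainAlgorithm_of_leftover ht, mainAlgorithm_of_leftover hv] at h
  obtain ⟨w, hwt, hwv, hw⟩ := exists_separating_pivot
    (processingRank_injective arrival sampleOrder S) (fun h => pivotEdge₂_symm h) hadj.ne hedge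
    fun h' => h (congrArg Sum.inr h')
  -- Being near `a`, the pivot `w` is within 7/10 of `b`. Without a clusterable edge `wb`, either
  -- this edge is negative and short, or it is positive of length at least `cr`; both are ambiguous.
  have key : ∀ {a b : V}, Leftover G S seed b → w ≠ b → estDist G S seed a b ≤ closeRadius →
      PivotEdge₂ G S seed w a → ¬ PivotEdge₂ G S seed w b →
      w ∈ ambiguous G (sub S seed .d) (sub S seed .r) b := by
    intro a b hb hwb hab hwa hnb
    have h1 := estDist_triangle (G := G) (S := S) (seed := seed) w a b
    have h2 := hwa.2.2.2
    have h3 : estDist G S seed b w ≤ 7 / 10 := by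
      rw [estDist_comm]
      linarith
    by_cases hadj' : G.Adj w b
    · have h4 : cConst * rConst ≤ estDist G S seed b w := by
        rw [estDist_comm]
        by_contra h5
        exact hnb ⟨hwa.1, hb, hadj', not_le.1 h5⟩
      exact mem_ambiguous_of_adjDist (le_trans (by rw [hcr]; linarith) h4) h3
    · obtain ⟨h5, h6, h7⟩ := not_isIsolated_of_adjDist_lt_one G (sub S seed .d) (sub S seed .r)
        hwb.symm (lt_of_le_of_lt h3 (by norm_num))
      refine mem_ambiguous.2 ⟨hwb, h5, h6, Or.inr ⟨fun h => hadj' h.symm, ?_⟩⟩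
      rw [← h7]
      exact h3
  rcases hw with hw | hw
  · exact Or.inr ⟨w, key hv hwv htv hw.1 hw.2⟩
  · exact Or.inl ⟨w, key ht hwt (by rwa [estDist_comm]) hw.1 hw.2⟩

/-- The close positive edges at `t` between vertices that are not isolated which the algorithm
cuts. -/
def closeCut (sampleOrder tie : V ↪ ℕ) (G : SimpleGraph V) (arrival : V ↪ ℕ) (S : Finset V)
    (seed : V → Subsample → Bool) (t : V) : Finset V :=
  Finset.univ.filter fun v => G.Adj t v ∧ ¬ IsIsolated G (sub S seed .d) (sub S seed .r) t ∧
    ¬ IsIsolated G (sub S seed .d) (sub S seed .r) v ∧ estDist G S seed t v ≤ closeRadius ∧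
    mainAlgorithm sampleOrder tie G arrival S seed t ≠
      mainAlgorithm sampleOrder tie G arrival S seed v

theorem mem_closeCut {t v : V} : v ∈ closeCut sampleOrder tie G arrival S seed t ↔
    G.Adj t v ∧ ¬ IsIsolated G (sub S seed .d) (sub S seed .r) t ∧
    ¬ IsIsolated G (sub S seed .d) (sub S seed .r) v ∧ estDist G S seed t v ≤ closeRadius ∧
    mainAlgorithm sampleOrder tie G arrival S seed t ≠
      mainAlgorithm sampleOrder tie G arrival S seed v := by
  simp [closeCut]

theorem centerFree_of_leftover {t : V} (h : Leftover G S seed t) :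
    CenterFree G (sub S seed .d) (sub S seed .r) (sub S seed .p) t := by
  refine Finset.eq_empty_of_forall_notMem fun z hz => h.2 ⟨z, h.1, (Finset.mem_inter.1 hz).2, ?_⟩
  have h1 : estDist G S seed t z ≤ closeRadius := mem_closeBall.1 (Finset.mem_inter.1 hz).1
  rw [closeRadius_eq] at h1
  rw [estDist_comm, cConst_mul_rConst]
  linarith

variable (G S seed) in
/-- The number of ambiguous edges at a vertex, with respect to the subsamples. -/
def ambiguousDegree (t : V) : ℝ := ((ambiguous G (sub S seed .d) (sub S seed .r) t).card : ℝ)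

theorem ambiguousDegree_nonneg (t : V) : 0 ≤ ambiguousDegree G S seed t := Nat.cast_nonneg _

theorem one_le_ambiguousDegree {t : V}
    (h : (ambiguous G (sub S seed .d) (sub S seed .r) t).Nonempty) :
    1 ≤ ambiguousDegree G S seed t := by
  unfold ambiguousDegree
  exact_mod_cast Finset.card_pos.2 h

/-- If a center is close to `t`, the ambiguous edges at `t` outnumber the counting sample in its
ball. If none is, `P` misses the ball, whose size is then a defect, paid by an ambiguous edge at
`t`; failing such an edge, each other end is a leftover vertex with one. The minimum with 1 records
that a single ambiguous edge is enough to pay. -/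
theorem card_closeCut_le {q : ℝ} (hq : 0 < q) (t : V) :
    ((closeCut sampleOrder tie G arrival S seed t).card : ℝ) ≤
      2 / q * ambiguousDegree G S seed t +
      ballDefect G (sub S seed .d) (sub S seed .r) (sub S seed .p) (sub S seed .b) q t *
        min 1 (ambiguousDegree G S seed t) +
      ∑ v, closeKernel G (sub S seed .d) (sub S seed .r) (sub S seed .p) t v *
        min 1 (ambiguousDegree G S seed v) := by
  set D := sub S seed .d with hD
  set R := sub S seed .r with hR
  set P := sub S seed .p with hP
  set B := sub S seed .b with hB
  have hmin0 : ∀ v, 0 ≤ min 1 (ambiguousDegree G S seed v) := fun v =>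
    le_min zero_le_one (ambiguousDegree_nonneg v)
  have n1 : 0 ≤ 2 / q * ambiguousDegree G S seed t :=
    mul_nonneg (by positivity) (ambiguousDegree_nonneg t)
  have n2 : 0 ≤ ballDefect G D R P B q t * min 1 (ambiguousDegree G S seed t) :=
    mul_nonneg (ballDefect_nonneg G D R P B q t) (hmin0 t)
  have n3 : 0 ≤ ∑ v, closeKernel G D R P t v * min 1 (ambiguousDegree G S seed v) :=
    Finset.sum_nonneg fun v _ => mul_nonneg (closeKernel_nonneg G D R P t v) (hmin0 v)
  have hcard : ((closeCut sampleOrder tie G arrival S seed t).card : ℝ) ≤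
      ((closeBall G D R t).card : ℝ) :=
    Nat.cast_le.2 (Finset.card_le_card fun v hv => mem_closeBall.2 (mem_closeCut.1 hv).2.2.2.1)
  rcases Finset.eq_empty_or_nonempty (closeCut sampleOrder tie G arrival S seed t) with
    hempty | ⟨v₀, hv₀⟩
  · rw [hempty, Finset.card_empty, Nat.cast_zero]
    linarith
  by_cases hcf : CenterFree G D R P t
  · by_cases hf : (ambiguous G D R t).Nonempty
    · have h1 := samplingDefect_of_disjoint hq hcf
      have h2 := samplingDefect_nonneg q (closeBall G D R t) B
      rw [min_eq_left (one_le_ambiguousDegree hf), mul_one] at n2 ⊢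
      unfold ballDefect at *
      linarith
    · refine le_trans ?_ (le_add_of_nonneg_left (add_nonneg n1 n2))
      calc ((closeCut sampleOrder tie G arrival S seed t).card : ℝ)
          = ∑ v ∈ closeCut sampleOrder tie G arrival S seed t, (1 : ℝ) := by simp
        _ ≤ ∑ v ∈ closeCut sampleOrder tie G arrival S seed t,
            closeKernel G D R P t v * min 1 (ambiguousDegree G S seed v) := by
            refine Finset.sum_le_sum fun v hv => ?_
            obtain ⟨hadj, ht, hv', hd, hl⟩ := mem_closeCut.1 hv
            have het := eligible_of_not_isIsolated ht
            have hev := eligible_of_not_isIsolated hv'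
            have hemp : ¬ (nearCenters G S seed t ∪ nearCenters G S seed v).Nonempty :=
              fun hne => hf (ambiguous_of_cut hl het hev hne hd).1
            have hlt : Leftover G S seed t := ⟨het, fun h => hemp (h.mono Set.subset_union_left)⟩
            have hlv : Leftover G S seed v := ⟨hev, fun h => hemp (h.mono Set.subset_union_right)⟩
            have hfv := (ambiguous_of_cut_leftover hl hlt hlv hadj hd).resolve_left hf
            unfold closeKernel
            rw [if_pos ⟨hd, hcf, centerFree_of_leftover hlv⟩,
              min_eq_left (one_le_ambiguousDegree hfv), mul_one]
        _ ≤ _ := Finset.sum_le_sum_of_subset_of_nonneg (Finset.subset_univ _) fun v _ _ =>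
            mul_nonneg (closeKernel_nonneg G D R P t v) (hmin0 v)
  · obtain ⟨hadj, ht, hv', hd, hl⟩ := mem_closeCut.1 hv₀
    have het := eligible_of_not_isIsolated ht
    have hev := eligible_of_not_isIsolated hv'
    have hne : (nearCenters G S seed t ∪ nearCenters G S seed v₀).Nonempty := by
      by_contra h
      exact hcf (centerFree_of_leftover ⟨het, fun h' => h (h'.mono Set.subset_union_left)⟩)
    obtain ⟨hf, hb⟩ := ambiguous_of_cut hl het hev hne hd
    have h1 := card_le_of_samplingDefect hq (closeBall G D R t) B
    have h2 := samplingDefect_nonneg q (closeBall G D R t) P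
    have h3 : 2 / q * ((closeBall G D R t ∩ B).card : ℝ) ≤
        2 / q * ambiguousDegree G S seed t :=
      mul_le_mul_of_nonneg_left (Nat.cast_le.2 (hb hcf)) (by positivity)
    rw [min_eq_left (one_le_ambiguousDegree hf), mul_one]
    unfold ballDefect
    linarith

/-- The pivot of `v` in the first run of Pivot. -/
def unseenPivot (sampleOrder : V ↪ ℕ) (G : SimpleGraph V) (arrival : V ↪ ℕ) (S : Finset V)
    (seed : V → Subsample → Bool) (v : V) : V :=
  pivotOf (processingRank arrival sampleOrder S) (PivotEdge₁ G S seed) v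

/-- The negative edges at `t` inside clusters of the first run of Pivot. -/
def unseenNegative (sampleOrder : V ↪ ℕ) (G : SimpleGraph V) (arrival : V ↪ ℕ) (S : Finset V)
    (seed : V → Subsample → Bool) (t : V) : Finset V :=
  Finset.univ.filter fun v => v ≠ t ∧ ¬ G.Adj t v ∧ ¬ Eligible G S seed t ∧
    ¬ Eligible G S seed v ∧ unseenPivot sampleOrder G arrival S seed t =
      unseenPivot sampleOrder G arrival S seed v

theorem mem_unseenNegative {t v : V} : v ∈ unseenNegative sampleOrder G arrival S seed t ↔
    v ≠ t ∧ ¬ G.Adj t v ∧ ¬ Eligible G S seed t ∧ ¬ Eligible G S seed v ∧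
      unseenPivot sampleOrder G arrival S seed t =
        unseenPivot sampleOrder G arrival S seed v := by
  simp [unseenNegative]

/-- The ends of such an edge are both neighbours of their pivot. If `C` is perfect at the pivot, it
puts them together and errs on the edge as well; otherwise the pivot has a disagreement, which is
charged with its degree. -/
theorem card_unseenNegative_le (C : Setoid V) (t : V) :
    ((unseenNegative sampleOrder G arrival S seed t).card : ℝ) ≤ disVec G C t +
      ∑ w, pivotKernel G (sub S seed .d) (unseenPivot sampleOrder G arrival S seed) t w *
        disVec G C w := by
  set D := sub S seed .d with hD
  set π := unseenPivot sampleOrder G arrival S seed with hπ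
  have hnn : ∀ w, 0 ≤ pivotKernel G D π t w * disVec G C w := fun w =>
    mul_nonneg (pivotKernel_nonneg G D π t w) (disVec_nonneg w)
  -- Neither end can itself be the pivot, since the other end is not joined to it.
  have hedge : ∀ {a b : V}, b ≠ a → ¬ G.Adj a b → π a = π b → PivotEdge₁ G S seed (π a) a := by
    intro a b hne hadj heq
    refine (pivotOf_eq_or_edge (processingRank arrival sampleOrder S) (PivotEdge₁ G S seed)
      a).resolve_left fun h => ?_
    have h' : π a = a := h
    rcases pivotOf_eq_or_edge (processingRank arrival sampleOrder S) (PivotEdge₁ G S seed) b with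
      h2 | h2
    · exact hne ((show π b = b from h2).symm.trans (heq.symm.trans h'))
    · have h3 : PivotEdge₁ G S seed (π b) b := h2
      rw [← heq, h'] at h3
      exact hadj h3.2.2
  rcases Finset.eq_empty_or_nonempty (unseenNegative sampleOrder G arrival S seed t) with
    hempty | ⟨v₀, hv₀⟩
  · rw [hempty, Finset.card_empty, Nat.cast_zero]
    exact add_nonneg (disVec_nonneg t) (Finset.sum_nonneg fun w _ => hnn w)
  obtain ⟨h1, h2, -, -, h3⟩ := mem_unseenNegative.1 hv₀
  have het := hedge h1 h2 h3
  have hmem : ∀ v ∈ unseenNegative sampleOrder G arrival S seed t, v ∈ posNbhd G (π t) := by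
    intro v hv
    obtain ⟨h4, h5, -, -, h6⟩ := mem_unseenNegative.1 hv
    have := hedge h4.symm (fun h => h5 h.symm) h6.symm
    rw [mem_posNbhd, show π t = π v from h6]
    exact Or.inr this.2.2
  have htmem : t ∈ posNbhd G (π t) := mem_posNbhd.2 (Or.inr het.2.2)
  have hw : posNbhd G (π t) ∩ D = ∅ := not_not.1 fun h => het.1 (eligible_iff.2 h)
  rcases disVec_eq_zero_or (G := G) (C := C) (π t) with h0 | h0
  · refine le_trans ?_ (le_add_of_nonneg_right (Finset.sum_nonneg fun w _ => hnn w))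
    rw [← card_disagreeSet]
    refine Nat.cast_le.2 (Finset.card_le_card fun v hv => ?_)
    obtain ⟨h4, h5, -⟩ := mem_unseenNegative.1 hv
    have hv' := hmem v hv
    rw [posNbhd_eq_clusterOf h0, mem_clusterOf] at hv' htmem
    exact mem_disagreeSet.2 ⟨h4.symm, Or.inr ⟨h5, C.trans (C.symm htmem) hv'⟩⟩
  · refine le_trans ?_ (le_add_of_nonneg_left (disVec_nonneg t))
    refine le_trans ?_ (Finset.single_le_sum (fun w _ => hnn w) (Finset.mem_univ (π t)))
    unfold pivotKernel
    rw [if_pos ⟨rfl, hw, htmem⟩, degreeRatio_of_empty G D hw]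
    calc ((unseenNegative sampleOrder G arrival S seed t).card : ℝ)
        ≤ ((posNbhd G (π t)).card : ℝ) := Nat.cast_le.2 (Finset.card_le_card hmem)
      _ ≤ _ := le_mul_of_one_le_right (Nat.cast_nonneg _) h0

/-- A positive edge between unseen vertices that are clustered perfectly by some clustering is not
cut. -/
theorem eq_of_perfectUnseen {C : Setoid V} {t v : V} (hadj : G.Adj t v) (hC : C t v)
    (ht : PerfectUnseen G (sub S seed .d) C t) (hv : PerfectUnseen G (sub S seed .d) C v) :
    mainAlgorithm sampleOrder tie G arrival S seed t =
      mainAlgorithm sampleOrder tie G arrival S seed v := by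
  have het : ¬ Eligible G S seed t := fun h => eligible_iff.1 h ht.1
  have hev : ¬ Eligible G S seed v := fun h => eligible_iff.1 h hv.1
  rw [mainAlgorithm_of_not_eligible het, mainAlgorithm_of_not_eligible hev]
  by_contra h
  obtain ⟨w, hwt, hwv, hw⟩ := exists_separating_pivot (E := PivotEdge₁ G S seed)
    (processingRank_injective arrival sampleOrder S) (fun h => pivotEdge₁_symm h) hadj.ne
    (⟨het, hev, hadj⟩ : PivotEdge₁ G S seed t v) fun h' => h (congrArg Sum.inr h')
  -- Both neighbourhoods are the common cluster, so no third vertex can separate `t` from `v`.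
  have hN : posNbhd G t = posNbhd G v := by
    rw [posNbhd_eq_clusterOf ht.2, posNbhd_eq_clusterOf hv.2, clusterOf_eq hC]
  have hiff : G.Adj t w ↔ G.Adj v w := by
    have h1 : w ∈ posNbhd G t ↔ w ∈ posNbhd G v := by rw [hN]
    rw [mem_posNbhd, mem_posNbhd] at h1
    tauto
  rcases hw with hw | hw
  · exact hw.2 ⟨hw.1.1, hev, (hiff.1 hw.1.2.2.symm).symm⟩
  · exact hw.2 ⟨hw.1.1, het, (hiff.2 hw.1.2.2.symm).symm⟩

/-- Every edge that disagrees with the output is of one of five kinds. -/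
theorem disagreeSet_subset (C : Setoid V) (t : V) :
    disagreeSet G (Setoid.ker (mainAlgorithm sampleOrder tie G arrival S seed)) t ⊆
      ambiguous G (sub S seed .d) (sub S seed .r) t ∪
      (closeCut sampleOrder tie G arrival S seed t ∪ (disagreeSet G C t ∪
      (isolatedEdges G (sub S seed .d) (sub S seed .r) C t ∪
      unseenNegative sampleOrder G arrival S seed t))) := by
  intro v hv
  simp only [Finset.mem_union]
  obtain ⟨hne, h⟩ := mem_disagreeSet.1 hv
  simp only [Setoid.ker_def] at h
  rcases h with ⟨hadj, hl⟩ | ⟨hadj, hl⟩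
  · by_cases hiso : IsIsolated G (sub S seed .d) (sub S seed .r) t ∨
        IsIsolated G (sub S seed .d) (sub S seed .r) v
    · by_cases hC : C t v
      · right; right; right; left
        refine mem_isolatedEdges.2 ⟨mem_posNbhd.2 (Or.inr hadj), hC, hiso, fun h => hl ?_⟩
        exact eq_of_perfectUnseen hadj hC h.1 h.2
      · right; right; left
        exact mem_disagreeSet.2 ⟨hne, Or.inl ⟨hadj, hC⟩⟩
    · push Not at hiso
      by_cases hd : estDist G S seed t v ≤ closeRadius
      · right; left
        exact mem_closeCut.2 ⟨hadj, hiso.1, hiso.2, hd, hl⟩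
      · left
        refine mem_ambiguous.2 ⟨hne.symm, hiso.1, hiso.2, Or.inl ⟨hadj, ?_⟩⟩
        rw [← adjDist_eq_corrDist G _ (sub S seed .r) hiso.1 hiso.2 (Or.inl hadj)]
        exact (not_le.1 hd).le
  · rcases eq_cluster_cases hl with ⟨h1, h2, h3⟩ | h1
    · right; right; right; right
      exact mem_unseenNegative.2 ⟨hne.symm, hadj, h1, h2, h3⟩
    · left
      obtain ⟨h2, h3, h4⟩ := not_isIsolated_of_adjDist_lt_one G (sub S seed .d) (sub S seed .r)
        hne (lt_of_le_of_lt h1 (by norm_num))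
      refine mem_ambiguous.2 ⟨hne.symm, h2, h3, Or.inr ⟨hadj, ?_⟩⟩
      rw [← h4]
      exact h1

end Rounding

/-! ### Norms and Schur's test -/

section LpNorm

variable {V : Type*} [Fintype V]

/-- The `ℓ_p`-norm of a real vector. -/
def lpNorm (p : ℝ≥0∞) (f : V → ℝ) : ℝ := ‖(WithLp.toLp p f : PiLp p fun _ : V => ℝ)‖

theorem lpNorm_nonneg (p : ℝ≥0∞) [Fact (1 ≤ p)] (f : V → ℝ) : 0 ≤ lpNorm p f := norm_nonneg _

theorem lpNorm_add_le (p : ℝ≥0∞) [Fact (1 ≤ p)] (f g : V → ℝ) :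
    lpNorm p (fun t => f t + g t) ≤ lpNorm p f + lpNorm p g := by
  unfold lpNorm
  exact norm_add_le (WithLp.toLp p f : PiLp p fun _ : V => ℝ) (WithLp.toLp p g)

theorem lpNorm_eq {p : ℝ≥0∞} [hp : Fact (1 ≤ p)] (hp' : p ≠ ⊤) {f : V → ℝ} (hf : ∀ t, 0 ≤ f t) :
    lpNorm p f = (∑ t, f t ^ p.toReal) ^ (1 / p.toReal) := by
  have h0 : 0 < p.toReal := ENNReal.toReal_pos (zero_lt_one.trans_le hp.out).ne' hp'
  unfold lpNorm
  rw [PiLp.norm_eq_sum h0]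
  congr 1
  refine Finset.sum_congr rfl fun t _ => ?_
  simp [abs_of_nonneg (hf t)]

/-- Schur's test: a kernel with small row sums and column sums is bounded in every `ℓ_p`-norm. -/
theorem lpNorm_kernel_le {p : ℝ≥0∞} [hp : Fact (1 ≤ p)] (hp' : p ≠ ⊤) {k : V → V → ℝ} {R : ℝ}
    (hR : 0 < R) (hk : ∀ t v, 0 ≤ k t v) (hrow : ∀ t, ∑ v, k t v ≤ R)
    (hcol : ∀ v, ∑ t, k t v ≤ R) {f g : V → ℝ} (hf : ∀ t, 0 ≤ f t) (hg : ∀ t, 0 ≤ g t)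
    (hfg : ∀ t, f t ≤ ∑ v, k t v * g v) : lpNorm p f ≤ R * lpNorm p g := by
  set r := p.toReal with hr
  have h1 : 1 ≤ r := by
    rw [hr, ← ENNReal.toReal_one]
    exact ENNReal.toReal_mono hp' hp.out
  have h0 : 0 < r := zero_lt_one.trans_le h1
  have hpow : ∀ t, f t ^ r ≤ R ^ (r - 1) * ∑ v, k t v * g v ^ r := by
    intro t
    have hw : 0 ≤ ∑ v, k t v := Finset.sum_nonneg fun v _ => hk t v
    have hwg : 0 ≤ ∑ v, k t v * g v ^ r :=
      Finset.sum_nonneg fun v _ => mul_nonneg (hk t v) (Real.rpow_nonneg (hg v) r)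
    -- Weighted Hölder inequality along a row. The row sum enters with exponent `r - 1`, and the
    -- column sum supplies the missing factor after summation.
    have h2 := Real.inner_le_weight_mul_Lp_of_nonneg Finset.univ h1 (k t) g (hk t) hg
    calc f t ^ r ≤ ((∑ v, k t v) ^ (1 - r⁻¹) * (∑ v, k t v * g v ^ r) ^ r⁻¹) ^ r :=
          Real.rpow_le_rpow (hf t) ((hfg t).trans h2) h0.le
      _ = (∑ v, k t v) ^ (r - 1) * ∑ v, k t v * g v ^ r := by
          rw [Real.mul_rpow (Real.rpow_nonneg hw _) (Real.rpow_nonneg hwg _),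
            ← Real.rpow_mul hw, ← Real.rpow_mul hwg, inv_mul_cancel₀ h0.ne', Real.rpow_one]
          congr 2
          field_simp
      _ ≤ _ := by
          gcongr
          exact hrow t
  have hsum : ∑ t, f t ^ r ≤ R ^ r * ∑ v, g v ^ r := by
    calc ∑ t, f t ^ r ≤ ∑ t, R ^ (r - 1) * ∑ v, k t v * g v ^ r :=
          Finset.sum_le_sum fun t _ => hpow t
      _ = R ^ (r - 1) * ∑ v, (∑ t, k t v) * g v ^ r := by
          rw [← Finset.mul_sum, Finset.sum_comm]
          simp_rw [Finset.sum_mul]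
      _ ≤ R ^ (r - 1) * ∑ v, R * g v ^ r := by
          gcongr with v
          · exact Real.rpow_nonneg (hg v) r
          · exact hcol v
      _ = R ^ r * ∑ v, g v ^ r := by
          rw [← Finset.mul_sum, ← mul_assoc, Real.rpow_sub_one hR.ne', div_mul_cancel₀ _ hR.ne']
  rw [lpNorm_eq hp' hf, lpNorm_eq hp' hg]
  calc (∑ t, f t ^ r) ^ (1 / r) ≤ (R ^ r * ∑ v, g v ^ r) ^ (1 / r) :=
        Real.rpow_le_rpow (Finset.sum_nonneg fun t _ => Real.rpow_nonneg (hf t) r) hsum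
          (by positivity)
    _ = R * (∑ v, g v ^ r) ^ (1 / r) := by
        rw [Real.mul_rpow (Real.rpow_nonneg hR.le _)
          (Finset.sum_nonneg fun t _ => Real.rpow_nonneg (hg t) r), ← Real.rpow_mul hR.le,
          mul_one_div, div_self h0.ne', Real.rpow_one]

theorem lpNorm_le_of_le_mul {p : ℝ≥0∞} [Fact (1 ≤ p)] (hp' : p ≠ ⊤) {R : ℝ} (hR : 0 < R)
    {f g : V → ℝ} (hf : ∀ t, 0 ≤ f t) (hg : ∀ t, 0 ≤ g t) (h : ∀ t, f t ≤ R * g t) :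
    lpNorm p f ≤ R * lpNorm p g := by
  refine lpNorm_kernel_le hp' (k := fun t v => if t = v then R else 0) hR (fun t v => ?_)
    (fun t => by simp) (fun v => by simp) hf hg fun t => ?_
  · split_ifs
    exacts [hR.le, le_rfl]
  · simpa using h t

theorem lpNorm_mono {p : ℝ≥0∞} [Fact (1 ≤ p)] (hp' : p ≠ ⊤) {f g : V → ℝ} (hf : ∀ t, 0 ≤ f t)
    (h : ∀ t, f t ≤ g t) : lpNorm p f ≤ lpNorm p g := by
  simpa using lpNorm_le_of_le_mul hp' one_pos hf (fun t => (hf t).trans (h t))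
    (by simpa using h)

theorem cost_eq_lpNorm (G : SimpleGraph V) (p : ℝ≥0∞) (C : Setoid V) :
    cost G p C = lpNorm p (disVec G C) := rfl

theorem cost_one (G : SimpleGraph V) (C : Setoid V) : cost G 1 C = ∑ t, disVec G C t := by
  rw [cost_eq_lpNorm, lpNorm_eq ENNReal.one_ne_top (fun t => disVec_nonneg t)]
  simp

theorem disVec_le_cost_top (G : SimpleGraph V) (C : Setoid V) (t : V) :
    disVec G C t ≤ cost G ⊤ C := by
  unfold cost
  rw [PiLp.norm_eq_ciSup]
  have := le_ciSup (f := fun i => ‖(WithLp.toLp ⊤ fun u => (disagreements G C u : ℝ) :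
    PiLp ⊤ fun _ : V => ℝ) i‖) (Set.finite_range _).bddAbove t
  refine le_trans ?_ this
  simp [disVec]

theorem cost_top_le (G : SimpleGraph V) (C : Setoid V) {Y : ℝ} (hY : 0 ≤ Y)
    (h : ∀ t, disVec G C t ≤ Y) : cost G ⊤ C ≤ Y := by
  unfold cost
  rw [PiLp.norm_eq_ciSup]
  refine Real.iSup_le (fun t => ?_) hY
  have := h t
  simpa [disVec] using this

theorem cost_top_eq_zero_or (G : SimpleGraph V) (C : Setoid V) :
    cost G ⊤ C = 0 ∨ 1 ≤ cost G ⊤ C := by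
  by_cases h : ∀ t, disVec G C t = 0
  · refine Or.inl (le_antisymm (cost_top_le G C le_rfl fun t => (h t).le) ?_)
    rw [cost, PiLp.norm_eq_ciSup]
    exact Real.iSup_nonneg fun t => norm_nonneg _
  · push Not at h
    obtain ⟨t, ht⟩ := h
    exact Or.inr (((disVec_eq_zero_or t).resolve_left ht).trans (disVec_le_cost_top G C t))

theorem exists_cost_eq_OPT (G : SimpleGraph V) (p : ℝ≥0∞) : ∃ C : Setoid V, cost G p C = OPT G p := by
  have : Finite (Setoid V) := Finite.of_injective (fun C : Setoid V => C.r)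
    fun C C' h => Setoid.ext fun a b => by rw [show C a b ↔ C' a b from iff_of_eq (congrFun₂ h a b)]
  exact exists_eq_ciInf_of_finite

end LpNorm

/-! ### Pointwise comparison; the bounds for good samples -/

section Bounds

variable {V : Type*} [Fintype V] {G : SimpleGraph V} {S : Finset V}
  {seed : V → Subsample → Bool} {sampleOrder tie arrival : V ↪ ℕ} {q : ℝ}

/-- The disagreements of the output at a vertex in terms of those of any clustering `C`. -/
theorem disVec_output_le (hq : 0 < q) (C : Setoid V) (t : V) :
    disVec G (Setoid.ker (mainAlgorithm sampleOrder tie G arrival S seed)) t ≤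
      ambiguousDegree G S seed t + (2 / q * ambiguousDegree G S seed t +
        ballDefect G (sub S seed .d) (sub S seed .r) (sub S seed .p) (sub S seed .b) q t *
          min 1 (ambiguousDegree G S seed t) +
        ∑ v, closeKernel G (sub S seed .d) (sub S seed .r) (sub S seed .p) t v *
          min 1 (ambiguousDegree G S seed v)) + disVec G C t +
      (isolatedCharge G (sub S seed .d) C t +
        ∑ v, isolatedKernel G (sub S seed .d) (sub S seed .r) C t v *
          (disVec G C v + isolatedCharge G (sub S seed .d) C v) +
        degreeRatio G (sub S seed .d) (perfectRep G C t) * disVec G C t +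
        ∑ v, perfectKernel G (sub S seed .d) C t v * disVec G C v) +
      (disVec G C t + ∑ w, pivotKernel G (sub S seed .d)
        (unseenPivot sampleOrder G arrival S seed) t w * disVec G C w) := by
  have h1 := Finset.card_le_card (disagreeSet_subset (sampleOrder := sampleOrder) (tie := tie)
    (arrival := arrival) (G := G) (S := S) (seed := seed) C t)
  have h2 : disVec G (Setoid.ker (mainAlgorithm sampleOrder tie G arrival S seed)) t ≤
      ((ambiguous G (sub S seed .d) (sub S seed .r) t).card : ℝ) +
      (((closeCut sampleOrder tie G arrival S seed t).card : ℝ) + ((disagreeSet G C t).card +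
      ((isolatedEdges G (sub S seed .d) (sub S seed .r) C t).card +
      ((unseenNegative sampleOrder G arrival S seed t).card : ℝ)))) := by
    rw [← card_disagreeSet]
    have h3 := Finset.card_union_le (ambiguous G (sub S seed .d) (sub S seed .r) t)
      (closeCut sampleOrder tie G arrival S seed t ∪ (disagreeSet G C t ∪
      (isolatedEdges G (sub S seed .d) (sub S seed .r) C t ∪
      unseenNegative sampleOrder G arrival S seed t)))
    have h4 := Finset.card_union_le (closeCut sampleOrder tie G arrival S seed t)
      (disagreeSet G C t ∪ (isolatedEdges G (sub S seed .d) (sub S seed .r) C t ∪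
      unseenNegative sampleOrder G arrival S seed t))
    have h5 := Finset.card_union_le (disagreeSet G C t)
      (isolatedEdges G (sub S seed .d) (sub S seed .r) C t ∪
      unseenNegative sampleOrder G arrival S seed t)
    have h6 := Finset.card_union_le (isolatedEdges G (sub S seed .d) (sub S seed .r) C t)
      (unseenNegative sampleOrder G arrival S seed t)
    exact_mod_cast (by omega)
  have h3 := card_closeCut_le (sampleOrder := sampleOrder) (tie := tie) (arrival := arrival)
    (G := G) (S := S) (seed := seed) hq t
  have h4 := card_isolatedEdges_le (G := G) (D := sub S seed .d) (R := sub S seed .r) (C := C) t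
  have h5 := card_unseenNegative_le (sampleOrder := sampleOrder) (arrival := arrival)
    (G := G) (S := S) (seed := seed) C t
  rw [card_disagreeSet] at h2
  unfold ambiguousDegree at *
  linarith

/-- The counterpart of Schur's test for the maximum norm, where row sums suffice. -/
theorem kernel_sum_le {k : V → ℝ} {g : V → ℝ} {R Y : ℝ} (hk : ∀ v, 0 ≤ k v)
    (hrow : ∑ v, k v ≤ R) (hg : ∀ v, g v ≤ Y) (hY : 0 ≤ Y) : ∑ v, k v * g v ≤ R * Y :=
  calc ∑ v, k v * g v ≤ ∑ v, k v * Y :=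
        Finset.sum_le_sum fun v _ => mul_le_mul_of_nonneg_left (hg v) (hk v)
    _ = (∑ v, k v) * Y := (Finset.sum_mul _ _ _).symm
    _ ≤ R * Y := mul_le_mul_of_nonneg_right hrow hY

theorem card_ambiguous_le' (D R : Finset V) (C : Setoid V) (t : V) :
    ((ambiguous G D R t).card : ℝ) ≤ disVec G C t + 1 / closeRadius *
      (((ambiguous G D R t).card : ℝ) / sampledDegree G D t * disVec G C t +
        ∑ v, ambiguousKernel G D R t v * disVec G C v) := by
  refine (card_ambiguous_le (C := C) t).trans ?_
  have hκ0 : 0 ≤ 1 / closeRadius := by rw [closeRadius_eq]; norm_num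
  gcongr
  simp_rw [mul_add]
  rw [Finset.sum_add_distrib, ← Finset.sum_mul]
  gcongr
  · exact disVec_nonneg t
  · exact sum_ambiguousKernel_le G D R t

variable (G S seed q) in
/-- The sampling ratios and defects are all at most `L`. -/
structure GoodSample (L : ℝ) : Prop where
  ratio_le : ∀ u, degreeRatio G (sub S seed .d) u ≤ L
  ambiguous_le : ∀ u, ambiguousDegree G S seed u / sampledDegree G (sub S seed .d) u ≤ L
  defect_le : ∀ u, ballDefect G (sub S seed .d) (sub S seed .r) (sub S seed .p) (sub S seed .b)
    q u ≤ L

theorem one_div_closeRadius_le : 1 / closeRadius ≤ 68 := by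
  rw [closeRadius_eq]
  norm_num

/-- The bound for the maximum number of disagreements at a vertex. -/
theorem disVec_output_le_of_good (hq : 0 < q) (hq1 : q ≤ 1) {L : ℝ} (hL : 1 ≤ L)
    (hgood : GoodSample G S seed q L) (C : Setoid V) {Y : ℝ} (hY : Y = 0 ∨ 1 ≤ Y)
    (hyY : ∀ t, disVec G C t ≤ Y) (t : V) :
    disVec G (Setoid.ker (mainAlgorithm sampleOrder tie G arrival S seed)) t ≤
      1000 / q * L * Y := by
  have hY0 : 0 ≤ Y := by rcases hY with h | h <;> linarith
  have hL0 : 0 ≤ L := by linarith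
  have hLY : Y ≤ L * Y := le_mul_of_one_le_left hY0 hL
  have hLY0 : 0 ≤ L * Y := mul_nonneg hL0 hY0
  have hqinv : 1 ≤ 1 / q := by rwa [one_le_div hq]
  -- The constant is `1 + 68 · 2`, one share for each end of an ambiguous edge.
  have hamb : ∀ v, ambiguousDegree G S seed v ≤ 137 * (L * Y) := by
    intro v
    have h1 := card_ambiguous_le' (G := G) (sub S seed .d) (sub S seed .r) C v
    have h2 : ambiguousDegree G S seed v / sampledDegree G (sub S seed .d) v * disVec G C v ≤
        L * Y := mul_le_mul (hgood.ambiguous_le v) (hyY v) (disVec_nonneg v) hL0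
    have h3 : ∑ w, ambiguousKernel G (sub S seed .d) (sub S seed .r) v w * disVec G C w ≤ L * Y :=
      kernel_sum_le (ambiguousKernel_nonneg G _ _ v)
        ((sum_ambiguousKernel_le G _ _ v).trans (hgood.ambiguous_le v)) hyY hY0
    have h4 := mul_le_mul one_div_closeRadius_le (add_le_add h2 h3) (add_nonneg
      (mul_nonneg (div_nonneg (ambiguousDegree_nonneg v) (sampledDegree_pos G _ v).le)
        (disVec_nonneg v)) (Finset.sum_nonneg fun w _ =>
          mul_nonneg (ambiguousKernel_nonneg G _ _ v w) (disVec_nonneg w))) (by norm_num)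
    have h5 := hyY v
    unfold ambiguousDegree at h4 ⊢
    linarith
  -- Integrality of `Y` saves a factor `L`: the defect terms are multiplied by `Y` and not by the
  -- bound `137 L Y`, so one logarithm is enough for the maximum norm.
  have hmin : ∀ v, min 1 (ambiguousDegree G S seed v) ≤ Y := by
    intro v
    rcases hY with h | h
    · have := hamb v
      rw [h, mul_zero, mul_zero] at this
      rw [h]
      exact (min_le_right _ _).trans this
    · exact (min_le_left _ _).trans h
  have hJ : ∀ v, isolatedCharge G (sub S seed .d) C v ≤ 80 * (L * Y) := by
    intro v
    have h1 : ∑ w, sampleKernel G (sub S seed .d) v w * disVec G C w ≤ 1 * Y :=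
      kernel_sum_le (sampleKernel_nonneg G _ v) (sum_sampleKernel_le G _ v) hyY hY0
    have h2 : disVec G C v + ∑ w, sampleKernel G (sub S seed .d) v w * disVec G C w ≤ 2 * Y := by
      linarith [hyY v]
    have h3 := mul_le_mul (hgood.ratio_le v) h2 (add_nonneg (disVec_nonneg v)
      (Finset.sum_nonneg fun w _ => mul_nonneg (sampleKernel_nonneg G _ v w) (disVec_nonneg w)))
      hL0
    unfold isolatedCharge
    linarith
  have hmain := disVec_output_le (sampleOrder := sampleOrder) (tie := tie) (arrival := arrival)
    (G := G) (S := S) (seed := seed) hq C t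
  have b1 := hamb t
  have b2 : 2 / q * ambiguousDegree G S seed t ≤ 2 / q * (137 * (L * Y)) := by gcongr
  have b3 : ballDefect G (sub S seed .d) (sub S seed .r) (sub S seed .p) (sub S seed .b) q t *
      min 1 (ambiguousDegree G S seed t) ≤ L * Y :=
    mul_le_mul (hgood.defect_le t) (hmin t) (le_min zero_le_one (ambiguousDegree_nonneg t)) hL0
  have b4 : ∑ v, closeKernel G (sub S seed .d) (sub S seed .r) (sub S seed .p) t v *
      min 1 (ambiguousDegree G S seed v) ≤ L * Y :=
    kernel_sum_le (closeKernel_nonneg G _ _ _ t)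
      ((sum_closeKernel_le G _ _ _ _ hq t).trans (hgood.defect_le t)) hmin hY0
  have b5 := hyY t
  have b6 := hJ t
  have b7 : ∑ v, isolatedKernel G (sub S seed .d) (sub S seed .r) C t v *
      (disVec G C v + isolatedCharge G (sub S seed .d) C v) ≤ 1 * (81 * (L * Y)) :=
    kernel_sum_le (isolatedKernel_nonneg G _ _ C t) (sum_isolatedKernel_le G _ _ C t)
      (fun v => by linarith [hyY v, hJ v]) (by linarith)
  have b8 : degreeRatio G (sub S seed .d) (perfectRep G C t) * disVec G C t ≤ L * Y :=
    mul_le_mul (hgood.ratio_le _) b5 (disVec_nonneg t) hL0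
  have b9 : ∑ v, perfectKernel G (sub S seed .d) C t v * disVec G C v ≤ L * Y :=
    kernel_sum_le (perfectKernel_nonneg G _ C t)
      ((sum_perfectKernel_le G _ C t).trans (hgood.ratio_le t)) hyY hY0
  have b10 : ∑ w, pivotKernel G (sub S seed .d)
        (unseenPivot sampleOrder G arrival S seed) t w * disVec G C w ≤ L * Y :=
    kernel_sum_le (pivotKernel_nonneg G _ _ t)
      ((sum_pivotKernel_le G _ _ t).trans (hgood.ratio_le _)) hyY hY0
  have e1 : 2 / q * (137 * (L * Y)) = 274 * (1 / q * (L * Y)) := by ring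
  have e2 : 1000 / q * L * Y = 1000 * (1 / q * (L * Y)) := by ring
  have e3 : L * Y ≤ 1 / q * (L * Y) := le_mul_of_one_le_left hLY0 hqinv
  rw [e2]
  rw [e1] at b2
  linarith

/-- The bound for the `ℓ_p`-norm of the disagreement vector. -/
theorem lpNorm_output_le_of_good (hq : 0 < q) (hq1 : q ≤ 1) {L : ℝ} (hL : 2 / q ≤ L)
    (hgood : GoodSample G S seed q L) (C : Setoid V) {p : ℝ≥0∞} [Fact (1 ≤ p)] (hp : p ≠ ⊤) :
    lpNorm p (disVec G (Setoid.ker (mainAlgorithm sampleOrder tie G arrival S seed))) ≤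
      1000 * L ^ 2 * lpNorm p (disVec G C) := by
  have hL2 : 2 ≤ L := le_trans (by rw [le_div_iff₀ hq]; linarith) hL
  have hL0 : 0 < L := by linarith
  set D := sub S seed .d with hD
  set R := sub S seed .r with hR
  set P := sub S seed .p with hP
  set B := sub S seed .b with hB
  set y := disVec G C with hy
  set f := ambiguousDegree G S seed with hf
  set J := isolatedCharge G D C with hJ
  set π := unseenPivot sampleOrder G arrival S seed with hπ
  set N := lpNorm p y with hN
  have hN0 : 0 ≤ N := lpNorm_nonneg p y
  have y0 : ∀ t, 0 ≤ y t := fun t => disVec_nonneg t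
  have f0 : ∀ t, 0 ≤ f t := fun t => ambiguousDegree_nonneg t
  have J0 : ∀ t, 0 ≤ J t := fun t => isolatedCharge_nonneg G D C t
  have m0 : ∀ t, 0 ≤ min 1 (f t) := fun t => le_min zero_le_one (f0 t)
  have k0 : ∀ {k : V → V → ℝ} {g : V → ℝ}, (∀ t v, 0 ≤ k t v) → (∀ v, 0 ≤ g v) →
      ∀ t, 0 ≤ ∑ v, k t v * g v := fun hk hg t =>
    Finset.sum_nonneg fun v _ => mul_nonneg (hk t v) (hg v)
  -- ambiguous edges
  have a1 : lpNorm p (fun t => ∑ v, ambiguousKernel G D R t v * y v) ≤ L * N := by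
    have hrow : ∀ t, ∑ v, ambiguousKernel G D R t v ≤ L := fun t =>
      (sum_ambiguousKernel_le G D R t).trans (hgood.ambiguous_le t)
    refine lpNorm_kernel_le hp hL0 (ambiguousKernel_nonneg G D R) hrow (fun v => ?_)
      (k0 (ambiguousKernel_nonneg G D R) y0) y0 fun t => le_rfl
    simp_rw [ambiguousKernel_comm G D R _ v]
    exact hrow v
  have a2 : lpNorm p (fun t => 68 * ∑ v, ambiguousKernel G D R t v * y v) ≤ 68 * (L * N) :=
    (lpNorm_le_of_le_mul hp (by norm_num) (fun t => mul_nonneg (by norm_num)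
      (k0 (ambiguousKernel_nonneg G D R) y0 t)) (k0 (ambiguousKernel_nonneg G D R) y0)
      fun t => le_rfl).trans (mul_le_mul_of_nonneg_left a1 (by norm_num))
  have a3 : lpNorm p f ≤ 137 * L * N := by
    have h1 : lpNorm p f ≤ lpNorm p (fun t => 69 * L * y t +
        68 * ∑ v, ambiguousKernel G D R t v * y v) := by
      refine lpNorm_mono hp f0 fun t => ?_
      have h2 : f t ≤ y t + 1 / closeRadius * (f t / sampledDegree G D t * y t +
        ∑ v, ambiguousKernel G D R t v * y v) := card_ambiguous_le' (G := G) D R C t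
      have h3 : f t / sampledDegree G D t * y t ≤ L * y t :=
        mul_le_mul_of_nonneg_right (hgood.ambiguous_le t) (y0 t)
      have h4 := mul_le_mul one_div_closeRadius_le (add_le_add_left h3
        (∑ v, ambiguousKernel G D R t v * y v)) (add_nonneg
          (mul_nonneg (div_nonneg (f0 t) (sampledDegree_pos G D t).le) (y0 t))
            (k0 (ambiguousKernel_nonneg G D R) y0 t)) (by norm_num)
      have h5 : y t ≤ L * y t := le_mul_of_one_le_left (y0 t) (by linarith)
      linarith
    refine h1.trans ((lpNorm_add_le p _ _).trans ?_)
    have h6 : lpNorm p (fun t => 69 * L * y t) ≤ 69 * L * N :=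
      lpNorm_le_of_le_mul hp (by positivity) (fun t => mul_nonneg (by positivity) (y0 t)) y0
        fun t => le_rfl
    linarith
  -- isolated vertices
  have a4 : lpNorm p (fun t => ∑ v, sampleKernel G D t v * y v) ≤ L * N :=
    lpNorm_kernel_le hp hL0 (sampleKernel_nonneg G D)
      (fun t => (sum_sampleKernel_le G D t).trans (by linarith))
      (fun v => (sum_sampleKernel_col_le G D v).trans (hgood.ratio_le v))
      (k0 (sampleKernel_nonneg G D) y0) y0 fun t => le_rfl
  have a5 : lpNorm p J ≤ 40 * L * (N + L * N) := by
    have h1 : lpNorm p J ≤ 40 * L * lpNorm p (fun t => y t + ∑ v, sampleKernel G D t v * y v) := by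
      refine lpNorm_le_of_le_mul hp (by positivity) J0 (fun t => add_nonneg (y0 t)
        (k0 (sampleKernel_nonneg G D) y0 t)) fun t => ?_
      refine mul_le_mul_of_nonneg_right ?_ (add_nonneg (y0 t)
        (k0 (sampleKernel_nonneg G D) y0 t))
      exact mul_le_mul_of_nonneg_left (hgood.ratio_le t) (by norm_num)
    refine h1.trans (mul_le_mul_of_nonneg_left ?_ (by positivity))
    exact (lpNorm_add_le p _ _).trans (by linarith)
  have a6 : lpNorm p (fun t => ∑ v, isolatedKernel G D R C t v * (y v + J v)) ≤
      1 * (N + 40 * L * (N + L * N)) :=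
    (lpNorm_kernel_le hp one_pos (isolatedKernel_nonneg G D R C)
      (sum_isolatedKernel_le G D R C) (sum_isolatedKernel_col_le G D R C)
      (k0 (isolatedKernel_nonneg G D R C) fun v => add_nonneg (y0 v) (J0 v))
      (fun v => add_nonneg (y0 v) (J0 v)) fun t => le_rfl).trans
    (mul_le_mul_of_nonneg_left ((lpNorm_add_le p _ _).trans (by linarith)) zero_le_one)
  have a7 : lpNorm p (fun t => degreeRatio G D (perfectRep G C t) * y t) ≤ L * N :=
    lpNorm_le_of_le_mul hp hL0 (fun t => mul_nonneg (degreeRatio_nonneg G D _) (y0 t)) y0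
      fun t => mul_le_mul_of_nonneg_right (hgood.ratio_le _) (y0 t)
  have a8 : lpNorm p (fun t => ∑ v, perfectKernel G D C t v * y v) ≤ L * N :=
    lpNorm_kernel_le hp hL0 (perfectKernel_nonneg G D C)
      (fun t => (sum_perfectKernel_le G D C t).trans (hgood.ratio_le t))
      (fun v => (sum_perfectKernel_col_le G D C v).trans (hgood.ratio_le _))
      (k0 (perfectKernel_nonneg G D C) y0) y0 fun t => le_rfl
  -- pivots
  have a9 : lpNorm p (fun t => ∑ v, pivotKernel G D π t v * y v) ≤ L ^ 2 * N :=
    lpNorm_kernel_le hp (by positivity) (pivotKernel_nonneg G D π)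
      (fun t => (sum_pivotKernel_le G D π t).trans ((hgood.ratio_le _).trans (by nlinarith)))
      (fun v => (sum_pivotKernel_col_le G D π v).trans
        (pow_le_pow_left₀ (degreeRatio_nonneg G D v) (hgood.ratio_le v) 2))
      (k0 (pivotKernel_nonneg G D π) y0) y0 fun t => le_rfl
  -- close edges
  have a10 : lpNorm p (fun t => ∑ v, closeKernel G D R P t v * min 1 (f v)) ≤
      L * (137 * L * N) := by
    have hrow : ∀ t, ∑ v, closeKernel G D R P t v ≤ L := fun t =>
      (sum_closeKernel_le G D R P B hq t).trans (hgood.defect_le t)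
    refine (lpNorm_kernel_le hp hL0 (closeKernel_nonneg G D R P) hrow (fun v => ?_)
      (k0 (closeKernel_nonneg G D R P) m0) f0 fun t => Finset.sum_le_sum fun v _ =>
        mul_le_mul_of_nonneg_left (min_le_right _ _) (closeKernel_nonneg G D R P t v)).trans
      (mul_le_mul_of_nonneg_left a3 hL0.le)
    simp_rw [closeKernel_comm G D R P _ v]
    exact hrow v
  have a11 : lpNorm p (fun t => 3 * L * f t) ≤ 3 * L * (137 * L * N) :=
    (lpNorm_le_of_le_mul hp (by positivity) (fun t => mul_nonneg (by positivity) (f0 t)) f0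
      fun t => le_rfl).trans (mul_le_mul_of_nonneg_left a3 (by positivity))
  have a12 : lpNorm p (fun t => 2 * y t) ≤ 2 * N :=
    lpNorm_le_of_le_mul hp (by norm_num) (fun t => mul_nonneg (by norm_num) (y0 t)) y0
      fun t => le_rfl
  have htotal : lpNorm p (disVec G (Setoid.ker
      (mainAlgorithm sampleOrder tie G arrival S seed))) ≤
      lpNorm p (fun t => ((((((3 * L * f t + ∑ v, closeKernel G D R P t v * min 1 (f v)) +
        2 * y t) + J t) + ∑ v, isolatedKernel G D R C t v * (y v + J v)) +
        degreeRatio G D (perfectRep G C t) * y t) + ∑ v, perfectKernel G D C t v * y v) +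
        ∑ v, pivotKernel G D π t v * y v) := by
    refine lpNorm_mono hp (fun t => disVec_nonneg t) fun t => ?_
    have h1 := disVec_output_le (sampleOrder := sampleOrder) (tie := tie) (arrival := arrival)
      (G := G) (S := S) (seed := seed) hq C t
    rw [← hD, ← hR, ← hP, ← hB, ← hy, ← hf, ← hJ, ← hπ] at h1
    have h2 : ballDefect G D R P B q t * min 1 (f t) ≤ L * f t :=
      mul_le_mul (hgood.defect_le t) (min_le_right _ _) (m0 t) hL0.le
    have h3 : 2 / q * f t ≤ L * f t := mul_le_mul_of_nonneg_right hL (f0 t)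
    have h4 : f t ≤ L * f t := le_mul_of_one_le_left (f0 t) (by linarith)
    linarith
  have hsum : lpNorm p (disVec G (Setoid.ker
      (mainAlgorithm sampleOrder tie G arrival S seed))) ≤
      3 * L * (137 * L * N) + L * (137 * L * N) + 2 * N + 40 * L * (N + L * N) +
        1 * (N + 40 * L * (N + L * N)) + L * N + L * N + L ^ 2 * N := by
    refine htotal.trans ?_
    refine (lpNorm_add_le p _ _).trans (add_le_add ?_ a9)
    refine (lpNorm_add_le p _ _).trans (add_le_add ?_ a8)
    refine (lpNorm_add_le p _ _).trans (add_le_add ?_ a7)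
    refine (lpNorm_add_le p _ _).trans (add_le_add ?_ a6)
    refine (lpNorm_add_le p _ _).trans (add_le_add ?_ a5)
    refine (lpNorm_add_le p _ _).trans (add_le_add ?_ a12)
    exact (lpNorm_add_le p _ _).trans (add_le_add a11 a10)
  have c1 : L * N ≤ L ^ 2 * N := mul_le_mul_of_nonneg_right (by nlinarith) hN0
  have c2 : N ≤ L ^ 2 * N := le_mul_of_one_le_left hN0 (by nlinarith)
  linarith

end Bounds

/-! ### The total cost in terms of ratios and defects -/

section SumBound

variable {V : Type*} [Fintype V] {G : SimpleGraph V} {S : Finset V}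
  {seed : V → Subsample → Bool} {sampleOrder tie arrival : V ↪ ℕ} {q : ℝ}

variable (G) in
/-- The average of the squared degree ratio over the positive neighbourhood. -/
def avgSqRatio (D : Finset V) (t : V) : ℝ :=
  1 / ((posNbhd G t).card : ℝ) * ∑ u ∈ posNbhd G t, degreeRatio G D u ^ 2

variable (G) in
/-- The weight with which the disagreements at `t` are charged, apart from ambiguous edges. -/
def chargeWeight (D : Finset V) (C : Setoid V) (t : V) : ℝ :=
  124 * degreeRatio G D t ^ 2 + 40 * avgSqRatio G D t + 2 * degreeRatio G D (perfectRep G C t) ^ 2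

theorem kernel_sum_sum_le {k : V → V → ℝ} {g c : V → ℝ} (hg : ∀ v, 0 ≤ g v)
    (hcol : ∀ v, ∑ t, k t v ≤ c v) : ∑ t, ∑ v, k t v * g v ≤ ∑ v, g v * c v := by
  rw [Finset.sum_comm]
  refine Finset.sum_le_sum fun v _ => ?_
  rw [← Finset.sum_mul, mul_comm]
  exact mul_le_mul_of_nonneg_left (hcol v) (hg v)

/-- Ratios of different vertices are dependent; the inequality of arithmetic and geometric means
replaces their products by squares, whose expectations are available. -/
theorem sum_degreeRatio_mul_sampleKernel_le (D : Finset V) (w : V) :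
    ∑ t, degreeRatio G D t * sampleKernel G D t w ≤
      (degreeRatio G D w ^ 2 + avgSqRatio G D w) / 2 := by
  have hk : (0 : ℝ) < ((posNbhd G w).card : ℝ) := by exact_mod_cast card_posNbhd_pos G w
  have hw : 1 / sampledDegree G D w = degreeRatio G D w / ((posNbhd G w).card : ℝ) := by
    unfold degreeRatio
    field_simp
  calc ∑ t, degreeRatio G D t * sampleKernel G D t w
      ≤ ∑ t, if t ∈ posNbhd G w then
          (degreeRatio G D w ^ 2 + degreeRatio G D t ^ 2) / 2 / ((posNbhd G w).card : ℝ) else 0 := by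
        refine Finset.sum_le_sum fun t _ => ?_
        have h1 := sampleKernel_le G D t w
        have h2 := degreeRatio_nonneg G D t
        split_ifs at h1 ⊢ with h
        · rw [hw] at h1
          calc degreeRatio G D t * sampleKernel G D t w
              ≤ degreeRatio G D t * (degreeRatio G D w / ((posNbhd G w).card : ℝ)) := by gcongr
            _ = degreeRatio G D t * degreeRatio G D w / ((posNbhd G w).card : ℝ) := by ring
            _ ≤ _ := by
                gcongr
                nlinarith [sq_nonneg (degreeRatio G D t - degreeRatio G D w)]
        · rw [le_antisymm h1 (sampleKernel_nonneg G D t w), mul_zero]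
    _ = _ := by
        rw [← Finset.sum_filter, Finset.filter_mem_eq_inter, Finset.univ_inter, avgSqRatio,
          ← Finset.sum_div, ← Finset.sum_div, Finset.sum_add_distrib, Finset.sum_const,
          nsmul_eq_mul]
        field_simp

theorem sum_isolatedCharge_le (D : Finset V) (C : Setoid V) :
    ∑ t, isolatedCharge G D C t ≤ ∑ t, disVec G C t *
      (40 * degreeRatio G D t + 20 * degreeRatio G D t ^ 2 + 20 * avgSqRatio G D t) := by
  unfold isolatedCharge
  have h1 : ∑ t, ∑ w, (degreeRatio G D t * sampleKernel G D t w) * disVec G C w ≤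
      ∑ w, disVec G C w * ((degreeRatio G D w ^ 2 + avgSqRatio G D w) / 2) :=
    kernel_sum_sum_le (fun v => disVec_nonneg v) (sum_degreeRatio_mul_sampleKernel_le D)
  calc ∑ t, 40 * degreeRatio G D t * (disVec G C t + ∑ w, sampleKernel G D t w * disVec G C w)
      = ∑ t, disVec G C t * (40 * degreeRatio G D t) +
        40 * ∑ t, ∑ w, (degreeRatio G D t * sampleKernel G D t w) * disVec G C w := by
        rw [Finset.mul_sum, ← Finset.sum_add_distrib]
        refine Finset.sum_congr rfl fun t _ => ?_
        simp_rw [mul_assoc, ← Finset.mul_sum]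
        ring
    _ ≤ ∑ t, disVec G C t * (40 * degreeRatio G D t) +
        40 * ∑ w, disVec G C w * ((degreeRatio G D w ^ 2 + avgSqRatio G D w) / 2) := by gcongr
    _ = _ := by
        rw [Finset.mul_sum, ← Finset.sum_add_distrib]
        refine Finset.sum_congr rfl fun t _ => ?_
        ring

/-- The quotient on the right is kept because it is bounded by an affine function of two defects,
which can be averaged. -/
theorem sum_card_ambiguous_le (D R : Finset V) (C : Setoid V) :
    ∑ t, ((ambiguous G D R t).card : ℝ) ≤ ∑ t, disVec G C t *
      (1 + 136 * (((ambiguous G D R t).card : ℝ) / sampledDegree G D t)) := by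
  have h1 : ∑ t, ∑ v, ambiguousKernel G D R t v * disVec G C v ≤
      ∑ v, disVec G C v * (((ambiguous G D R v).card : ℝ) / sampledDegree G D v) := by
    refine kernel_sum_sum_le (fun v => disVec_nonneg v) fun v => ?_
    simp_rw [ambiguousKernel_comm G D R _ v]
    exact sum_ambiguousKernel_le G D R v
  have h2 : ∀ t, ((ambiguous G D R t).card : ℝ) ≤ disVec G C t + 68 *
      (((ambiguous G D R t).card : ℝ) / sampledDegree G D t * disVec G C t +
        ∑ v, ambiguousKernel G D R t v * disVec G C v) := by
    intro t
    refine (card_ambiguous_le' (G := G) D R C t).trans ?_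
    have := disVec_nonneg (G := G) (C := C) t
    have h3 : 0 ≤ ∑ v, ambiguousKernel G D R t v * disVec G C v := Finset.sum_nonneg fun v _ =>
      mul_nonneg (ambiguousKernel_nonneg G D R t v) (disVec_nonneg v)
    have h4 := sampledDegree_pos G D t
    gcongr
    exact one_div_closeRadius_le
  calc ∑ t, ((ambiguous G D R t).card : ℝ)
      ≤ ∑ t, (disVec G C t + 68 *
      (((ambiguous G D R t).card : ℝ) / sampledDegree G D t * disVec G C t +
        ∑ v, ambiguousKernel G D R t v * disVec G C v)) := Finset.sum_le_sum fun t _ => h2 t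
    _ = ∑ t, disVec G C t * (1 + 68 * (((ambiguous G D R t).card : ℝ) / sampledDegree G D t)) +
        68 * ∑ t, ∑ v, ambiguousKernel G D R t v * disVec G C v := by
        rw [Finset.mul_sum, ← Finset.sum_add_distrib]
        refine Finset.sum_congr rfl fun t _ => ?_
        ring
    _ ≤ ∑ t, disVec G C t * (1 + 68 * (((ambiguous G D R t).card : ℝ) / sampledDegree G D t)) +
        68 * ∑ v, disVec G C v * (((ambiguous G D R v).card : ℝ) / sampledDegree G D v) := by
        gcongr
    _ = _ := by
        rw [Finset.mul_sum, ← Finset.sum_add_distrib]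
        refine Finset.sum_congr rfl fun t _ => ?_
        ring

/-- The bound for the total number of disagreements. -/
theorem sum_disVec_output_le (hq : 0 < q) (C : Setoid V) :
    ∑ t, disVec G (Setoid.ker (mainAlgorithm sampleOrder tie G arrival S seed)) t ≤
      ∑ t, ((ambiguous G (sub S seed .d) (sub S seed .r) t).card : ℝ) * (1 + 2 / q +
        2 * ballDefect G (sub S seed .d) (sub S seed .r) (sub S seed .p) (sub S seed .b) q t) +
      ∑ t, disVec G C t * chargeWeight G (sub S seed .d) C t := by
  set D := sub S seed .d with hD
  set R := sub S seed .r with hR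
  set P := sub S seed .p with hP
  set B := sub S seed .b with hB
  set y := disVec G C with hy
  set f := ambiguousDegree G S seed with hf
  set J := isolatedCharge G D C with hJ
  set π := unseenPivot sampleOrder G arrival S seed with hπ
  set β := ballDefect G D R P B q with hβ
  set ρ := degreeRatio G D with hρ
  have y0 : ∀ t, 0 ≤ y t := fun t => disVec_nonneg t
  have f0 : ∀ t, 0 ≤ f t := fun t => ambiguousDegree_nonneg t
  have J0 : ∀ t, 0 ≤ J t := fun t => isolatedCharge_nonneg G D C t
  have m0 : ∀ t, 0 ≤ min 1 (f t) := fun t => le_min zero_le_one (f0 t)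
  have β0 : ∀ t, 0 ≤ β t := fun t => ballDefect_nonneg G D R P B q t
  have s1 : ∑ t, ∑ v, closeKernel G D R P t v * min 1 (f v) ≤ ∑ v, min 1 (f v) * β v := by
    refine kernel_sum_sum_le m0 fun v => ?_
    simp_rw [closeKernel_comm G D R P _ v]
    exact sum_closeKernel_le G D R P B hq v
  have s2 : ∑ t, ∑ v, isolatedKernel G D R C t v * (y v + J v) ≤ ∑ v, (y v + J v) * 1 :=
    kernel_sum_sum_le (fun v => add_nonneg (y0 v) (J0 v)) (sum_isolatedKernel_col_le G D R C)
  have s3 : ∑ t, ∑ v, perfectKernel G D C t v * y v ≤ ∑ v, y v * ρ (perfectRep G C v) :=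
    kernel_sum_sum_le y0 (sum_perfectKernel_col_le G D C)
  have s4 : ∑ t, ∑ v, pivotKernel G D π t v * y v ≤ ∑ v, y v * ρ v ^ 2 :=
    kernel_sum_sum_le y0 (sum_pivotKernel_col_le G D π)
  have s5 := sum_isolatedCharge_le (G := G) D C
  rw [← hJ, ← hy, ← hρ] at s5
  have hpoint : ∀ t, disVec G (Setoid.ker (mainAlgorithm sampleOrder tie G arrival S seed)) t ≤ _ :=
    fun t => disVec_output_le (sampleOrder := sampleOrder) (tie := tie) (arrival := arrival)
      (G := G) (S := S) (seed := seed) hq C t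
  rw [← hD, ← hR, ← hP, ← hB, ← hy, ← hf, ← hJ, ← hπ] at hpoint
  refine (Finset.sum_le_sum fun t _ => hpoint t).trans ?_
  simp only [Finset.sum_add_distrib]
  have hfin : ∀ t, f t + 2 / q * f t + β t * min 1 (f t) + min 1 (f t) * β t + y t + y t + y t +
      ρ (perfectRep G C t) * y t + y t * ρ (perfectRep G C t) + y t * ρ t ^ 2 +
      2 * (y t * (40 * ρ t + 20 * ρ t ^ 2 + 20 * avgSqRatio G D t)) ≤
      ((ambiguous G D R t).card : ℝ) * (1 + 2 / q + 2 * β t) + y t * chargeWeight G D C t := by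
    intro t
    have h1 : f t = ((ambiguous G D R t).card : ℝ) := rfl
    have h2 : min 1 (f t) * β t ≤ f t * β t :=
      mul_le_mul_of_nonneg_right (min_le_right _ _) (β0 t)
    have h3 : 1 ≤ ρ t := one_le_degreeRatio G D t
    have h4 : 1 ≤ ρ (perfectRep G C t) := one_le_degreeRatio G D _
    -- Ratios are at least 1, so lower powers are absorbed by squares; `124 = 3 + 80 + 41`.
    have h5 : y t * (3 + 2 * ρ (perfectRep G C t) + ρ t ^ 2 +
        2 * (40 * ρ t + 20 * ρ t ^ 2 + 20 * avgSqRatio G D t)) ≤ y t * chargeWeight G D C t := by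
      refine mul_le_mul_of_nonneg_left ?_ (y0 t)
      unfold chargeWeight
      rw [← hρ]
      nlinarith
    rw [← h1]
    linarith
  have hsum := Finset.sum_le_sum fun t (_ : t ∈ Finset.univ) => hfin t
  simp only [Finset.sum_add_distrib, ← Finset.mul_sum] at hsum s2 ⊢
  simp only [mul_one, Finset.sum_add_distrib] at s2
  linarith

end SumBound

/-! ### Means over a random subset and the Chernoff bound -/

section RandomSubset

variable {V : Type*} [Fintype V]

/-- The probability that a random subset, containing every point independently with probability
`q`, is equal to `A`. -/
def subsetWeight (q : ℝ) (A : Finset V) : ℝ := ∏ v, if v ∈ A then q else 1 - q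

/-- The expectation of a function of a random subset that contains every point independently with
probability `q`. -/
def subsetMean (q : ℝ) (F : Finset V → ℝ) : ℝ := ∑ A, subsetWeight q A * F A

theorem subsetWeight_nonneg {q : ℝ} (h0 : 0 ≤ q) (h1 : q ≤ 1) (A : Finset V) :
    0 ≤ subsetWeight q A := by
  refine Finset.prod_nonneg fun v _ => ?_
  split_ifs <;> linarith

theorem subsetMean_mono {q : ℝ} (h0 : 0 ≤ q) (h1 : q ≤ 1) {F F' : Finset V → ℝ}
    (h : ∀ A, F A ≤ F' A) : subsetMean q F ≤ subsetMean q F' :=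
  Finset.sum_le_sum fun A _ => mul_le_mul_of_nonneg_left (h A) (subsetWeight_nonneg h0 h1 A)

theorem subsetMean_add (q : ℝ) (F F' : Finset V → ℝ) :
    subsetMean q (fun A => F A + F' A) = subsetMean q F + subsetMean q F' := by
  simp [subsetMean, mul_add, Finset.sum_add_distrib]

theorem subsetMean_const_mul (q c : ℝ) (F : Finset V → ℝ) :
    subsetMean q (fun A => c * F A) = c * subsetMean q F := by
  unfold subsetMean
  rw [Finset.mul_sum]
  exact Finset.sum_congr rfl fun A _ => by ring

theorem subsetMean_sum {ι : Type*} (q : ℝ) (s : Finset ι) (F : ι → Finset V → ℝ) :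
    subsetMean q (fun A => ∑ i ∈ s, F i A) = ∑ i ∈ s, subsetMean q (F i) := by
  unfold subsetMean
  rw [Finset.sum_comm]
  exact Finset.sum_congr rfl fun A _ => Finset.mul_sum _ _ _

theorem sum_subset_prod (f g : V → ℝ) :
    ∑ A : Finset V, ∏ v, (if v ∈ A then f v else g v) = ∏ v, (f v + g v) := by
  rw [Finset.prod_add, Finset.powerset_univ]
  refine Finset.sum_congr rfl fun A _ => ?_
  rw [Finset.prod_ite]
  congr 1
  · congr 1
    ext v
    simp
  · congr 1
    ext v
    simp

theorem subsetMean_const (q c : ℝ) : subsetMean (V := V) q (fun _ => c) = c := by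
  unfold subsetMean subsetWeight
  rw [← Finset.sum_mul, sum_subset_prod]
  simp

/-- The moment generating function of the size of the sampled part of `X`, at base 1/2; it factors
over the points. -/
theorem subsetMean_half_pow (q : ℝ) (X : Finset V) :
    subsetMean q (fun A => (1 / 2) ^ (X ∩ A).card) = (1 - q / 2) ^ X.card := by
  unfold subsetMean subsetWeight
  have h : ∀ A : Finset V, (∏ v, if v ∈ A then q else 1 - q) * (1 / 2) ^ (X ∩ A).card =
      ∏ v, if v ∈ A then q * (if v ∈ X then 1 / 2 else 1) else 1 - q := by
    intro A
    have h1 : ((1 : ℝ) / 2) ^ (X ∩ A).card = ∏ v, if v ∈ X ∩ A then 1 / 2 else 1 := by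
      rw [← Finset.prod_filter, Finset.filter_mem_eq_inter, Finset.univ_inter, Finset.prod_const]
    rw [h1, ← Finset.prod_mul_distrib]
    refine Finset.prod_congr rfl fun v _ => ?_
    by_cases hA : v ∈ A <;> by_cases hX : v ∈ X <;> simp [hA, hX]
  simp_rw [h]
  rw [sum_subset_prod]
  have h2 : ∀ v, q * (if v ∈ X then 1 / 2 else 1) + (1 - q) = if v ∈ X then 1 - q / 2 else 1 := by
    intro v
    split_ifs <;> ring
  simp_rw [h2]
  rw [Finset.prod_ite]
  simp

/-- A Chernoff bound for the lower tail of the size of a random subset of `X`. -/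
theorem subsetMean_lowerTail_le {q : ℝ} (h0 : 0 ≤ q) (h1 : q ≤ 1) (X : Finset V) :
    subsetMean q (fun A => if ((X ∩ A).card : ℝ) < q / 2 * X.card then 1 else 0) ≤
      Real.exp (-(q * X.card / 8)) := by
  set x : ℝ := (X.card : ℝ) with hx
  have hx0 : 0 ≤ x := Nat.cast_nonneg _
  -- The final exponent is `(q x / 2)(log 2 - 1)`, at most `-(3/20) q x` and hence below `-q x / 8`.
  have hlog : Real.log 2 < 7 / 10 := by linarith [Real.log_two_lt_d9]
  have h2 : ∀ A : Finset V, (if ((X ∩ A).card : ℝ) < q / 2 * x then (1 : ℝ) else 0) ≤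
      Real.exp (Real.log 2 * (q / 2 * x)) * (1 / 2) ^ (X ∩ A).card := by
    intro A
    have h3 : ((1 : ℝ) / 2) ^ (X ∩ A).card = Real.exp (-(Real.log 2 * (X ∩ A).card)) := by
      rw [one_div, inv_pow, Real.exp_neg, mul_comm, Real.exp_nat_mul, Real.exp_log (by norm_num)]
    rw [h3, ← Real.exp_add]
    split_ifs with h
    · rw [← Real.exp_zero]
      refine Real.exp_le_exp.2 ?_
      have := Real.log_pos one_lt_two
      nlinarith
    · exact (Real.exp_pos _).le
  calc _ ≤ _ := subsetMean_mono h0 h1 h2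
    _ = Real.exp (Real.log 2 * (q / 2 * x)) * (1 - q / 2) ^ X.card := by
        rw [subsetMean_const_mul, subsetMean_half_pow]
    _ ≤ Real.exp (Real.log 2 * (q / 2 * x)) * Real.exp (-(q / 2)) ^ X.card := by
        gcongr
        · linarith
        · have := Real.add_one_le_exp (-(q / 2))
          linarith
    _ = Real.exp (Real.log 2 * (q / 2 * x) + x * (-(q / 2))) := by
        rw [← Real.exp_nat_mul, ← Real.exp_add]
    _ ≤ _ := by
        refine Real.exp_le_exp.2 ?_
        have : 0 ≤ q * x := mul_nonneg h0 hx0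
        nlinarith

omit [Fintype V] in
theorem samplingDefect_eq (q : ℝ) (X A : Finset V) : samplingDefect q X A =
    X.card * (if ((X ∩ A).card : ℝ) < q / 2 * X.card then 1 else 0) := by
  unfold samplingDefect
  split_ifs <;> simp

theorem mul_exp_neg_le (x : ℝ) : x * Real.exp (-x) ≤ 1 := by
  rw [Real.exp_neg, mul_inv_le_iff₀ (Real.exp_pos x), one_mul]
  linarith [Real.add_one_le_exp x]

theorem sq_mul_exp_neg_le {x : ℝ} (hx : 0 ≤ x) : x ^ 2 * Real.exp (-x) ≤ 2 := by
  rw [Real.exp_neg, mul_inv_le_iff₀ (Real.exp_pos x)]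
  nlinarith [Real.quadratic_le_exp_of_nonneg hx]

/-- Large sets are rarely badly represented: `x · exp(-q x / 8)` is bounded uniformly in the size
`x`. The second moment below works in the same way. -/
theorem subsetMean_samplingDefect_le {q : ℝ} (h0 : 0 < q) (h1 : q ≤ 1) (X : Finset V) :
    subsetMean q (samplingDefect q X) ≤ 8 / q := by
  have h2 : samplingDefect q X = fun A => (X.card : ℝ) *
    (if ((X ∩ A).card : ℝ) < q / 2 * X.card then 1 else 0) := funext (samplingDefect_eq q X)
  rw [h2, subsetMean_const_mul]
  refine (mul_le_mul_of_nonneg_left (subsetMean_lowerTail_le h0.le h1 X)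
    (Nat.cast_nonneg _)).trans ?_
  have h3 := mul_exp_neg_le (q * X.card / 8)
  rw [le_div_iff₀ h0]
  linarith

theorem subsetMean_samplingDefect_sq_le {q : ℝ} (h0 : 0 < q) (h1 : q ≤ 1) (X : Finset V) :
    subsetMean q (fun A => samplingDefect q X A ^ 2) ≤ 128 / q ^ 2 := by
  have h2 : (fun A => samplingDefect q X A ^ 2) = fun A => (X.card : ℝ) ^ 2 *
      (if ((X ∩ A).card : ℝ) < q / 2 * X.card then 1 else 0) := by
    funext A
    rw [samplingDefect_eq, mul_pow]
    split_ifs <;> simp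
  rw [h2, subsetMean_const_mul]
  refine (mul_le_mul_of_nonneg_left (subsetMean_lowerTail_le h0.le h1 X)
    (by positivity)).trans ?_
  have h3 := sq_mul_exp_neg_le (x := q * X.card / 8) (by positivity)
  rw [le_div_iff₀ (by positivity)]
  nlinarith

/-- Only sets with more than `L` elements can have such a defect, and for them the Chernoff exponent
is at least `q L / 8`. -/
theorem subsetMean_samplingDefect_gt_le {q : ℝ} (h0 : 0 < q) (h1 : q ≤ 1) (X : Finset V) {L : ℝ}
    (hL : 0 ≤ L) : subsetMean q (fun A => if L < samplingDefect q X A then 1 else 0) ≤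
      Real.exp (-(q * L / 8)) := by
  by_cases hX : L < X.card
  · refine (subsetMean_mono h0.le h1 fun A => ?_).trans
      ((subsetMean_lowerTail_le h0.le h1 X).trans (Real.exp_le_exp.2 ?_))
    · unfold samplingDefect
      by_cases h2 : ((X ∩ A).card : ℝ) < q / 2 * X.card
      · simp [h2, hX]
      · simp [h2, hL.not_gt]
    · have : q * L ≤ q * X.card := by gcongr
      linarith
  · have h2 : ∀ A, ¬ L < samplingDefect q X A := by
      intro A h
      unfold samplingDefect at h
      split_ifs at h
      · exact hX h
      · exact hL.not_gt h
    simp only [h2, if_false, subsetMean_const]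
    exact (Real.exp_pos _).le

end RandomSubset

/-! ### The law of the four subsamples -/

section Law

open MeasureTheory

variable {ε : ℝ}

/-- The probability of the value `b` for a coin that shows `true` with probability `q`. -/
def coinWeight (q : ℝ) (b : Bool) : ℝ := if b = true then q else 1 - q

theorem allocWeight_zero_nonneg (h0 : 0 < ε) (h1 : ε < 1) : 0 ≤ allocWeight ε 0 := by
  have h2 : ε ^ 2 ≤ 1 := pow_le_one₀ h0.le h1.le
  have h3 : ε ^ 3 ≤ 1 := pow_le_one₀ h0.le h1.le
  -- The weight is the polynomial `1 - 2ε + 3ε³/2 - ε⁵/2 + ε⁷/16`, which comes close to 0 near `ε =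
  -- 81/100`. This is its quotient by `(ε - 81/100)²`; the linear remainder is positive on the
  -- interval.
  have hQ : 0 ≤ 1.4978724150375 + 0.650371003125 * ε - 0.67713975 * ε ^ 2 -
      0.37698125 * ε ^ 3 + 0.10125 * ε ^ 4 + 0.0625 * ε ^ 5 := by
    have h4 : 0 ≤ ε ^ 4 := by positivity
    have h5 : 0 ≤ ε ^ 5 := by positivity
    linarith
  unfold allocWeight
  norm_num at hQ ⊢
  nlinarith [mul_nonneg (sq_nonneg (ε - 81 / 100)) hQ]

theorem allocWeight_nonneg (h0 : 0 < ε) (h1 : ε < 1) (k : ℕ) : 0 ≤ allocWeight ε k := by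
  have hq : 0 ≤ 1 - ε * (ε / 2) := by nlinarith
  by_cases hk : k = 0
  · rw [hk]
    exact allocWeight_zero_nonneg h0 h1
  unfold allocWeight
  rw [if_neg hk]
  split_ifs
  · have : ε / 2 - 3 * ε * (ε / 2) ^ 2 + 3 * ε ^ 2 * (ε / 2) ^ 3 - ε ^ 3 * (ε / 2) ^ 4 =
        ε / 2 * (1 - ε * (ε / 2)) ^ 3 := by ring
    rw [this]
    positivity
  · have : ε * (ε / 2) ^ 2 - 2 * ε ^ 2 * (ε / 2) ^ 3 + ε ^ 3 * (ε / 2) ^ 4 =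
        ε * (ε / 2) ^ 2 * (1 - ε * (ε / 2)) ^ 2 := by ring
    rw [this]
    positivity
  · have : ε ^ 2 * (ε / 2) ^ 3 - ε ^ 3 * (ε / 2) ^ 4 =
        ε ^ 2 * (ε / 2) ^ 3 * (1 - ε * (ε / 2)) := by ring
    rw [this]
    positivity
  · positivity

theorem coinLaw_real (h0 : 0 < ε) (h1 : ε < 1) (b : Bool) :
    (coinLaw ε).real {b} = coinWeight ε b := by
  unfold coinLaw coinWeight Measure.real
  cases b <;> simp [h0.le, h1.le]

theorem allocLaw_real (h0 : 0 < ε) (h1 : ε < 1) (a : Subsample → Bool) :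
    (allocLaw ε).real {a} = allocWeight ε (Finset.univ.filter fun i => a i = true).card := by
  unfold allocLaw Measure.real
  rw [Measure.finsetSum_apply]
  rw [Finset.sum_eq_single a]
  · simp [allocWeight_nonneg h0 h1]
  · intro b _ hb
    simp [hb]
  · simp

instance : IsFiniteMeasure (coinLaw ε) :=
  ⟨by simp [coinLaw]⟩

instance : IsFiniteMeasure (allocLaw ε) :=
  ⟨by simp [allocLaw, Measure.finsetSum_apply]⟩

/-- The subsamples that contain a vertex, given whether it is in the sample. -/
def memberships (x : Bool × (Subsample → Bool)) : Subsample → Bool := fun i => x.1 && x.2 i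

theorem prod_coinWeight (q : ℝ) (a : Subsample → Bool) : ∏ i, coinWeight q (a i) =
    q ^ (Finset.univ.filter fun i => a i = true).card *
      (1 - q) ^ (4 - (Finset.univ.filter fun i => a i = true).card) := by
  unfold coinWeight
  rw [Finset.prod_ite, Finset.prod_const, Finset.prod_const]
  congr 2
  have h := Finset.card_filter_add_card_filter_not (s := (Finset.univ : Finset Subsample))
    fun i => a i = true
  have h4 : (Finset.univ : Finset Subsample).card = 4 := rfl
  omega

/-- The reason for the weights: with `q = ε · (ε/2)`, the memberships of a vertex, unconditionally
on its being sampled, are four independent coins of probability `q`. The extra term accounts for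
vertices outside the sample, which are in no subsample. -/
theorem allocWeight_mul (a : Subsample → Bool) :
    ε * allocWeight ε (Finset.univ.filter fun i => a i = true).card +
      (if a = fun _ => false then 1 - ε else 0) = ∏ i, coinWeight (ε ^ 2 / 2) (a i) := by
  rw [prod_coinWeight]
  have hle : (Finset.univ.filter fun i => a i = true).card ≤ 4 :=
    (Finset.card_le_univ _).trans_eq rfl
  have h0 : (a = fun _ => false) ↔ (Finset.univ.filter fun i => a i = true).card = 0 := by
    rw [Finset.card_eq_zero, Finset.filter_eq_empty_iff, funext_iff]
    simp
  simp only [h0]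
  generalize (Finset.univ.filter fun i => a i = true).card = k at hle ⊢
  unfold allocWeight
  interval_cases k <;> norm_num <;> ring

theorem sum_prod_coinWeight (q : ℝ) : ∑ a : Subsample → Bool, ∏ i, coinWeight q (a i) = 1 := by
  have h := Finset.prod_univ_sum (fun _ : Subsample => (Finset.univ : Finset Bool))
    fun _ b => coinWeight q b
  rw [Fintype.piFinset_univ] at h
  rw [← h]
  simp [coinWeight]

theorem sum_allocWeight (h0 : 0 < ε) : ∑ a : Subsample → Bool,
    allocWeight ε (Finset.univ.filter fun i => a i = true).card = 1 := by
  have h := sum_prod_coinWeight (ε ^ 2 / 2)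
  simp_rw [← allocWeight_mul] at h
  rw [Finset.sum_add_distrib, ← Finset.mul_sum, Finset.sum_ite_eq'] at h
  simp only [Finset.mem_univ, if_true] at h
  have h2 : ε * (∑ a : Subsample → Bool,
    allocWeight ε (Finset.univ.filter fun i => a i = true).card - 1) = 0 := by linarith
  rcases mul_eq_zero.1 h2 with h3 | h3
  · exact absurd h3 h0.ne'
  · linarith

theorem memberships_true (a : Subsample → Bool) : memberships (true, a) = a := by
  funext i
  simp [memberships]

theorem memberships_false (a : Subsample → Bool) : memberships (false, a) = fun _ => false := by
  funext i
  simp [memberships]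

theorem sum_memberships (h0 : 0 < ε) (b : Subsample → Bool) :
    ∑ x : Bool × (Subsample → Bool) with memberships x = b,
      coinWeight ε x.1 * allocWeight ε (Finset.univ.filter fun i => x.2 i = true).card =
    ∏ i, coinWeight (ε ^ 2 / 2) (b i) := by
  rw [Finset.sum_filter, Fintype.sum_prod_type, Fintype.sum_bool, ← allocWeight_mul]
  simp only [memberships_true, memberships_false]
  congr 1
  · simp [coinWeight]
  · split_ifs with h1 h2 h2
    · rw [← Finset.mul_sum, sum_allocWeight h0]
      simp [coinWeight]
    · exact absurd h1.symm h2
    · exact absurd h2.symm h1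
    · simp

/-- The product law on the values of a map that acts coordinatewise. -/
theorem sum_prod_comp {V α β : Type*} [Fintype V] [Fintype α] [Fintype β] [DecidableEq β] (w : α → ℝ)
    (φ : α → β) (h : (V → β) → ℝ) :
    ∑ x : V → α, (∏ v, w (x v)) * h (fun v => φ (x v)) =
      ∑ y : V → β, (∏ v, ∑ a with φ a = y v, w a) * h y := by
  rw [← Finset.sum_fiberwise Finset.univ fun (x : V → α) v => φ (x v)]
  refine Finset.sum_congr rfl fun y _ => ?_
  rw [Finset.prod_univ_sum, Finset.sum_mul]
  refine Finset.sum_congr ?_ fun x hx => ?_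
  · ext x
    simp [funext_iff]
  · have : (fun v => φ (x v)) = y := by
      funext v
      simpa using Fintype.mem_piFinset.1 hx v
    rw [this]

/-- Families of subsets indexed by the names of the subsamples. -/
def membershipEquiv (V : Type*) [Fintype V] :
    (V → Subsample → Bool) ≃ Finset V × Finset V × Finset V × Finset V where
  toFun y := (Finset.univ.filter fun v => y v .d = true, Finset.univ.filter fun v => y v .r = true,
    Finset.univ.filter fun v => y v .p = true, Finset.univ.filter fun v => y v .b = true)
  invFun A v
    | .d => decide (v ∈ A.1)
    | .r => decide (v ∈ A.2.1)
    | .p => decide (v ∈ A.2.2.1)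
    | .b => decide (v ∈ A.2.2.2)
  left_inv y := by
    funext v i
    cases i <;> simp
  right_inv A := by
    simp

theorem prod_subsample (f : Subsample → ℝ) : ∏ i, f i = f .p * f .d * f .b * f .r := by
  have : (Finset.univ : Finset Subsample) = {.p, .d, .b, .r} := rfl
  rw [this]
  simp
  ring

/-- Independence over vertices and over names turns the law into a product of four. The order of the
means matters later: short negative neighbourhoods depend on `D`, close balls on `D` and `R`, and
nothing tested depends on `P` or `B`. -/
theorem integral_subsamples (h0 : 0 < ε) (h1 : ε < 1) {V : Type*} [Fintype V]
    (F : Finset V → Finset V → Finset V → Finset V → ℝ) :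
    ∫ ω, F (sub (Finset.univ.filter fun v => ω.1 v = true) ω.2 .d)
        (sub (Finset.univ.filter fun v => ω.1 v = true) ω.2 .r)
        (sub (Finset.univ.filter fun v => ω.1 v = true) ω.2 .p)
        (sub (Finset.univ.filter fun v => ω.1 v = true) ω.2 .b) ∂(aosLaw ε V) =
      subsetMean (ε ^ 2 / 2) fun D => subsetMean (ε ^ 2 / 2) fun R =>
        subsetMean (ε ^ 2 / 2) fun P => subsetMean (ε ^ 2 / 2) fun B => F D R P B := by
  have hfin : IsFiniteMeasure (aosLaw ε V) := by
    unfold aosLaw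
    infer_instance
  set H : (V → Subsample → Bool) → ℝ := fun y => F (membershipEquiv V y).1
    (membershipEquiv V y).2.1 (membershipEquiv V y).2.2.1 (membershipEquiv V y).2.2.2 with hH
  have hsub : ∀ (ω : (V → Bool) × (V → Subsample → Bool)) (i : Subsample),
      sub (Finset.univ.filter fun v => ω.1 v = true) ω.2 i =
        Finset.univ.filter fun v => memberships (ω.1 v, ω.2 v) i = true := by
    intro ω i
    ext v
    simp [sub, memberships]
  have hF : ∀ ω : (V → Bool) × (V → Subsample → Bool),
      F (sub (Finset.univ.filter fun v => ω.1 v = true) ω.2 .d)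
        (sub (Finset.univ.filter fun v => ω.1 v = true) ω.2 .r)
        (sub (Finset.univ.filter fun v => ω.1 v = true) ω.2 .p)
        (sub (Finset.univ.filter fun v => ω.1 v = true) ω.2 .b) =
      H (fun v => memberships (ω.1 v, ω.2 v)) := by
    intro ω
    simp only [hsub]
    rfl
  simp_rw [hF]
  rw [integral_fintype Integrable.of_finite]
  have hμ : ∀ ω : (V → Bool) × (V → Subsample → Bool), (aosLaw ε V).real {ω} =
      ∏ v, (coinWeight ε (ω.1 v) *
        allocWeight ε (Finset.univ.filter fun i => ω.2 v i = true).card) := by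
    rintro ⟨s, a⟩
    rw [Finset.prod_mul_distrib]
    simp_rw [← coinLaw_real h0 h1, ← allocLaw_real h0 h1]
    unfold aosLaw Measure.real
    rw [← Set.singleton_prod_singleton, Measure.prod_prod, Measure.pi_singleton,
      Measure.pi_singleton, ENNReal.toReal_mul, ENNReal.toReal_prod, ENNReal.toReal_prod]
  simp_rw [hμ, smul_eq_mul]
  have e1 := (Equiv.arrowProdEquivProdArrow V (fun _ => Bool) (fun _ => Subsample → Bool)).sum_comp
    fun ω => (∏ v, (coinWeight ε (ω.1 v) *
        allocWeight ε (Finset.univ.filter fun i => ω.2 v i = true).card)) *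
        H (fun v => memberships (ω.1 v, ω.2 v))
  rw [← e1]
  have e2 := sum_prod_comp (V := V) (fun x : Bool × (Subsample → Bool) => coinWeight ε x.1 *
    allocWeight ε (Finset.univ.filter fun i => x.2 i = true).card) memberships H
  simp only [sum_memberships h0] at e2
  refine Eq.trans e2 ?_
  rw [← (membershipEquiv V).symm.sum_comp, Fintype.sum_prod_type]
  unfold subsetMean
  refine Finset.sum_congr rfl fun D _ => ?_
  rw [Fintype.sum_prod_type, Finset.mul_sum]
  refine Finset.sum_congr rfl fun R _ => ?_
  rw [Fintype.sum_prod_type, Finset.mul_sum, Finset.mul_sum]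
  refine Finset.sum_congr rfl fun P _ => ?_
  rw [Finset.mul_sum, Finset.mul_sum, Finset.mul_sum]
  refine Finset.sum_congr rfl fun B _ => ?_
  have e3 : ∏ v, ∏ i, coinWeight (ε ^ 2 / 2) ((membershipEquiv V).symm (D, R, P, B) v i) =
      subsetWeight (ε ^ 2 / 2) P * subsetWeight (ε ^ 2 / 2) D * subsetWeight (ε ^ 2 / 2) B *
        subsetWeight (ε ^ 2 / 2) R := by
    rw [Finset.prod_comm, prod_subsample]
    simp [membershipEquiv, coinWeight, subsetWeight]
  rw [e3]
  simp only [hH, Equiv.apply_symm_apply]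
  ring

end Law

/-! ### High probability, expectation and conclusion -/

section Assembly

open MeasureTheory

variable {V : Type*} [Fintype V] {q ε : ℝ}

/-- The set of sampled vertices. -/
def sampleOf (ω : (V → Bool) × (V → Subsample → Bool)) : Finset V :=
  Finset.univ.filter fun v => ω.1 v = true

theorem aosLaw_isProbabilityMeasure (h0 : 0 < ε) (h1 : ε < 1) :
    IsProbabilityMeasure (aosLaw ε V) := by
  have hfin : IsFiniteMeasure (aosLaw ε V) := by
    unfold aosLaw
    infer_instance
  have h := integral_subsamples (V := V) h0 h1 fun _ _ _ _ => 1
  simp only [subsetMean_const, integral_const, smul_eq_mul, mul_one] at h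
  exact ⟨(ENNReal.toReal_eq_one_iff _).1 h⟩

theorem subsetMean_const_add (q c : ℝ) (F : Finset V → ℝ) :
    subsetMean q (fun A => c + F A) = c + subsetMean q F := by
  rw [subsetMean_add, subsetMean_const]

theorem subsetMean_affine_le (c a b : V → ℝ) (F : V → Finset V → ℝ) {M : ℝ}
    (hc : ∀ t, 0 ≤ c t) (hb : ∀ t, 0 ≤ b t) (hF : ∀ t, subsetMean q (F t) ≤ M) (K : ℝ) :
    subsetMean q (fun A => K + ∑ t, c t * (a t + b t * F t A)) ≤
      K + ∑ t, c t * (a t + b t * M) := by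
  rw [subsetMean_const_add, subsetMean_sum]
  gcongr with t
  rw [subsetMean_const_mul, subsetMean_const_add, subsetMean_const_mul]
  exact mul_le_mul_of_nonneg_left (add_le_add_right (mul_le_mul_of_nonneg_left (hF t) (hb t)) _)
    (hc t)

/-- The number of sets of size greater than `L` among those of interest that are badly
represented in their samples. -/
def badCount (G : SimpleGraph V) (q L : ℝ) (D R P B : Finset V) : ℝ :=
  ∑ u, (if L < samplingDefect q (posNbhd G u) D then 1 else 0) +
  ∑ u, (if L < samplingDefect q (shortNegative G D u) R then 1 else 0) +
  ∑ u, (if L < samplingDefect q (closeBall G D R u) P then 1 else 0) +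
  ∑ u, (if L < samplingDefect q (closeBall G D R u) B then 1 else 0)

/-- Averaging from the inside out: when a subsample is averaged, the sets it has to represent are
already fixed, so the tail bound for a fixed set applies to each indicator. -/
theorem subsetMean_badCount_le (h0 : 0 < q) (h1 : q ≤ 1) {L : ℝ} (hL : 0 ≤ L)
    (G : SimpleGraph V) :
    (subsetMean q fun D => subsetMean q fun R => subsetMean q fun P => subsetMean q fun B =>
      badCount G q L D R P B) ≤ 4 * (Fintype.card V * Real.exp (-(q * L / 8))) := by
  set M : ℝ := Fintype.card V * Real.exp (-(q * L / 8)) with hM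
  have key : ∀ X : V → Finset V,
      subsetMean q (fun A => ∑ u, if L < samplingDefect q (X u) A then (1 : ℝ) else 0) ≤ M := by
    intro X
    rw [subsetMean_sum]
    refine (Finset.sum_le_card_nsmul _ _ _ fun u _ =>
      subsetMean_samplingDefect_gt_le h0 h1 (X u) hL).trans_eq ?_
    rw [nsmul_eq_mul, hM, Finset.card_univ]
  have step : ∀ {c : ℝ} {F : Finset V → ℝ}, subsetMean q F ≤ M →
      subsetMean q (fun A => c + F A) ≤ c + M := by
    intro c F hF
    rw [subsetMean_const_add]
    linarith
  have mono := fun {F F' : Finset V → ℝ} (h : ∀ A, F A ≤ F' A) => subsetMean_mono h0.le h1 h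
  have s1 : ∀ D R, (subsetMean q fun P => subsetMean q fun B => badCount G q L D R P B) ≤
      ∑ u, (if L < samplingDefect q (posNbhd G u) D then 1 else 0) +
      ∑ u, (if L < samplingDefect q (shortNegative G D u) R then 1 else 0) + M + M := by
    intro D R
    refine (mono fun P => step (key _)).trans ?_
    have h2 := step (c := ∑ u, (if L < samplingDefect q (posNbhd G u) D then (1 : ℝ) else 0) +
      ∑ u, (if L < samplingDefect q (shortNegative G D u) R then 1 else 0) + M)
      (key (closeBall G D R))
    refine le_trans (mono fun P => ?_) h2
    linarith
  have s2 : ∀ D, (subsetMean q fun R => subsetMean q fun P => subsetMean q fun B =>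
      badCount G q L D R P B) ≤
      ∑ u, (if L < samplingDefect q (posNbhd G u) D then 1 else 0) + M + M + M := by
    intro D
    refine (mono fun R => s1 D R).trans ?_
    have h2 := step (c := ∑ u, (if L < samplingDefect q (posNbhd G u) D then (1 : ℝ) else 0)
      + M + M) (key (shortNegative G D))
    refine le_trans (mono fun P => ?_) h2
    linarith
  refine (mono s2).trans ?_
  have h2 := step (c := M + M + M) (key (posNbhd G))
  refine le_trans (mono fun P => ?_) (h2.trans_eq (by ring))
  linarith

theorem goodSample_of_badCount (h0 : 0 < q) {L : ℝ} (hL : 0 ≤ L) {G : SimpleGraph V}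
    {S : Finset V} {seed : V → Subsample → Bool}
    (h : badCount G q L (sub S seed .d) (sub S seed .r) (sub S seed .p) (sub S seed .b) < 1) :
    GoodSample G S seed q (9 / q + 2 * L) := by
  have hnn : ∀ (X : V → Finset V) (A : Finset V),
      0 ≤ ∑ u, if L < samplingDefect q (X u) A then (1 : ℝ) else 0 := fun X A =>
    Finset.sum_nonneg fun u _ => by split_ifs <;> norm_num
  have key : ∀ (X : V → Finset V) (A : Finset V),
      (∑ u, if L < samplingDefect q (X u) A then (1 : ℝ) else 0) < 1 →
      ∀ u, samplingDefect q (X u) A ≤ L := by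
    intro X A hX u
    by_contra hu
    have h2 := Finset.single_le_sum (f := fun u =>
      if L < samplingDefect q (X u) A then (1 : ℝ) else 0)
      (fun u _ => by split_ifs <;> norm_num) (Finset.mem_univ u)
    simp only [not_le.1 hu, if_true] at h2
    linarith
  set D := sub S seed .d
  set R := sub S seed .r
  have n1 := hnn (posNbhd G) D
  have n2 := hnn (shortNegative G D) R
  have n3 := hnn (closeBall G D R) (sub S seed .p)
  have n4 := hnn (closeBall G D R) (sub S seed .b)
  unfold badCount at h
  have k1 := key _ _ (by linarith : ∑ u, (if L < samplingDefect q (posNbhd G u) D then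
    (1 : ℝ) else 0) < 1)
  have k2 := key _ _ (by linarith : ∑ u, (if L < samplingDefect q (shortNegative G D u) R then
    (1 : ℝ) else 0) < 1)
  have k3 := key _ _ (by linarith : ∑ u, (if L < samplingDefect q (closeBall G D R u)
    (sub S seed .p) then (1 : ℝ) else 0) < 1)
  have k4 := key _ _ (by linarith : ∑ u, (if L < samplingDefect q (closeBall G D R u)
    (sub S seed .b) then (1 : ℝ) else 0) < 1)
  have h9 : (0 : ℝ) ≤ 9 / q := by positivity
  have h2 : 2 / q ≤ 9 / q := by gcongr; norm_num
  refine ⟨fun u => ?_, fun u => ?_, fun u => ?_⟩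
  · have := degreeRatio_le G D h0 u
    linarith [k1 u]
  · have := card_ambiguous_div_le G D R h0 u
    unfold ambiguousDegree
    linarith [k1 u, k2 u]
  · unfold ballDefect
    linarith [k3 u, k4 u]

/-- A union bound in integrated form: 1 minus the count of bad events is at most the indicator of
`A`. -/
theorem le_measureReal_of_badCount (h0 : 0 < ε) (h1 : ε < 1) (G : SimpleGraph V) {L : ℝ}
    (hL : 0 ≤ L) {A : Set ((V → Bool) × (V → Subsample → Bool))}
    (hA : ∀ ω, badCount G (ε ^ 2 / 2) L (sub (sampleOf ω) ω.2 .d) (sub (sampleOf ω) ω.2 .r)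
      (sub (sampleOf ω) ω.2 .p) (sub (sampleOf ω) ω.2 .b) < 1 → ω ∈ A) :
    1 - 4 * (Fintype.card V * Real.exp (-(ε ^ 2 / 2 * L / 8))) ≤ (aosLaw ε V).real A := by
  have hprob := aosLaw_isProbabilityMeasure (V := V) h0 h1
  have hnn : ∀ D R P B : Finset V, 0 ≤ badCount G (ε ^ 2 / 2) L D R P B := by
    intro D R P B
    unfold badCount
    refine add_nonneg (add_nonneg (add_nonneg ?_ ?_) ?_) ?_ <;>
    exact Finset.sum_nonneg fun u _ => by split_ifs <;> norm_num
  have h2 := subsetMean_badCount_le (q := ε ^ 2 / 2) (by positivity) (by nlinarith) hL G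
  rw [← integral_subsamples h0 h1] at h2
  have h3 : ∫ ω, (1 - badCount G (ε ^ 2 / 2) L (sub (sampleOf ω) ω.2 .d)
      (sub (sampleOf ω) ω.2 .r) (sub (sampleOf ω) ω.2 .p) (sub (sampleOf ω) ω.2 .b))
        ∂(aosLaw ε V) ≤ ∫ ω, A.indicator 1 ω ∂(aosLaw ε V) := by
    refine integral_mono Integrable.of_finite Integrable.of_finite fun ω => ?_
    by_cases hω : ω ∈ A
    · rw [Set.indicator_of_mem hω]
      simpa using hnn _ _ _ _
    · rw [Set.indicator_of_notMem hω]
      have := not_lt.1 fun h => hω (hA ω h)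
      simpa using this
  rw [integral_sub Integrable.of_finite Integrable.of_finite, integral_indicator_one
    (Set.toFinite A).measurableSet] at h3
  simp only [integral_const, probReal_univ, smul_eq_mul, mul_one] at h3
  unfold sampleOf at h3
  linarith

theorem subsetMean_degreeRatio_sq_le (h0 : 0 < q) (h1 : q ≤ 1) (G : SimpleGraph V) (u : V) :
    subsetMean q (fun D => degreeRatio G D u ^ 2) ≤ 264 / q ^ 2 := by
  have h2 : ∀ D, degreeRatio G D u ^ 2 ≤
      8 / q ^ 2 + 2 * samplingDefect q (posNbhd G u) D ^ 2 := by
    intro D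
    have h3 := degreeRatio_le G D h0 u
    have h4 := degreeRatio_nonneg G D u
    have h5 : (8 : ℝ) / q ^ 2 = 2 * (2 / q) ^ 2 := by ring
    rw [h5]
    nlinarith [sq_nonneg (2 / q - samplingDefect q (posNbhd G u) D)]
  refine (subsetMean_mono h0.le h1 h2).trans ?_
  rw [subsetMean_const_add, subsetMean_const_mul]
  have h6 := subsetMean_samplingDefect_sq_le h0 h1 (posNbhd G u)
  have h7 : (264 : ℝ) / q ^ 2 = 8 / q ^ 2 + 2 * (128 / q ^ 2) := by ring
  rw [h7]
  linarith

theorem subsetMean_chargeWeight_le (h0 : 0 < q) (h1 : q ≤ 1) (G : SimpleGraph V) (C : Setoid V)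
    (t : V) : subsetMean q (fun D => chargeWeight G D C t) ≤ 44000 / q ^ 2 := by
  have h2 : subsetMean q (fun D => avgSqRatio G D t) ≤ 264 / q ^ 2 := by
    unfold avgSqRatio
    rw [subsetMean_const_mul, subsetMean_sum]
    have hk : (0 : ℝ) < ((posNbhd G t).card : ℝ) := by exact_mod_cast card_posNbhd_pos G t
    rw [one_div_mul_eq_div, div_le_iff₀ hk]
    refine (Finset.sum_le_card_nsmul _ _ _ fun u _ =>
      subsetMean_degreeRatio_sq_le h0 h1 G u).trans_eq ?_
    rw [nsmul_eq_mul, mul_comm]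
  have h3 := subsetMean_degreeRatio_sq_le h0 h1 G t
  have h4 := subsetMean_degreeRatio_sq_le h0 h1 G (perfectRep G C t)
  unfold chargeWeight
  rw [subsetMean_add, subsetMean_add, subsetMean_const_mul, subsetMean_const_mul,
    subsetMean_const_mul]
  have h5 : (44000 : ℝ) / q ^ 2 = 166 * (264 / q ^ 2) + 176 / q ^ 2 := by ring
  have h6 : (0 : ℝ) ≤ 176 / q ^ 2 := by positivity
  rw [h5]
  linarith

/-- The expected value of the bound for the total number of disagreements. -/
theorem subsetMean_sum_le (h0 : 0 < q) (h1 : q ≤ 1) (G : SimpleGraph V) (C : Setoid V) :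
    (subsetMean q fun D => subsetMean q fun R => subsetMean q fun P => subsetMean q fun B =>
      ∑ t, ((ambiguous G D R t).card : ℝ) * (1 + 2 / q + 2 * ballDefect G D R P B q t) +
        ∑ t, disVec G C t * chargeWeight G D C t) ≤
      200000 / q ^ 2 * ∑ t, disVec G C t := by
  have mono := fun {F F' : Finset V → ℝ} (h : ∀ A, F A ≤ F' A) => subsetMean_mono h0.le h1 h
  have y0 : ∀ t, 0 ≤ disVec G C t := fun t => disVec_nonneg t
  have defect := fun X : Finset V => subsetMean_samplingDefect_le h0 h1 X
  have hq1 : 1 ≤ 1 / q := by rwa [one_le_div h0]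
  -- Ambiguous edges are determined by `D` and `R`, so `B` and then `P` are averaged against
  -- constants; each contributes a mean defect of `8/q`, whence the factor `1 + 34/q`. Only
  -- afterwards are ambiguous edges charged to `C`.
  have s1 : ∀ D R, (subsetMean q fun P => subsetMean q fun B =>
      ∑ t, ((ambiguous G D R t).card : ℝ) * (1 + 2 / q + 2 * ballDefect G D R P B q t) +
        ∑ t, disVec G C t * chargeWeight G D C t) ≤
      ∑ t, disVec G C t * chargeWeight G D C t +
      ∑ t, (35 / q * disVec G C t) * ((1 + 136 * (9 / q + samplingDefect q (posNbhd G t) D)) +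
        136 * samplingDefect q (shortNegative G D t) R) := by
    intro D R
    set K := ∑ t, disVec G C t * chargeWeight G D C t with hK
    have b1 : ∀ P, (subsetMean q fun B =>
      ∑ t, ((ambiguous G D R t).card : ℝ) * (1 + 2 / q + 2 * ballDefect G D R P B q t) + K) ≤
      K + ∑ t, ((ambiguous G D R t).card : ℝ) * ((1 + 2 / q + 2 * (8 / q)) +
        2 * samplingDefect q (closeBall G D R t) P) := by
      intro P
      have h2 := subsetMean_affine_le (q := q) (fun t => ((ambiguous G D R t).card : ℝ))
        (fun t => 1 + 2 / q + 2 * samplingDefect q (closeBall G D R t) P) (fun _ => 2)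
        (fun t => samplingDefect q (closeBall G D R t)) (fun t => Nat.cast_nonneg _)
        (fun _ => by norm_num) (fun t => defect _) K
      refine (mono fun B => le_of_eq ?_).trans (h2.trans_eq ?_)
      · unfold ballDefect
        rw [add_comm]
        congr 1
        exact Finset.sum_congr rfl fun t _ => by ring
      · congr 1
        exact Finset.sum_congr rfl fun t _ => by ring
    have h3 := subsetMean_affine_le (q := q) (fun t => ((ambiguous G D R t).card : ℝ))
        (fun t => 1 + 2 / q + 2 * (8 / q)) (fun _ => 2)
        (fun t => samplingDefect q (closeBall G D R t)) (fun t => Nat.cast_nonneg _)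
        (fun _ => by norm_num) (fun t => defect _) K
    refine (mono b1).trans (h3.trans ?_)
    refine add_le_add_right ?_ _
    have h4 := sum_card_ambiguous_le (G := G) D R C
    calc ∑ t, ((ambiguous G D R t).card : ℝ) * (1 + 2 / q + 2 * (8 / q) + 2 * (8 / q))
        = (1 + 34 / q) * ∑ t, ((ambiguous G D R t).card : ℝ) := by
          rw [← Finset.sum_mul]
          ring
      _ ≤ 35 / q * ∑ t, ((ambiguous G D R t).card : ℝ) := by
          refine mul_le_mul_of_nonneg_right ?_ (Finset.sum_nonneg fun t _ => Nat.cast_nonneg _)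
          have : (35 : ℝ) / q = 1 / q + 34 / q := by ring
          linarith
      _ ≤ 35 / q * ∑ t, disVec G C t *
          (1 + 136 * (((ambiguous G D R t).card : ℝ) / sampledDegree G D t)) :=
          mul_le_mul_of_nonneg_left h4 (by positivity)
      _ ≤ _ := by
          rw [Finset.mul_sum]
          refine Finset.sum_le_sum fun t _ => ?_
          rw [← mul_assoc]
          refine mul_le_mul_of_nonneg_left ?_ (mul_nonneg (by positivity) (y0 t))
          have := card_ambiguous_div_le G D R h0 t
          linarith
  have s2 : ∀ D, (subsetMean q fun R => subsetMean q fun P => subsetMean q fun B =>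
      ∑ t, ((ambiguous G D R t).card : ℝ) * (1 + 2 / q + 2 * ballDefect G D R P B q t) +
        ∑ t, disVec G C t * chargeWeight G D C t) ≤
      ∑ t, disVec G C t * chargeWeight G D C t +
      ∑ t, (35 / q * disVec G C t) * ((1 + 136 * (9 / q + samplingDefect q (posNbhd G t) D)) +
        136 * (8 / q)) := by
    intro D
    refine (mono fun R => s1 D R).trans ?_
    exact subsetMean_affine_le (q := q) _ _ (fun _ => 136)
      (fun t => samplingDefect q (shortNegative G D t))
      (fun t => mul_nonneg (by positivity) (y0 t)) (fun _ => by norm_num) (fun t => defect _) _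
  refine (mono s2).trans ?_
  rw [subsetMean_add, subsetMean_sum]
  have h5 : ∑ t, subsetMean q (fun D => disVec G C t * chargeWeight G D C t) ≤
      44000 / q ^ 2 * ∑ t, disVec G C t := by
    rw [Finset.mul_sum]
    refine Finset.sum_le_sum fun t _ => ?_
    rw [subsetMean_const_mul, mul_comm]
    exact mul_le_mul_of_nonneg_right (subsetMean_chargeWeight_le h0 h1 G C t) (y0 t)
  have h6 := subsetMean_affine_le (q := q) (fun t => 35 / q * disVec G C t)
    (fun t => 1 + 136 * (9 / q) + 136 * (8 / q)) (fun _ => 136)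
    (fun t => samplingDefect q (posNbhd G t))
    (fun t => mul_nonneg (by positivity) (y0 t)) (fun _ => by norm_num) (fun t => defect _) 0
  have h7 : subsetMean q (fun D => ∑ t, (35 / q * disVec G C t) *
      ((1 + 136 * (9 / q + samplingDefect q (posNbhd G t) D)) + 136 * (8 / q))) ≤
      120000 / q ^ 2 * ∑ t, disVec G C t := by
    refine (mono fun D => le_of_eq ?_).trans (h6.trans ?_)
    · rw [zero_add]
      exact Finset.sum_congr rfl fun t _ => by ring
    · rw [zero_add, Finset.mul_sum]
      refine Finset.sum_le_sum fun t _ => ?_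
      have e1 : 35 / q * disVec G C t * (1 + 136 * (9 / q) + 136 * (8 / q) + 136 * (8 / q)) =
        (35 * (1 / q) + 119000 * (1 / q) ^ 2) * disVec G C t := by ring
      have e2 : 120000 / q ^ 2 = 120000 * (1 / q) ^ 2 := by ring
      rw [e1, e2]
      refine mul_le_mul_of_nonneg_right ?_ (y0 t)
      nlinarith
  have h8 : (200000 : ℝ) / q ^ 2 = 44000 / q ^ 2 + 120000 / q ^ 2 + 36000 / q ^ 2 := by ring
  have h9 : 0 ≤ 36000 / q ^ 2 * ∑ t, disVec G C t :=
    mul_nonneg (by positivity) (Finset.sum_nonneg fun t _ => y0 t)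
  rw [h8, add_mul, add_mul]
  linarith

theorem OPT_nonneg (G : SimpleGraph V) (p : ℝ≥0∞) [Fact (1 ≤ p)] : 0 ≤ OPT G p :=
  Real.iInf_nonneg fun C => lpNorm_nonneg p (disVec G C)

/-- The expected `ℓ_1`-cost of the output. -/
theorem integral_cost_one_le (h0 : 0 < ε) (h1 : ε < 1) (sampleOrder tie : V ↪ ℕ)
    (G : SimpleGraph V) (arrival : V ↪ ℕ) :
    ∫ ω, cost G 1 (output sampleOrder tie G arrival ω) ∂(aosLaw ε V) ≤
      100000000 / ε ^ 6 * OPT G 1 := by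
  have hprob := aosLaw_isProbabilityMeasure (V := V) h0 h1
  obtain ⟨C, hC⟩ := exists_cost_eq_OPT G 1
  have hq : 0 < ε ^ 2 / 2 := by positivity
  have hO := OPT_nonneg G 1
  have h2 := subsetMean_sum_le (q := ε ^ 2 / 2) hq (by nlinarith) G C
  rw [← integral_subsamples h0 h1, ← cost_one, hC] at h2
  refine (integral_mono Integrable.of_finite Integrable.of_finite fun ω => ?_).trans
    (h2.trans ?_)
  · dsimp only
    rw [cost_one]
    exact sum_disVec_output_le hq C
  · refine mul_le_mul_of_nonneg_right ?_ hO
    rw [div_le_div_iff₀ (by positivity) (by positivity)]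
    have : ε ^ 6 ≤ ε ^ 4 := pow_le_pow_of_le_one h0.le h1.le (by norm_num)
    nlinarith [pow_pos h0 4]

/-- With high probability all sampling ratios and defects are small. -/
theorem le_measureReal_of_goodSample (h0 : 0 < ε) (h1 : ε < 1) (G : SimpleGraph V)
    (hn : 2 ≤ Fintype.card V) {A : Set ((V → Bool) × (V → Subsample → Bool))}
    (hA : ∀ ω, GoodSample G (sampleOf ω) ω.2 (ε ^ 2 / 2)
      (160 * Real.log (Fintype.card V) / ε ^ 2) → ω ∈ A) :
    1 - 1 / (Fintype.card V : ℝ) ≤ (aosLaw ε V).real A := by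
  set n : ℝ := (Fintype.card V : ℝ) with hn'
  have hn2 : 2 ≤ n := by rw [hn']; exact_mod_cast hn
  have hlog : 69 / 100 ≤ Real.log n := by
    have := Real.log_le_log (by norm_num) hn2
    linarith [Real.log_two_gt_d9]
  -- Chosen so that each bad event has probability at most `n⁻⁴`. The `4n` events then have total
  -- probability at most `4/n³`, which is at most `1/n` for `n ≥ 2`.
  set L : ℝ := 64 * Real.log n / ε ^ 2 with hL
  have hL0 : 0 ≤ L := by positivity
  have h2 := le_measureReal_of_badCount h0 h1 G hL0 (A := A) fun ω hω => hA ω (by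
    have h3 := goodSample_of_badCount (by positivity) hL0 hω
    have h4 : 9 / (ε ^ 2 / 2) + 2 * L ≤ 160 * Real.log n / ε ^ 2 := by
      have : 9 / (ε ^ 2 / 2) + 2 * L = (18 + 128 * Real.log n) / ε ^ 2 := by
        rw [hL]
        field_simp
        ring
      rw [this]
      gcongr
      linarith
    exact ⟨fun u => (h3.ratio_le u).trans h4, fun u => (h3.ambiguous_le u).trans h4,
      fun u => (h3.defect_le u).trans h4⟩)
  refine le_trans ?_ h2
  have h5 : Real.exp (-(ε ^ 2 / 2 * L / 8)) = 1 / n ^ 4 := by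
    have : -(ε ^ 2 / 2 * L / 8) = -((4 : ℕ) * Real.log n) := by
      rw [hL]
      field_simp
      norm_num
    rw [this, Real.exp_neg, Real.exp_nat_mul, Real.exp_log (by linarith), one_div]
  rw [h5]
  have h6 : 4 * (n * (1 / n ^ 4)) ≤ 1 / n := by
    have hn0 : 0 < n := by linarith
    have : 4 * (n * (1 / n ^ 4)) = 4 / n ^ 3 := by
      field_simp
    rw [this, div_le_div_iff₀ (by positivity) hn0]
    nlinarith [mul_le_mul hn2 hn2 (by norm_num) hn0.le]
  linarith

theorem cost_eq_zero_of_isEmpty [IsEmpty V] (G : SimpleGraph V) (p : ℝ≥0∞) [Fact (1 ≤ p)]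
    (C : Setoid V) : cost G p C = 0 := by
  unfold cost
  rw [Subsingleton.elim (WithLp.toLp p fun u => (disagreements G C u : ℝ) :
    PiLp p fun _ : V => ℝ) 0, norm_zero]

theorem OPT_eq_zero_of_isEmpty [IsEmpty V] (G : SimpleGraph V) (p : ℝ≥0∞) [Fact (1 ≤ p)] :
    OPT G p = 0 := by
  obtain ⟨C, hC⟩ := exists_cost_eq_OPT G p
  rw [← hC, cost_eq_zero_of_isEmpty]

/-- For one vertex the claimed probability is 0. For none, `1 / 0 = 0` makes it 1, so the event has
to be everything. -/
theorem le_measureReal_of_card_le_one (h0 : 0 < ε) (h1 : ε < 1) (hn : Fintype.card V < 2)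
    {A : Set ((V → Bool) × (V → Subsample → Bool))} (hA : IsEmpty V → A = Set.univ) :
    1 - 1 / (Fintype.card V : ℝ) ≤ (aosLaw ε V).real A := by
  have hprob := aosLaw_isProbabilityMeasure (V := V) h0 h1
  have h : Fintype.card V = 0 ∨ Fintype.card V = 1 := by omega
  rcases h with h | h
  · rw [hA (Fintype.card_eq_zero_iff.1 h), h]
    simp
  · rw [h]
    simp

theorem le_measureReal_cost (h0 : 0 < ε) (h1 : ε < 1) (sampleOrder tie : V ↪ ℕ)
    (G : SimpleGraph V) (arrival : V ↪ ℕ) :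
    1 - 1 / (Fintype.card V : ℝ) ≤ (aosLaw ε V).real {ω | ∀ p : ENNReal, 1 ≤ p → p ≠ ⊤ →
      cost G p (output sampleOrder tie G arrival ω) ≤
        100000000 / ε ^ 8 * Real.log (Fintype.card V) ^ 4 * OPT G p} := by
  by_cases hn : Fintype.card V < 2
  · refine le_measureReal_of_card_le_one h0 h1 hn fun hemp => Set.eq_univ_of_forall fun ω => ?_
    intro p hp hp'
    have : Fact (1 ≤ p) := ⟨hp⟩
    rw [cost_eq_zero_of_isEmpty, OPT_eq_zero_of_isEmpty, mul_zero]
  push Not at hn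
  refine le_measureReal_of_goodSample h0 h1 G hn fun ω hω => ?_
  intro p hp hp'
  have : Fact (1 ≤ p) := ⟨hp⟩
  have hn2 : (2 : ℝ) ≤ Fintype.card V := by exact_mod_cast hn
  set l := Real.log (Fintype.card V) with hl
  have hlog : 69 / 100 ≤ l := by
    have := Real.log_le_log (by norm_num) hn2
    linarith [Real.log_two_gt_d9]
  obtain ⟨C, hC⟩ := exists_cost_eq_OPT G p
  have h2 := lpNorm_output_le_of_good (sampleOrder := sampleOrder) (tie := tie)
    (arrival := arrival) (q := ε ^ 2 / 2) (by positivity) (by nlinarith)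
    (L := 160 * l / ε ^ 2) (by
      rw [div_le_div_iff₀ (by positivity) (by positivity)]
      nlinarith [pow_pos h0 2]) hω C hp'
  rw [← cost_eq_lpNorm, ← cost_eq_lpNorm, hC] at h2
  refine h2.trans (mul_le_mul_of_nonneg_right ?_ (OPT_nonneg G p))
  -- The argument gives `log² n / ε⁴`; the stated bound is weaker because `log n` is bounded below
  -- and `ε < 1`.
  have e1 : 1000 * (160 * l / ε ^ 2) ^ 2 = 25600000 * l ^ 2 / ε ^ 4 := by
    field_simp
    ring
  have e2 : 100000000 / ε ^ 8 * l ^ 4 = 100000000 * l ^ 4 / ε ^ 8 := by ring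
  rw [e1, e2]
  have hl2 : 47 / 100 ≤ l ^ 2 := by nlinarith
  refine div_le_div₀ (by positivity) ?_ (by positivity)
    (pow_le_pow_of_le_one h0.le h1.le (by norm_num))
  nlinarith [sq_nonneg (l ^ 2)]

theorem le_measureReal_cost_top (h0 : 0 < ε) (h1 : ε < 1) (sampleOrder tie : V ↪ ℕ)
    (G : SimpleGraph V) (arrival : V ↪ ℕ) :
    1 - 1 / (Fintype.card V : ℝ) ≤ (aosLaw ε V).real {ω |
      cost G ⊤ (output sampleOrder tie G arrival ω) ≤
        100000000 / ε ^ 6 * Real.log (Fintype.card V) * OPT G ⊤} := by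
  by_cases hn : Fintype.card V < 2
  · refine le_measureReal_of_card_le_one h0 h1 hn fun hemp => Set.eq_univ_of_forall fun ω => ?_
    rw [Set.mem_ofPred_eq, cost_eq_zero_of_isEmpty, OPT_eq_zero_of_isEmpty, mul_zero]
  push Not at hn
  refine le_measureReal_of_goodSample h0 h1 G hn fun ω hω => ?_
  have hn2 : (2 : ℝ) ≤ Fintype.card V := by exact_mod_cast hn
  set l := Real.log (Fintype.card V) with hl
  have hlog : 69 / 100 ≤ l := by
    have := Real.log_le_log (by norm_num) hn2
    linarith [Real.log_two_gt_d9]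
  obtain ⟨C, hC⟩ := exists_cost_eq_OPT G ⊤
  have hO : 0 ≤ OPT G ⊤ := OPT_nonneg G ⊤
  have hε2 : ε ^ 2 ≤ 1 := pow_le_one₀ h0.le h1.le
  have h2 := disVec_output_le_of_good (sampleOrder := sampleOrder) (tie := tie)
    (arrival := arrival) (q := ε ^ 2 / 2) (by positivity) (by linarith)
    (L := 160 * l / ε ^ 2) (by
      rw [one_le_div (by positivity)]
      linarith) hω C (cost_top_eq_zero_or G C) (disVec_le_cost_top G C)
  rw [hC] at h2
  refine cost_top_le G _ (by positivity) fun t => (h2 t).trans ?_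
  refine mul_le_mul_of_nonneg_right ?_ hO
  have e1 : 1000 / (ε ^ 2 / 2) * (160 * l / ε ^ 2) = 320000 * l / ε ^ 4 := by
    field_simp
    ring
  have e2 : 100000000 / ε ^ 6 * l = 100000000 * l / ε ^ 6 := by ring
  rw [e1, e2]
  exact div_le_div₀ (by positivity) (by linarith) (by positivity)
    (pow_le_pow_of_le_one h0.le h1.le (by norm_num))

end Assembly

end OnlineCC

end

open OnlineCC in
theorem theorem1 :
    (∀ (V : Type*) [Fintype V] (sampleOrder tie : V ↪ ℕ),
      IsOnline (mainAlgorithm sampleOrder tie)) ∧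
    ∃ K : ℝ, 0 < K ∧
      ∀ (ε : ℝ), 0 < ε → ε < 1 →
      ∀ (V : Type*) [Fintype V] (sampleOrder tie : V ↪ ℕ) (G : SimpleGraph V) (arrival : V ↪ ℕ),
        1 - 1 / (Fintype.card V : ℝ) ≤
          (aosLaw ε V).real {ω | ∀ p : ENNReal, 1 ≤ p → p ≠ ⊤ →
            cost G p (output sampleOrder tie G arrival ω) ≤
              K / ε ^ 8 * Real.log (Fintype.card V) ^ 4 * OPT G p} ∧
        1 - 1 / (Fintype.card V : ℝ) ≤
          (aosLaw ε V).real {ω |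
            cost G ⊤ (output sampleOrder tie G arrival ω) ≤
              K / ε ^ 6 * Real.log (Fintype.card V) * OPT G ⊤} ∧
        ∫ ω, cost G 1 (output sampleOrder tie G arrival ω) ∂(aosLaw ε V) ≤
          K / ε ^ 6 * OPT G 1 := by
  refine ⟨fun V _ sampleOrder tie => mainAlgorithm_isOnline sampleOrder tie, 100000000,
    by norm_num, fun ε h0 h1 V _ sampleOrder tie G arrival => ⟨?_, ?_, ?_⟩⟩
  · exact le_measureReal_cost h0 h1 sampleOrder tie G arrival
  · exact le_measureReal_cost_top h0 h1 sampleOrder tie G arrival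
  · exact integral_cost_one_le h0 h1 sampleOrder tie G arrival
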